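/- Let $\bar T>0$, $H=L^2[0,\bar T]$ (real) with inner product $\langle\cdot,\cdot\rangle$. Let $\rho:H\to H$ be a Hilbert–Schmidt integral operator, $(\rho x)(v)=\int_0^{\bar T}k(u,v)x(u)\,du$ with $\iint k^2<\infty$, and let $(\varepsilon_t)_{t\in\mathbb Z}$ be a strong $H$-white noise (i.i.d. $H$-valued random variables with mean zero and $0<E\|\varepsilon_t\|^2<\infty$). Suppose that the autoregression $$f_{t+1}=\rho f_t+\varepsilon_t,\qquad \varepsilon_t \text{ uncorrelated with } f_t \qquad (t\in\mathbb Z),$$ defines a weakly stationary $H$-valued process $(f_t)_{t\in\mathbb Z}$, i.e. $(f_t)$ is its unique weakly stationary solution up to a.s. equality (weakly stationary: $E\|f_t\|^2<\infty$, constant mean, covariance and cross-covariance operators depending only on the time lag), and that $E\|f_t\|^4<\infty$. With $m=Ef_t$, put $\Gamma_{11}g=E[\langle f_t-m,g\rangle (f_t-m)]$, $\Gamma_{12}g=E[\langle f_t-m,g\rangle (f_{t+1}-m)]$, $\Gamma_{21}g=E[\langle f_{t+1}-m,g\rangle (f_{t}-m)]$. For the sample $f_1,\dots,f_n$ with mean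 $\bar f=\frac1n\sum_{i=1}^n f_i$, put $$\hat\Gamma_{11}g=\frac1n\sum_{i=1}^n\langle f_i,g\rangle f_i-\langle\bar f,g\rangle\bar f,\qquad \hat\Gamma_{12}g=\frac1{n-1}\sum_{i=1}^{n-1}\langle f_i,g\rangle f_{i+1}-\langle\bar f,g\rangle\bar f,\qquad \hat\Gamma_{21}=\hat\Gamma_{12}^{*}.$$ An eigenvalue of a pencil $A-\lambda B$ is a number $\lambda$ such that $Ax=\lambda Bx$ for some $x\neq0$ (an eigenvector). Eigenvalues are listed in decreasing order with multiplicity: $\lambda$ is the $j$-th eigenvalue if the eigenvectors with eigenvalue $>\lambda$ span a space of dimension $<j$ and those with eigenvalue $\ge\lambda$ span a space of dimension $\ge j$ (possibly infinite). Theorem. Assume that $\Gamma_{11}$ is positive definite ($\langle\Gamma_{11}x,x\rangle>0$ for $x\ne0$) and that the eigenvalues of $\Gamma_{21}\Gamma_{12}-\lambda\Gamma_{11}$, so listed, are distinct. Let $\alpha=\alpha_n>0$ satisfy $\alpha_n\to0$ and $(n/\log n)^{1/2}\alpha_n\to\infty$. Then for every $j=1,2,\dots$ the $j$-th eigenvalue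 $\lambda_j$ of $\Gamma_{21}\Gamma_{12}-\lambda\Gamma_{11}$ and, for every $n$ and every sample, the $j$-th eigenvalue $\hat\lambda_{\alpha j}$ of $\hat\Gamma_{21}\hat\Gamma_{12}-\lambda(\hat\Gamma_{11}+\alpha_n I)$ exist, and: i) $\hat\lambda_{\alpha j}\to\lambda_j$ in probability as $n\to\infty$; ii) if $b_j$ and $\hat b_{\alpha j}$ are corresponding eigenvectors normalised by $\langle\Gamma_{11}b_j,b_j\rangle=1$ and $\langle(\hat\Gamma_{11}+\alpha_n I)\hat b_{\alpha j},\hat b_{\alpha j}\rangle=1$, then for a suitable choice of signs $s_n\in\{1,-1\}$ (depending on the sample), $\langle\Gamma_{11}(s_n\hat b_{\alpha j}-b_j),\,s_n\hat b_{\alpha j}-b_j\rangle\to0$ in probability as $n\to\infty$. -/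

import Mathlib

open MeasureTheory ProbabilityTheory Filter Topology InnerProductSpace

noncomputable section

section Operators

variable {H : Type*} [NormedAddCommGroup H] [InnerProductSpace ℝ H]

/-- The eigenspace of the operator pencil `A - l B` at the number `l`: all `x` with
`A x = l B x`. -/
def pencilEigenspace (A B : H →L[ℝ] H) (l : ℝ) : Submodule ℝ H :=
  LinearMap.ker (A - l • B : H →L[ℝ] H).toLinearMap

lemma mem_pencilEigenspace {A B : H →L[ℝ] H} {l : ℝ} {x : H} :
    x ∈ pencilEigenspace A B l ↔ A x = l • B x := by
  simp [pencilEigenspace, sub_eq_zero]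

/-- `l` is the `j`-th eigenvalue (`j = 1, 2, …`) of the pencil `A - l B` when the eigenvalues are
listed in decreasing order and repeated according to multiplicity: fewer than `j` eigenvalues lie
strictly above `l`, and at least `j` eigenvalues are `≥ l`. The number of eigenvalues in a set is
counted with multiplicity, as the (possibly infinite) dimension of the space spanned by the
corresponding eigenvectors. -/
def IsPencilEigenvalue (A B : H →L[ℝ] H) (j : ℕ) (l : ℝ) : Prop :=
  Module.rank ℝ (⨆ m > l, pencilEigenspace A B m : Submodule ℝ H) < j ∧
    (j : Cardinal) ≤ Module.rank ℝ (⨆ m ≥ l, pencilEigenspace A B m : Submodule ℝ H)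

/-- A number satisfying the definition above is an eigenvalue: it has a nonzero eigenvector. -/
lemma IsPencilEigenvalue.exists_ne_zero {A B : H →L[ℝ] H} {j : ℕ} {l : ℝ}
    (h : IsPencilEigenvalue A B j l) : ∃ x ≠ 0, A x = l • B x := by
  by_contra! hc
  have hbot : pencilEigenspace A B l = ⊥ := by
    rw [Submodule.eq_bot_iff]
    intro x hx
    by_contra hx0
    exact hc x hx0 (mem_pencilEigenspace.1 hx)
  have hle : (⨆ m ≥ l, pencilEigenspace A B m) ≤ ⨆ m > l, pencilEigenspace A B m := by
    refine iSup₂_le fun m hm => ?_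
    rcases eq_or_lt_of_le hm with h1 | h1
    · rw [← h1, hbot]; exact bot_le
    · exact le_iSup₂_of_le m h1 le_rfl
  exact absurd (h.2.trans (Submodule.rank_mono hle)) (not_le.2 h.1)

/-- There is at most one `j`-th eigenvalue. -/
lemma IsPencilEigenvalue.unique {A B : H →L[ℝ] H} {j : ℕ} {l l' : ℝ}
    (h : IsPencilEigenvalue A B j l) (h' : IsPencilEigenvalue A B j l') : l = l' := by
  have key : ∀ {a c : ℝ}, IsPencilEigenvalue A B j a → IsPencilEigenvalue A B j c → ¬ a < c := by
    intro a c ha hc hlt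
    have hle : (⨆ m ≥ c, pencilEigenspace A B m) ≤ ⨆ m > a, pencilEigenspace A B m :=
      iSup₂_le fun m hm => le_iSup₂_of_le m (lt_of_lt_of_le hlt hm) le_rfl
    exact absurd (hc.2.trans (Submodule.rank_mono hle)) (not_le.2 ha.1)
  exact le_antisymm (not_lt.1 (key h' h)) (not_lt.1 (key h h'))

/-- `x` is an eigenvector of the pencil `A - l B` at `l`, normalised by `⟪B x, x⟫ = 1`. -/
def IsNormalizedEigenvector (A B : H →L[ℝ] H) (l : ℝ) (x : H) : Prop :=
  A x = l • B x ∧ ⟪B x, x⟫_ℝ = 1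

end Operators

section Processes

variable {H : Type*} [NormedAddCommGroup H] [InnerProductSpace ℝ H]
  {Ω : Type*} [MeasurableSpace Ω]

/-- The cross-covariance operator `g ↦ E[⟪g, X - E X⟫ (Y - E Y)]` of two `H`-valued random
variables. -/
def crossCov (μ : Measure Ω) (X Y : Ω → H) : H →L[ℝ] H :=
  ∫ ω, rankOne ℝ (Y ω - ∫ ω', Y ω' ∂μ) (X ω - ∫ ω', X ω' ∂μ) ∂μ

lemma crossCov_apply [CompleteSpace H] (μ : Measure Ω) [IsProbabilityMeasure μ] {X Y : Ω → H}
    (hX : MemLp X 2 μ) (hY : MemLp Y 2 μ) (g : H) :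
    crossCov μ X Y g =
      ∫ ω, ⟪X ω - ∫ ω', X ω' ∂μ, g⟫_ℝ • (Y ω - ∫ ω', Y ω' ∂μ) ∂μ := by
  have hX' : MemLp (fun ω => X ω - ∫ ω', X ω' ∂μ) 2 μ := hX.sub (memLp_const _)
  have hY' : MemLp (fun ω => Y ω - ∫ ω', Y ω' ∂μ) 2 μ := hY.sub (memLp_const _)
  have hc : Continuous fun p : H × H => rankOne ℝ p.1 p.2 :=
    ((rankOne (𝕜 := ℝ) (E := H) (F := H)).continuous.comp continuous_fst).clm_apply
      continuous_snd
  have hm := hc.comp_aestronglyMeasurable (hY'.1.prodMk hX'.1)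
  have hi : Integrable
      (fun ω => rankOne ℝ (Y ω - ∫ ω', Y ω' ∂μ) (X ω - ∫ ω', X ω' ∂μ)) μ := by
    refine Integrable.mono' (hY'.norm.integrable_mul hX'.norm) hm ?_
    filter_upwards with ω
    exact (norm_rankOne (𝕜 := ℝ) _ _).le
  rw [crossCov, ContinuousLinearMap.integral_apply hi]
  rfl

/-- Weak stationarity of an `H`-valued process indexed by `ℤ`: finite second moments, constant
mean, and (cross-)covariance operators depending on the time lag only. -/
structure IsWeaklyStationary (μ : Measure Ω) (f : ℤ → Ω → H) : Prop where
  memLp : ∀ t, MemLp (f t) 2 μ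
  mean : ∀ s t, ∫ ω, f s ω ∂μ = ∫ ω, f t ω ∂μ
  cov : ∀ s t h, crossCov μ (f s) (f (s + h)) = crossCov μ (f t) (f (t + h))

/-- Strong `H`-white noise: independent identically distributed `H`-valued random variables with
mean zero and `0 < E‖ε_t‖² < ∞`. -/
structure IsStrongWhiteNoise [MeasurableSpace H] (μ : Measure Ω) (ε : ℤ → Ω → H) : Prop where
  memLp : ∀ t, MemLp (ε t) 2 μ
  pos : ∀ t, 0 < ∫ ω, ‖ε t ω‖ ^ 2 ∂μ
  mean_zero : ∀ t, ∫ ω, ε t ω ∂μ = 0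
  indep : iIndepFun ε μ
  identDistrib : ∀ s t, IdentDistrib (ε s) (ε t) μ μ

/-- `f` is a weakly stationary solution of the autoregression `f_{t+1} = ρ f_t + ε_t`, in which
the innovation `ε_t` is uncorrelated with `f_t`. -/
structure IsStationarySolution (μ : Measure Ω) (ρ : H →L[ℝ] H) (ε f : ℤ → Ω → H) : Prop where
  stationary : IsWeaklyStationary μ f
  recursion : ∀ t, f (t + 1) =ᵐ[μ] fun ω => ρ (f t ω) + ε t ω
  innovation : ∀ t, crossCov μ (f t) (ε t) = 0

/-- The autoregression `f_{t+1} = ρ f_t + ε_t` defines the weakly stationary process `f`: it is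
the only weakly stationary solution, up to almost sure equality at each time. -/
def DefinesStationaryProcess (μ : Measure Ω) (ρ : H →L[ℝ] H) (ε f : ℤ → Ω → H) : Prop :=
  IsStationarySolution μ ρ ε f ∧
    ∀ g : ℤ → Ω → H, IsStationarySolution μ ρ ε g → ∀ t, g t =ᵐ[μ] f t

/-- The sample mean of `f_1, …, f_n`. -/
def sampleMean (f : ℤ → Ω → H) (n : ℕ) (ω : Ω) : H :=
  (1 / (n : ℝ)) • ∑ i ∈ Finset.Icc 1 n, f i ω

/-- The empirical covariance operator
`g ↦ n⁻¹ ∑_{i ≤ n} ⟪f_i, g⟫ f_i - ⟪m, g⟫ m`, where `m` is the sample mean. -/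
def empCov (f : ℤ → Ω → H) (n : ℕ) (ω : Ω) : H →L[ℝ] H :=
  (1 / (n : ℝ)) • ∑ i ∈ Finset.Icc 1 n, rankOne ℝ (f i ω) (f i ω) -
    rankOne ℝ (sampleMean f n ω) (sampleMean f n ω)

/-- The empirical cross-covariance operator
`g ↦ (n - 1)⁻¹ ∑_{i ≤ n - 1} ⟪f_i, g⟫ f_{i+1} - ⟪m, g⟫ m`, where `m` is the sample mean. -/
def empCrossCov (f : ℤ → Ω → H) (n : ℕ) (ω : Ω) : H →L[ℝ] H :=
  (1 / ((n : ℝ) - 1)) • ∑ i ∈ Finset.Icc 1 (n - 1), rankOne ℝ (f (i + 1) ω) (f i ω) -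
    rankOne ℝ (sampleMean f n ω) (sampleMean f n ω)

/-- `Γ₁₁`, the covariance operator of `f_t` (for a weakly stationary process). -/
def covOp (μ : Measure Ω) (f : ℤ → Ω → H) : H →L[ℝ] H := crossCov μ (f 0) (f 0)

/-- `Γ₂₁ Γ₁₂`, where `Γ₁₂ g = E[⟪g, f_t⟫ f_{t+1}]` and `Γ₂₁ g = E[⟪g, f_{t+1}⟫ f_t]` (centred)
are the lag-one cross-covariance operators of a weakly stationary process. -/
def crossCovSq (μ : Measure Ω) (f : ℤ → Ω → H) : H →L[ℝ] H :=
  crossCov μ (f 1) (f 0) ∘L crossCov μ (f 0) (f 1)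

/-- The empirical counterpart of `Γ₂₁ Γ₁₂`; the empirical `Γ₂₁` has the transposed kernel of the
empirical `Γ₁₂`, that is, it is the adjoint operator. -/
def empCrossCovSq [CompleteSpace H] (f : ℤ → Ω → H) (n : ℕ) (ω : Ω) : H →L[ℝ] H :=
  ContinuousLinearMap.adjoint (empCrossCov f n ω) ∘L empCrossCov f n ω

/-- The regularised empirical covariance operator: the empirical `Γ₁₁` plus `a` times the
identity. -/
def regCov (f : ℤ → Ω → H) (n : ℕ) (a : ℝ) (ω : Ω) : H →L[ℝ] H :=
  empCov f n ω + a • ContinuousLinearMap.id ℝ H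

end Processes

/-- Lebesgue measure on the interval `[0, T]`. -/
abbrev intervalMeasure (T : ℝ) : Measure ℝ := volume.restrict (Set.Icc 0 T)

/-- The real Hilbert space `L²[0, T]`. -/
abbrev L2Interval (T : ℝ) : Type := Lp ℝ 2 (intervalMeasure T)

/-- `L²[0, T]` carries its Borel σ-algebra. -/
instance instMeasurableSpaceL2Interval (T : ℝ) : MeasurableSpace (L2Interval T) :=
  borel (L2Interval T)

instance instBorelSpaceL2Interval (T : ℝ) : BorelSpace (L2Interval T) := ⟨rfl⟩

/-- `ρ` is a Hilbert–Schmidt integral operator on `L²[0, T]`: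
`(ρ x)(v) = ∫ k(u, v) x(u) du` with a square-integrable kernel `k`. -/
def IsHilbertSchmidtIntegralOperator (T : ℝ) (ρ : L2Interval T →L[ℝ] L2Interval T) : Prop :=
  ∃ k : ℝ → ℝ → ℝ,
    MemLp (Function.uncurry k) 2 ((intervalMeasure T).prod (intervalMeasure T)) ∧
    ∀ x : L2Interval T, ρ x =ᵐ[intervalMeasure T] fun v => ∫ u, k u v * x u ∂(intervalMeasure T)

end

/-! Because `ε t` is uncorrelated with `f t`, one has Γ₁₂ = ρΓ₁₁. With B = Γ₁₁ the population pencil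
is therefore A = B ρ* ρ B, whose Rayleigh quotient is ‖ρBx‖² / ⟨Bx, x⟩. The regularised empirical
pencil has the same shape A = B R* R B, with R = Γ̂₁₂ (Γ̂₁₁ + α)⁻¹ of finite rank. `IsCompactPencil`
isolates this shape. The form of B need not be bounded below, so vectors of bounded form may be
unbounded in norm; but Bx stays bounded, and compactness of R, applied to Bx, makes Rayleigh suprema
attained (`exists_eigenvector_of_isSup`). Existence of all eigenvalues and both halves of the
min–max principle follow.

Suppose the empirical operators are within eα of the true ones, and put q(x) = ⟨Bx, x⟩ + α‖x‖². The
regularised form is q up to a factor 1 ± e, and as α‖x‖ ≤ √q for α ≤ 1, the roots satisfy ‖R̂B̂x -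
RBx‖ ≤ e√q. All errors are thus relative, and a min–max comparison bounds √λ̂ in terms of √λ from
both sides. The bias α‖x‖² is harmless on a fixed finite-dimensional space of eigenvectors. An
empirical eigenvector loses its components along higher eigenvectors by testing its equation, and
the remaining ones by an energy argument that uses the gap to the next eigenvalue
(`tendsto_eigenvector`).

It remains to show that the errors are o(α) in probability; they are O(n^(-1/2)). The decay ρᵏ → 0
is not assumed but extracted from uniqueness of the stationary solution
(`DefinesStationaryProcess.tendsto_norm_pow`): ρ* does not increase the form of Γ₁₁, a strong limit
L of its powers along an ultrafilter has an adjoint that kills the noise, so f + L*f is again a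
stationary solution and L = 0. Then `f t` is a limit of finite sums of past innovations, which
upgrades "uncorrelated" to "independent", and the ε_t ⊗ f_t are orthogonal in the Hilbert tensor
square. Summing the recursion for f ⊗ f gives a Lyapunov equation W = ρWρ* + O(√n), inverted by
`exists_norm_le_of_eq_comp_add`.

The deterministic and random parts are joined by a filter on ℕ × Ω that says "n is large and the
error is small". -/

noncomputable section

/-! ### Rayleigh quotients of compact pencils -/

section Pencils

variable {H : Type*} [NormedAddCommGroup H] [InnerProductSpace ℝ H]

/-- `x` is orthogonal to `W` for the bilinear form of `B`. -/
def FormOrthogonal (B : H →L[ℝ] H) (W : Submodule ℝ H) : Submodule ℝ H where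
  carrier := {x | ∀ w ∈ W, ⟪B x, w⟫_ℝ = 0}
  add_mem' := fun {x y} hx hy w hw => by
    rw [map_add, inner_add_left, hx w hw, hy w hw, add_zero]
  zero_mem' := fun w _ => by simp
  smul_mem' := fun c x hx w hw => by
    rw [map_smul, real_inner_smul_left, hx w hw, mul_zero]

lemma mem_formOrthogonal {B : H →L[ℝ] H} {W : Submodule ℝ H} {x : H} :
    x ∈ FormOrthogonal B W ↔ ∀ w ∈ W, ⟪B x, w⟫_ℝ = 0 := Iff.rfl

/-- Cauchy–Schwarz for the quadratic form of an operator that is symmetric and nonnegative on a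
subspace. -/
lemma inner_sq_le_of_nonneg_on (Q : H →L[ℝ] H) (X : Submodule ℝ H)
    (hsymm : ∀ x y, ⟪Q x, y⟫_ℝ = ⟪x, Q y⟫_ℝ) (hnn : ∀ x ∈ X, 0 ≤ ⟪Q x, x⟫_ℝ) {x y : H}
    (hx : x ∈ X) (hy : y ∈ X) :
    ⟪Q x, y⟫_ℝ ^ 2 ≤ ⟪Q x, x⟫_ℝ * ⟪Q y, y⟫_ℝ := by
  have hs : ⟪Q y, x⟫_ℝ = ⟪Q x, y⟫_ℝ := by rw [hsymm, real_inner_comm]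
  have key : ∀ t : ℝ, 0 ≤ ⟪Q y, y⟫_ℝ * (t * t) + (2 * ⟪Q x, y⟫_ℝ) * t + ⟪Q x, x⟫_ℝ := by
    intro t
    have h := hnn (x + t • y) (X.add_mem hx (X.smul_mem t hy))
    simp only [map_add, map_smul, inner_add_left, inner_add_right, real_inner_smul_left,
      real_inner_smul_right, hs] at h
    linarith
  have := discrim_le_zero key
  rw [discrim] at this
  nlinarith

/-- With respect to a positive definite form, every vector splits along a finite-dimensional
subspace. -/
lemma exists_sub_mem_formOrthogonal {B : H →L[ℝ] H} (hpos : ∀ x, x ≠ 0 → 0 < ⟪B x, x⟫_ℝ)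
    (W : Submodule ℝ H) [FiniteDimensional ℝ W] (x : H) :
    ∃ w ∈ W, x - w ∈ FormOrthogonal B W := by
  let Φ : H →ₗ[ℝ] Module.Dual ℝ W :=
    { toFun := fun x => (innerₛₗ ℝ (B x)).comp W.subtype
      map_add' := fun x y => by ext w; simp
      map_smul' := fun c x => by ext w; simp }
  have hΦ : ∀ x (w : W), Φ x w = ⟪B x, (w : H)⟫_ℝ := fun x w => rfl
  -- Positivity makes the form nondegenerate on `W`; finite dimension then represents every
  -- functional on `W`, so no completeness for the form is needed.
  have hinj : Function.Injective (Φ.comp W.subtype) := by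
    rw [← LinearMap.ker_eq_bot, LinearMap.ker_eq_bot']
    intro w hw
    by_contra hne
    have h1 := hpos (w : H) (by simpa using hne)
    have h2 : Φ w w = 0 := by
      have := LinearMap.congr_fun hw w
      simpa using this
    rw [hΦ] at h2
    exact h1.ne' h2
  have hsurj : Function.Surjective (Φ.comp W.subtype) :=
    (LinearMap.injective_iff_surjective_of_finrank_eq_finrank
      (Subspace.dual_finrank_eq).symm).1 hinj
  obtain ⟨w, hw⟩ := hsurj (Φ x)
  refine ⟨w, w.2, fun v hv => ?_⟩
  have h3 := LinearMap.congr_fun hw ⟨v, hv⟩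
  simp only [LinearMap.comp_apply, Submodule.subtype_apply, hΦ] at h3
  rw [map_sub, inner_sub_left, h3, sub_self]

variable [CompleteSpace H]

/-- A symmetric pencil `A - l B` with `B` positive definite and `A = B R* R B` for a compact
operator `R`. -/
structure IsCompactPencil (A B R : H →L[ℝ] H) : Prop where
  symm : ∀ x y, ⟪B x, y⟫_ℝ = ⟪x, B y⟫_ℝ
  pos : ∀ x, x ≠ 0 → 0 < ⟪B x, x⟫_ℝ
  compact : IsCompactOperator R
  factor : ∀ x, A x = B (ContinuousLinearMap.adjoint R (R (B x)))

namespace IsCompactPencil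

variable {A B R : H →L[ℝ] H}

lemma nonneg (h : IsCompactPencil A B R) (x : H) : 0 ≤ ⟪B x, x⟫_ℝ := by
  by_cases hx : x = 0
  · simp [hx]
  · exact (h.pos x hx).le

lemma inner_left (h : IsCompactPencil A B R) (x y : H) :
    ⟪A x, y⟫_ℝ = ⟪R (B x), R (B y)⟫_ℝ := by
  rw [h.factor, h.symm, ContinuousLinearMap.adjoint_inner_left]

lemma inner_self (h : IsCompactPencil A B R) (x : H) : ⟪A x, x⟫_ℝ = ‖R (B x)‖ ^ 2 := by
  rw [h.inner_left, real_inner_self_eq_norm_sq]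

lemma symm_left (h : IsCompactPencil A B R) (x y : H) : ⟪A x, y⟫_ℝ = ⟪x, A y⟫_ℝ := by
  rw [h.inner_left, real_inner_comm (A y) x, h.inner_left, real_inner_comm]

lemma inner_sq_le (h : IsCompactPencil A B R) (x y : H) :
    ⟪B x, y⟫_ℝ ^ 2 ≤ ⟪B x, x⟫_ℝ * ⟪B y, y⟫_ℝ :=
  inner_sq_le_of_nonneg_on B ⊤ h.symm (fun x _ => h.nonneg x) trivial trivial

/-- Cauchy–Schwarz for the form, applied to `x` and `B x`. The form thus controls `B x`, although it
need not control `x`. -/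
lemma norm_sq_le (h : IsCompactPencil A B R) (x : H) : ‖B x‖ ^ 2 ≤ ‖B‖ * ⟪B x, x⟫_ℝ := by
  by_cases hx : B x = 0
  · simp [hx]
  have h1 := h.inner_sq_le x (B x)
  have h2 : ⟪B (B x), B x⟫_ℝ ≤ ‖B‖ * ‖B x‖ ^ 2 := by
    calc ⟪B (B x), B x⟫_ℝ ≤ ‖B (B x)‖ * ‖B x‖ := real_inner_le_norm _ _
      _ ≤ (‖B‖ * ‖B x‖) * ‖B x‖ := by gcongr; exact B.le_opNorm _
      _ = _ := by ring
  rw [real_inner_self_eq_norm_sq] at h1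
  have h3 : 0 < ‖B x‖ ^ 2 := by positivity
  have h4 : ‖B x‖ ^ 2 * ‖B x‖ ^ 2 ≤ (‖B‖ * ⟪B x, x⟫_ℝ) * ‖B x‖ ^ 2 := by
    nlinarith [h.nonneg x]
  exact le_of_mul_le_mul_right h4 h3

lemma inner_self_le (h : IsCompactPencil A B R) (x : H) :
    ⟪A x, x⟫_ℝ ≤ (‖R‖ ^ 2 * ‖B‖) * ⟪B x, x⟫_ℝ := by
  rw [h.inner_self]
  calc ‖R (B x)‖ ^ 2 ≤ (‖R‖ * ‖B x‖) ^ 2 := by gcongr; exact R.le_opNorm _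
    _ = ‖R‖ ^ 2 * ‖B x‖ ^ 2 := by ring
    _ ≤ ‖R‖ ^ 2 * (‖B‖ * ⟪B x, x⟫_ℝ) := by gcongr; exact h.norm_sq_le x
    _ = _ := by ring

/-- The supremum of the Rayleigh quotient on the orthogonal complement of a finite-dimensional
invariant subspace is attained at an eigenvector, if it is positive. -/
lemma exists_eigenvector_of_isSup (h : IsCompactPencil A B R) (W : Submodule ℝ H)
    [FiniteDimensional ℝ W]
    (hW : ∀ x ∈ FormOrthogonal B W, ∀ w ∈ W, ⟪A x, w⟫_ℝ = 0) {κ : ℝ} (hκ : 0 < κ)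
    (hub : ∀ x ∈ FormOrthogonal B W, ⟪A x, x⟫_ℝ ≤ κ * ⟪B x, x⟫_ℝ)
    (hsup : ∀ t < κ, ∃ x ∈ FormOrthogonal B W, t * ⟪B x, x⟫_ℝ < ⟪A x, x⟫_ℝ) :
    ∃ y ≠ 0, A y = κ • B y ∧ y ∈ FormOrthogonal B W := by
  have hseq : ∀ n : ℕ, ∃ x ∈ FormOrthogonal B W, ⟪B x, x⟫_ℝ = 1 ∧
      κ - 1 / ((n : ℝ) + 1) < ⟪A x, x⟫_ℝ := by
    intro n
    obtain ⟨x, hx, hlt⟩ := hsup (κ - 1 / ((n : ℝ) + 1)) (by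
      have : (0 : ℝ) < 1 / ((n : ℝ) + 1) := by positivity
      linarith)
    have hx0 : x ≠ 0 := by rintro rfl; simp at hlt
    have hb := h.pos x hx0
    set c := (Real.sqrt ⟪B x, x⟫_ℝ)⁻¹ with hc
    have hc2 : c * c * ⟪B x, x⟫_ℝ = 1 := by
      rw [hc, ← mul_inv, Real.mul_self_sqrt hb.le, inv_mul_cancel₀ hb.ne']
    have hc0 : 0 < c * c := by
      have : 0 < c := inv_pos.2 (Real.sqrt_pos.2 hb)
      positivity
    refine ⟨c • x, (FormOrthogonal B W).smul_mem c hx, ?_, ?_⟩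
    · rw [map_smul, real_inner_smul_left, real_inner_smul_right, ← mul_assoc, hc2]
    · rw [map_smul, real_inner_smul_left, real_inner_smul_right, ← mul_assoc]
      have h1 := mul_lt_mul_of_pos_left hlt hc0
      rwa [mul_left_comm, hc2, mul_one] at h1
  choose x hxW hxB hxA using hseq
  have hbd : ∀ n, ‖B (x n)‖ ≤ Real.sqrt ‖B‖ := by
    intro n
    apply Real.le_sqrt_of_sq_le
    simpa [hxB n] using h.norm_sq_le (x n)
  -- The maximising sequence is normalised for the form only, so compactness of `R` is applied to
  -- the bounded sequence `B (x n)`.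
  obtain ⟨K, hK, hKsub⟩ := h.compact.image_closedBall_subset_compact (f := (R : H →ₗ[ℝ] H))
    (Real.sqrt ‖B‖)
  have hmem : ∀ n, R (B (x n)) ∈ K := fun n =>
    hKsub ⟨B (x n), by simpa using hbd n, rfl⟩
  obtain ⟨z, -, φ, hφ, hz⟩ := hK.tendsto_subseq hmem
  have hφt : Tendsto φ atTop atTop := hφ.tendsto_atTop
  -- `κ B x_n - A x_n` tends to zero
  set Q : H →L[ℝ] H := κ • B - A with hQ
  have hQx : ∀ x, Q x = κ • B x - A x := fun x => by simp [hQ]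
  have hQs : ∀ x y, ⟪Q x, y⟫_ℝ = ⟪x, Q y⟫_ℝ := by
    intro x y
    rw [hQx, hQx, inner_sub_left, inner_sub_right, real_inner_smul_left, real_inner_smul_right,
      h.symm, h.symm_left]
  have hQq : ∀ x, ⟪Q x, x⟫_ℝ = κ * ⟪B x, x⟫_ℝ - ⟪A x, x⟫_ℝ := by
    intro x; rw [hQx, inner_sub_left, real_inner_smul_left]
  have hQn : ∀ x ∈ FormOrthogonal B W, 0 ≤ ⟪Q x, x⟫_ℝ := fun x hx => by
    rw [hQq]; linarith [hub x hx]
  -- `Q` is nonnegative only on the complement of `W`, so Cauchy–Schwarz is used with the component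
  -- `r` of `Q (x n)` there. The other component `w` is invisible, since `Q (x n)` is orthogonal to
  -- `W`.
  have hest : ∀ n, ‖Q (x n)‖ ^ 2 ≤ κ * ‖B‖ * (1 / ((n : ℝ) + 1)) := by
    intro n
    obtain ⟨w, hw, hr⟩ := exists_sub_mem_formOrthogonal h.pos W (Q (x n))
    set r := Q (x n) - w with hrdef
    have h1 : ⟪Q (x n), w⟫_ℝ = 0 := by
      rw [hQx, inner_sub_left, real_inner_smul_left, hxW n w hw, hW _ (hxW n) w hw]; simp
    have h2 : ‖Q (x n)‖ ^ 2 = ⟪Q (x n), r⟫_ℝ := by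
      rw [hrdef, inner_sub_right, h1, sub_zero, real_inner_self_eq_norm_sq]
    have h3 := inner_sq_le_of_nonneg_on Q _ hQs hQn (hxW n) hr
    have h4 : ⟪Q (x n), x n⟫_ℝ ≤ 1 / ((n : ℝ) + 1) := by
      rw [hQq, hxB n]; linarith [hxA n]
    have h5 : ⟪Q r, r⟫_ℝ ≤ κ * ⟪B r, r⟫_ℝ := by
      rw [hQq, h.inner_self]; linarith [sq_nonneg ‖R (B r)‖]
    have h6 : ⟪B r, r⟫_ℝ ≤ ⟪B (Q (x n)), Q (x n)⟫_ℝ := by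
      have hsum : Q (x n) = w + r := by rw [hrdef]; abel
      have hrw : ⟪B r, w⟫_ℝ = 0 := hr w hw
      have hwr : ⟪B w, r⟫_ℝ = 0 := by rw [h.symm, real_inner_comm, hrw]
      have e : ⟪B (Q (x n)), Q (x n)⟫_ℝ = ⟪B w, w⟫_ℝ + ⟪B r, r⟫_ℝ := by
        conv_lhs => rw [hsum]
        rw [map_add, inner_add_left, inner_add_right, inner_add_right, hrw, hwr]; ring
      rw [e]; linarith [h.nonneg w]
    have h7 : ⟪B (Q (x n)), Q (x n)⟫_ℝ ≤ ‖B‖ * ‖Q (x n)‖ ^ 2 := by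
      calc _ ≤ ‖B (Q (x n))‖ * ‖Q (x n)‖ := real_inner_le_norm _ _
        _ ≤ (‖B‖ * ‖Q (x n)‖) * ‖Q (x n)‖ := by gcongr; exact B.le_opNorm _
        _ = _ := by ring
    rw [← h2] at h3
    by_cases hz : ‖Q (x n)‖ ^ 2 = 0
    · rw [hz]; positivity
    have hzp : 0 < ‖Q (x n)‖ ^ 2 := lt_of_le_of_ne (sq_nonneg _) (Ne.symm hz)
    have h8 : ⟪Q r, r⟫_ℝ ≤ κ * (‖B‖ * ‖Q (x n)‖ ^ 2) :=
      h5.trans (mul_le_mul_of_nonneg_left (h6.trans h7) hκ.le)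
    have h9 : ⟪Q (x n), x n⟫_ℝ * ⟪Q r, r⟫_ℝ ≤
        1 / ((n : ℝ) + 1) * (κ * (‖B‖ * ‖Q (x n)‖ ^ 2)) :=
      mul_le_mul h4 h8 (hQn r hr) (by positivity)
    have h10 : ‖Q (x n)‖ ^ 2 * ‖Q (x n)‖ ^ 2 ≤
        (κ * ‖B‖ * (1 / ((n : ℝ) + 1))) * ‖Q (x n)‖ ^ 2 := by
      nlinarith
    exact le_of_mul_le_mul_right h10 hzp
  have hQ0 : Tendsto (fun n => Q (x n)) atTop (𝓝 0) := by
    rw [tendsto_zero_iff_norm_tendsto_zero]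
    have h1 : Tendsto (fun n => ‖Q (x n)‖ ^ 2) atTop (𝓝 0) := by
      refine squeeze_zero (fun n => sq_nonneg _) hest ?_
      simpa using tendsto_one_div_add_atTop_nhds_zero_nat.const_mul (κ * ‖B‖)
    have h2 := (Real.continuous_sqrt.tendsto _).comp h1
    rw [Real.sqrt_zero] at h2
    exact h2.congr fun n => Real.sqrt_sq (norm_nonneg _)
  -- `x n` itself need not converge. Reading κ B x ≈ B R* R B x as x ≈ κ⁻¹ R* R B x suggests the
  -- limit vector.
  set y : H := κ⁻¹ • ContinuousLinearMap.adjoint R z with hy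
  -- `B x_{φ n}` tends to `B y`
  have hBx : ∀ n, B (x n) = κ⁻¹ • Q (x n) +
      B (κ⁻¹ • ContinuousLinearMap.adjoint R (R (B (x n)))) := by
    intro n
    rw [map_smul, ← h.factor, hQx, smul_sub, smul_smul, inv_mul_cancel₀ hκ.ne', one_smul]
    abel
  have hBlim : Tendsto (fun n => B (x (φ n))) atTop (𝓝 (B y)) := by
    have h1 : Tendsto (fun n => κ⁻¹ • Q (x (φ n))) atTop (𝓝 (κ⁻¹ • (0 : H))) :=
      (hQ0.comp hφt).const_smul κ⁻¹
    have h2 : Tendsto (fun n => B (κ⁻¹ • ContinuousLinearMap.adjoint R (R (B (x (φ n))))))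
        atTop (𝓝 (B y)) := by
      have hc : Continuous fun u => B (κ⁻¹ • ContinuousLinearMap.adjoint R u) := by fun_prop
      exact (hc.tendsto z).comp hz
    have h3 := h1.add h2
    rw [smul_zero, zero_add] at h3
    exact h3.congr fun n => (hBx (φ n)).symm
  have hzeq : z = R (B y) := tendsto_nhds_unique hz ((R.continuous.tendsto _).comp hBlim)
  have hyA : A y = κ • B y := by
    rw [h.factor, ← hzeq, ← map_smul B, hy, smul_smul, mul_inv_cancel₀ hκ.ne', one_smul]
  have hznorm : ‖z‖ ^ 2 = κ := by
    have h1 : Tendsto (fun n => ‖R (B (x (φ n)))‖ ^ 2) atTop (𝓝 (‖z‖ ^ 2)) :=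
      (hz.norm).pow 2
    have h2 : Tendsto (fun n => ‖R (B (x n))‖ ^ 2) atTop (𝓝 κ) := by
      refine tendsto_of_tendsto_of_tendsto_of_le_of_le (g := fun n : ℕ => κ - 1 / ((n : ℝ) + 1))
        (h := fun _ => κ) ?_ tendsto_const_nhds ?_ ?_
      · simpa using tendsto_one_div_add_atTop_nhds_zero_nat.const_sub κ
      · intro n; have := hxA n; rw [h.inner_self] at this; exact this.le
      · intro n; have := hub _ (hxW n); rw [h.inner_self, hxB n, mul_one] at this; exact this
    exact tendsto_nhds_unique h1 (h2.comp hφt)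
  refine ⟨y, ?_, hyA, ?_⟩
  · intro h0
    rw [hzeq, h0] at hznorm
    simp at hznorm
    exact hκ.ne hznorm
  · intro w hw
    have h1 : Tendsto (fun n => ⟪B (x (φ n)), w⟫_ℝ) atTop (𝓝 ⟪B y, w⟫_ℝ) :=
      hBlim.inner tendsto_const_nhds
    refine tendsto_nhds_unique h1 ?_
    simp only [hxW _ w hw, tendsto_const_nhds]

/-- The Rayleigh quotient on the orthogonal complement of a finite-dimensional invariant
subspace has a supremum, which is zero or attained at an eigenvector. -/
lemma exists_sup (h : IsCompactPencil A B R) (W : Submodule ℝ H) [FiniteDimensional ℝ W]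
    (hW : ∀ x ∈ FormOrthogonal B W, ∀ w ∈ W, ⟪A x, w⟫_ℝ = 0) :
    ∃ κ : ℝ, 0 ≤ κ ∧ (∀ x ∈ FormOrthogonal B W, ⟪A x, x⟫_ℝ ≤ κ * ⟪B x, x⟫_ℝ) ∧
      (0 < κ → ∃ y ≠ 0, A y = κ • B y ∧ y ∈ FormOrthogonal B W) := by
  -- Adjoining 0 keeps the set nonempty when the complement is trivial, and makes the supremum
  -- nonnegative.
  set S : Set ℝ := insert 0 {t | ∃ x ∈ FormOrthogonal B W, x ≠ 0 ∧
    t = ⟪A x, x⟫_ℝ / ⟪B x, x⟫_ℝ} with hS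
  have hbdd : BddAbove S := by
    refine ⟨‖R‖ ^ 2 * ‖B‖, ?_⟩
    rintro t (rfl | ⟨x, -, hx0, rfl⟩)
    · positivity
    · rw [div_le_iff₀ (h.pos x hx0)]; exact h.inner_self_le x
  have hub : ∀ x ∈ FormOrthogonal B W, ⟪A x, x⟫_ℝ ≤ sSup S * ⟪B x, x⟫_ℝ := by
    intro x hx
    by_cases hx0 : x = 0
    · simp [hx0]
    · rw [← div_le_iff₀ (h.pos x hx0)]
      exact le_csSup hbdd (Or.inr ⟨x, hx, hx0, rfl⟩)
  refine ⟨sSup S, le_csSup hbdd (Or.inl rfl), hub, fun hpos => ?_⟩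
  refine h.exists_eigenvector_of_isSup W hW hpos hub fun t ht => ?_
  -- Exceeding 0 as well as `t` excludes the adjoined element.
  obtain ⟨s, hs, hlt⟩ := exists_lt_of_lt_csSup (s := S) ⟨0, Or.inl rfl⟩ (max_lt ht hpos)
  rcases hs with rfl | ⟨x, hx, hx0, rfl⟩
  · exact absurd hlt (not_lt.2 (le_max_right _ _))
  · refine ⟨x, hx, ?_⟩
    rw [← lt_div_iff₀ (h.pos x hx0)]
    exact (le_max_left _ _).trans_lt hlt

end IsCompactPencil
end Pencils

/-! ### Existence and variational bounds for the listed eigenvalues -/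

section PencilEigenvalues

variable {H : Type*} [NormedAddCommGroup H] [InnerProductSpace ℝ H]

/-- The span of the eigenvectors of the pencil `A - l B` with eigenvalue above `l`. -/
abbrev eigenspanGT (A B : H →L[ℝ] H) (l : ℝ) : Submodule ℝ H := ⨆ m > l, pencilEigenspace A B m

/-- The span of the eigenvectors of the pencil `A - l B` with eigenvalue at least `l`. -/
abbrev eigenspanGE (A B : H →L[ℝ] H) (l : ℝ) : Submodule ℝ H := ⨆ m ≥ l, pencilEigenspace A B m

lemma pencilEigenspace_le_eigenspanGT {A B : H →L[ℝ] H} {l m : ℝ} (h : l < m) :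
    pencilEigenspace A B m ≤ eigenspanGT A B l :=
  le_iSup₂_of_le m h le_rfl

lemma pencilEigenspace_le_eigenspanGE {A B : H →L[ℝ] H} {l m : ℝ} (h : l ≤ m) :
    pencilEigenspace A B m ≤ eigenspanGE A B l :=
  le_iSup₂_of_le m h le_rfl

lemma eigenspanGT_anti {A B : H →L[ℝ] H} {l m : ℝ} (h : l ≤ m) :
    eigenspanGT A B m ≤ eigenspanGT A B l :=
  iSup₂_le fun _ hk => pencilEigenspace_le_eigenspanGT (h.trans_lt hk)

/-- A vector of the span involves finitely many eigenvalues, all strictly above `l`, so the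
threshold can be raised a little. -/
lemma eventually_mem_eigenspanGT {A B : H →L[ℝ] H} {l : ℝ} {x : H} (hx : x ∈ eigenspanGT A B l) :
    ∀ᶠ t in 𝓝[>] l, x ∈ eigenspanGT A B t := by
  induction hx using Submodule.iSup_induction' with
  | mem m x hx =>
    by_cases hm : m > l
    · simp only [hm, iSup_pos] at hx
      filter_upwards [Ioo_mem_nhdsGT hm] with t ht
      exact pencilEigenspace_le_eigenspanGT ht.2 hx
    · simp only [hm, iSup_neg, not_false_eq_true, Submodule.mem_bot] at hx
      simp [hx]
  | zero => simp
  | add y z _ _ hy hz =>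
    filter_upwards [hy, hz] with t h1 h2
    exact Submodule.add_mem _ h1 h2

/-- A subspace of larger dimension than `W` meets the orthogonal complement of `W`. -/
lemma exists_mem_formOrthogonal_of_rank_lt {B : H →L[ℝ] H} {V W : Submodule ℝ H}
    [FiniteDimensional ℝ W] (h : Module.rank ℝ W < Module.rank ℝ V) :
    ∃ x ∈ V, x ≠ 0 ∧ x ∈ FormOrthogonal B W := by
  by_contra! hc
  let Φ : V →ₗ[ℝ] Module.Dual ℝ W :=
    { toFun := fun x => (innerₛₗ ℝ (B x)).comp W.subtype
      map_add' := fun x y => by ext w; simp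
      map_smul' := fun c x => by ext w; simp }
  have hinj : Function.Injective Φ := by
    rw [← LinearMap.ker_eq_bot, LinearMap.ker_eq_bot']
    intro x hx
    by_contra hne
    exact hc x x.2 (by simpa using hne) fun w hw => LinearMap.congr_fun hx ⟨w, hw⟩
  have h1 := LinearMap.lift_rank_le_of_injective Φ hinj
  simp only [Cardinal.lift_id] at h1
  have h2 : Module.rank ℝ (Module.Dual ℝ W) = Module.rank ℝ W := by
    rw [← Module.finrank_eq_rank, Subspace.dual_finrank_eq, Module.finrank_eq_rank]
  exact absurd (h1.trans_eq h2) (not_le.2 h)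

/-- Spans of eigenvectors may be infinite-dimensional, for instance at the eigenvalue 0; min–max
arguments need a test space of dimension exactly `j`. -/
lemma exists_finiteDimensional_le_of_le_rank {W : Submodule ℝ H} {j : ℕ}
    (h : (j : Cardinal) ≤ Module.rank ℝ W) :
    ∃ V ≤ W, FiniteDimensional ℝ V ∧ Module.rank ℝ V = j := by
  obtain ⟨s, hs, hli⟩ := le_rank_iff_exists_linearIndependent_finset.1 h
  have hli' : LinearIndependent ℝ (fun x : s => ((x : W) : H)) :=
    hli.map' W.subtype (Submodule.ker_subtype W)
  refine ⟨Submodule.span ℝ (Set.range fun x : s => ((x : W) : H)), ?_, ?_, ?_⟩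
  · rw [Submodule.span_le]
    rintro _ ⟨x, rfl⟩
    exact (x : W).2
  · exact FiniteDimensional.span_of_finite ℝ (Set.finite_range _)
  · rw [rank_span hli', Cardinal.mk_range_eq _ hli'.injective, Cardinal.mk_coe_finset, hs]

lemma finiteDimensional_of_rank_lt {W : Submodule ℝ H} {j : ℕ}
    (h : Module.rank ℝ W < j) : FiniteDimensional ℝ W :=
  Module.rank_lt_aleph0_iff.1 (h.trans (Cardinal.natCast_lt_aleph0))

/-- Right-continuity of the counting function: `j` independent vectors in the span above `l` already
lie in the span above some `t > l`. -/
lemma rank_eigenspanGT_lt_of_forall_gt {A B : H →L[ℝ] H} {j : ℕ} {l : ℝ}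
    (hT : ∀ t > l, ∃ t' < t, Module.rank ℝ (eigenspanGT A B t') < j) :
    Module.rank ℝ (eigenspanGT A B l) < j := by
  by_contra hc
  obtain ⟨s, hs, hli⟩ := le_rank_iff_exists_linearIndependent_finset.1 (not_lt.1 hc)
  have hev : ∀ᶠ t in 𝓝[>] l, ∀ x ∈ s, (x : H) ∈ eigenspanGT A B t := by
    rw [Filter.eventually_all_finset]
    exact fun x _ => eventually_mem_eigenspanGT x.2
  obtain ⟨t, ht, htl⟩ := (hev.and self_mem_nhdsWithin).exists
  obtain ⟨t', ht't, hr⟩ := hT t htl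
  have hli' : LinearIndependent ℝ (fun x : s => (⟨x, ht x x.2⟩ : eigenspanGT A B t)) := by
    have h1 : LinearIndependent ℝ (fun x : s => ((x : eigenspanGT A B l) : H)) :=
      hli.map' (eigenspanGT A B l).subtype (Submodule.ker_subtype _)
    exact LinearIndependent.of_comp (eigenspanGT A B t).subtype h1
  have h2 := hli'.cardinal_le_rank
  rw [Cardinal.mk_coe_finset, hs] at h2
  exact absurd (h2.trans (Submodule.rank_mono (eigenspanGT_anti ht't.le))) (not_le.2 hr)

variable [CompleteSpace H]

namespace IsCompactPencil

variable {A B R : H →L[ℝ] H}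

lemma inner_eq_zero_of_ne (h : IsCompactPencil A B R) {l m : ℝ} (hlm : l ≠ m) {x y : H}
    (hx : x ∈ pencilEigenspace A B l) (hy : y ∈ pencilEigenspace A B m) : ⟪B x, y⟫_ℝ = 0 := by
  rw [mem_pencilEigenspace] at hx hy
  have h1 : l * ⟪B x, y⟫_ℝ = m * ⟪B x, y⟫_ℝ := by
    rw [← real_inner_smul_left, ← hx, h.symm_left, hy, real_inner_smul_right, h.symm]
  have h2 : (l - m) * ⟪B x, y⟫_ℝ = 0 := by linarith
  exact (mul_eq_zero.1 h2).resolve_left (sub_ne_zero.2 hlm)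

/-- On an eigenvector the forms of `A` and `B` are proportional, so orthogonality for `B` implies
orthogonality for `A`. This is the invariance that `exists_sup` asks for. -/
lemma inner_apply_eq_zero (h : IsCompactPencil A B R) {p : ℝ → Prop} {x : H}
    (hx : x ∈ FormOrthogonal B (⨆ (m) (_ : p m), pencilEigenspace A B m)) :
    ∀ w ∈ ⨆ (m) (_ : p m), pencilEigenspace A B m, ⟪A x, w⟫_ℝ = 0 := by
  intro w hw
  induction hw using Submodule.iSup_induction' with
  | mem m w hw =>
    by_cases hm : p m
    · have h1 := hx w (Submodule.mem_iSup_of_mem m hw)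
      simp only [hm, iSup_pos] at hw
      rw [h.symm_left, mem_pencilEigenspace.1 hw, real_inner_smul_right, ← h.symm, h1, mul_zero]
    · simp only [hm, iSup_neg, not_false_eq_true, Submodule.mem_bot] at hw
      simp [hw]
  | zero => simp
  | add y z _ _ hy hz => rw [inner_add_right, hy, hz, add_zero]

lemma eq_zero_of_mem_of_mem_orthogonal (h : IsCompactPencil A B R) {W : Submodule ℝ H} {x : H}
    (hx : x ∈ W) (hx' : x ∈ FormOrthogonal B W) : x = 0 := by
  by_contra h0
  exact (h.pos x h0).ne' (hx' x hx)

/-- The Rayleigh quotient on the span of the eigenvectors with eigenvalue `≥ l` is `≥ l`. -/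
lemma le_inner_of_mem_eigenspanGE (h : IsCompactPencil A B R) {l : ℝ} {x : H}
    (hx : x ∈ eigenspanGE A B l) : l * ⟪B x, x⟫_ℝ ≤ ⟪A x, x⟫_ℝ := by
  rw [Submodule.mem_iSup_iff_exists_finsupp] at hx
  obtain ⟨g, hg, rfl⟩ := hx
  have hg' : ∀ m, g m = 0 ∨ (l ≤ m ∧ g m ∈ pencilEigenspace A B m) := by
    intro m
    have := hg m
    by_cases hm : m ≥ l
    · simp only [hm, iSup_pos] at this; exact Or.inr ⟨hm, this⟩
    · simp only [hm, iSup_neg, not_false_eq_true, Submodule.mem_bot] at this; exact Or.inl this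
  have hB : ∀ m, ∀ m', m' ≠ m → ⟪B (g m), g m'⟫_ℝ = 0 := by
    intro m m' hne
    rcases hg' m with h0 | ⟨-, h1⟩
    · simp [h0]
    rcases hg' m' with h0 | ⟨-, h2⟩
    · simp [h0]
    exact h.inner_eq_zero_of_ne hne.symm h1 h2
  have hA : ∀ m, A (g m) = m • B (g m) := by
    intro m
    rcases hg' m with h0 | ⟨-, h1⟩
    · simp [h0]
    · exact mem_pencilEigenspace.1 h1
  have e1 : ⟪B (g.sum fun _ x => x), g.sum fun _ x => x⟫_ℝ =
      ∑ m ∈ g.support, ⟪B (g m), g m⟫_ℝ := by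
    simp only [Finsupp.sum, map_sum, sum_inner, inner_sum]
    refine Finset.sum_congr rfl fun m hm => ?_
    exact Finset.sum_eq_single_of_mem m hm fun m' _ hne => hB m' m hne.symm
  have e2 : ⟪A (g.sum fun _ x => x), g.sum fun _ x => x⟫_ℝ =
      ∑ m ∈ g.support, m * ⟪B (g m), g m⟫_ℝ := by
    simp only [Finsupp.sum, map_sum, sum_inner, inner_sum, hA, real_inner_smul_left]
    refine Finset.sum_congr rfl fun m hm => ?_
    exact Finset.sum_eq_single_of_mem m hm fun m' _ hne => by rw [hB m' m hne.symm, mul_zero]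
  rw [e1, e2, Finset.mul_sum]
  refine Finset.sum_le_sum fun m _ => ?_
  rcases hg' m with h0 | ⟨hm, -⟩
  · simp [h0]
  · exact mul_le_mul_of_nonneg_right hm (h.nonneg _)

lemma pencilEigenspace_le_formOrthogonal (h : IsCompactPencil A B R) {l m : ℝ} (hml : m < l) :
    pencilEigenspace A B m ≤ FormOrthogonal B (eigenspanGE A B l) := by
  intro x hx
  rw [mem_formOrthogonal]
  intro w hw
  induction hw using Submodule.iSup_induction' with
  | mem k w hw =>
    by_cases hk : k ≥ l
    · simp only [hk, iSup_pos] at hw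
      exact h.inner_eq_zero_of_ne (hml.trans_le hk).ne hx hw
    · simp only [hk, iSup_neg, not_false_eq_true, Submodule.mem_bot] at hw
      simp [hw]
  | zero => simp
  | add y z _ _ hy hz => rw [inner_add_right, hy, hz, add_zero]

lemma inner_self_of_mem (h : IsCompactPencil A B R) {m : ℝ} {x : H}
    (hx : x ∈ pencilEigenspace A B m) : m * ⟪B x, x⟫_ℝ = ‖R (B x)‖ ^ 2 := by
  rw [← h.inner_self, mem_pencilEigenspace.1 hx, real_inner_smul_left]

lemma eigenvalue_nonneg (h : IsCompactPencil A B R) {j : ℕ} {l : ℝ}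
    (hl : IsPencilEigenvalue A B j l) : 0 ≤ l := by
  obtain ⟨x, hx0, hx⟩ := hl.exists_ne_zero
  have h1 := h.inner_self_of_mem (mem_pencilEigenspace.2 hx)
  have h2 := h.pos x hx0
  by_contra hneg
  have := mul_neg_of_neg_of_pos (not_le.1 hneg) h2
  nlinarith [sq_nonneg ‖R (B x)‖]

/-- The Rayleigh quotient is at most `l` on the orthogonal complement of the eigenvectors with
eigenvalue `> l`. -/
lemma inner_le_of_mem_orthogonal (h : IsCompactPencil A B R) {l : ℝ} (hl : 0 ≤ l)
    [FiniteDimensional ℝ (eigenspanGT A B l)] {x : H}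
    (hx : x ∈ FormOrthogonal B (eigenspanGT A B l)) : ⟪A x, x⟫_ℝ ≤ l * ⟪B x, x⟫_ℝ := by
  obtain ⟨κ, -, hub, hat⟩ := h.exists_sup (eigenspanGT A B l) fun x hx =>
    h.inner_apply_eq_zero (p := fun m => m > l) hx
  rcases le_or_gt κ l with hκ | hκ
  · exact (hub x hx).trans (mul_le_mul_of_nonneg_right hκ (h.nonneg x))
  -- A supremum above `l` would be attained at an eigenvector lying both in the span and in its
  -- complement.
  · obtain ⟨y, hy0, hyA, hy⟩ := hat (hl.trans_lt hκ)
    exact absurd (h.eq_zero_of_mem_of_mem_orthogonal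
      (pencilEigenspace_le_eigenspanGT hκ (mem_pencilEigenspace.2 hyA)) hy) hy0

/-- In an infinite-dimensional space every compact pencil has a `j`-th eigenvalue for all `j`. -/
theorem exists_isPencilEigenvalue (h : IsCompactPencil A B R) (hH : ¬ FiniteDimensional ℝ H)
    {j : ℕ} (hj : 1 ≤ j) : ∃ l, IsPencilEigenvalue A B j l := by
  -- The `j`-th eigenvalue is the least threshold with fewer than `j` eigenvalues above it.
  set T : Set ℝ := {t | 0 ≤ t ∧ Module.rank ℝ (eigenspanGT A B t) < j} with hT
  have hbdd : BddBelow T := ⟨0, fun t ht => ht.1⟩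
  have hne : T.Nonempty := by
    refine ⟨‖R‖ ^ 2 * ‖B‖, by positivity, ?_⟩
    have : eigenspanGT A B (‖R‖ ^ 2 * ‖B‖) = ⊥ := by
      rw [eq_bot_iff]
      refine iSup₂_le fun m hm x hx => ?_
      by_contra hx0
      rw [Submodule.mem_bot] at hx0
      have h1 := h.inner_self_of_mem hx
      rw [← h.inner_self] at h1
      have h2 := h.inner_self_le x
      have h3 := mul_lt_mul_of_pos_right hm (h.pos x hx0)
      linarith
    rw [this, rank_bot]
    exact_mod_cast hj
  set l := sInf T with hldef
  have hl0 : 0 ≤ l := le_csInf hne fun t ht => ht.1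
  refine ⟨l, ?_, ?_⟩
  · refine rank_eigenspanGT_lt_of_forall_gt fun t ht => ?_
    obtain ⟨t', ht', htt⟩ := exists_lt_of_csInf_lt hne (show sInf T < t from ht)
    exact ⟨t', htt, ht'.2⟩
  · by_contra hc
    have hc' : Module.rank ℝ (eigenspanGE A B l) < j := not_le.1 hc
    have := finiteDimensional_of_rank_lt hc'
    obtain ⟨κ, hκ0, hub, hat⟩ := h.exists_sup (eigenspanGE A B l) fun x hx =>
      h.inner_apply_eq_zero (p := fun m => m ≥ l) hx
    have hκ : ¬ (0 < κ ∧ l ≤ κ) := by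
      rintro ⟨h1, h2⟩
      obtain ⟨y, hy0, hyA, hy⟩ := hat h1
      exact hy0 (h.eq_zero_of_mem_of_mem_orthogonal
        (pencilEigenspace_le_eigenspanGE h2 (mem_pencilEigenspace.2 hyA)) hy)
    -- If `l = 0`, the complement consists of eigenvectors at 0, so the finite-dimensional span
    -- would be the whole space. If `l > 0`, there is no eigenvalue between `κ` and `l`, so the
    -- midpoint contradicts the choice of `l` as infimum.
    rcases hl0.eq_or_lt with hz | hlpos
    · have hκz : κ = 0 := by
        by_contra hne
        exact hκ ⟨lt_of_le_of_ne hκ0 (Ne.symm hne), by rw [← hz]; exact hκ0⟩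
      apply hH
      have htop : eigenspanGE A B l = ⊤ := by
        rw [eq_top_iff]
        intro x _
        obtain ⟨w, hw, hr⟩ := exists_sub_mem_formOrthogonal h.pos (eigenspanGE A B l) x
        have h1 := hub _ hr
        rw [hκz, zero_mul, h.inner_self] at h1
        have h2 : R (B (x - w)) = 0 := by
          have : ‖R (B (x - w))‖ = 0 := by
            by_contra h3
            have : 0 < ‖R (B (x - w))‖ := lt_of_le_of_ne (norm_nonneg _) (Ne.symm h3)
            nlinarith
          exact norm_eq_zero.1 this
        have h3 : x - w ∈ pencilEigenspace A B 0 := by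
          rw [mem_pencilEigenspace, h.factor, h2]; simp
        have h4 := pencilEigenspace_le_eigenspanGE (A := A) (B := B) hz.ge h3
        have := Submodule.add_mem _ h4 hw
        simpa using this
      rw [htop] at this
      exact Module.Finite.equiv (Submodule.topEquiv : (⊤ : Submodule ℝ H) ≃ₗ[ℝ] H)
    · have hκl : κ < l := by
        by_contra hnl
        exact hκ ⟨hlpos.trans_le (not_lt.1 hnl), not_lt.1 hnl⟩
      have hle : eigenspanGT A B ((κ + l) / 2) ≤ eigenspanGE A B l := by
        refine iSup₂_le fun m hm x hx => ?_
        rcases le_or_gt l m with hlm | hlm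
        · exact pencilEigenspace_le_eigenspanGE hlm hx
        · have hxo : x ∈ FormOrthogonal B (eigenspanGE A B l) := by
            exact h.pencilEigenspace_le_formOrthogonal hlm hx
          have h1 := hub x hxo
          have h2 := h.inner_self_of_mem hx
          rw [← h.inner_self] at h2
          by_cases hx0 : x = 0
          · rw [hx0]; exact Submodule.zero_mem _
          · have h3 := h.pos x hx0
            rw [← h2] at h1
            have h4 := le_of_mul_le_mul_right h1 h3
            linarith
      have hmem : (κ + l) / 2 ∈ T :=
        ⟨by linarith, (Submodule.rank_mono hle).trans_lt hc'⟩
      have := csInf_le hbdd hmem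
      rw [← hldef] at this
      linarith

end IsCompactPencil
end PencilEigenvalues

/-! ### Relative perturbation bounds for eigenvalues -/

section PencilPerturbation

variable {H : Type*} [NormedAddCommGroup H] [InnerProductSpace ℝ H]

/-- A positive definite form dominates the squared norm on a finite-dimensional subspace. -/
lemma exists_norm_sq_le_of_finiteDimensional {B : H →L[ℝ] H}
    (hpos : ∀ x, x ≠ 0 → 0 < ⟪B x, x⟫_ℝ) (V : Submodule ℝ H) [FiniteDimensional ℝ V] :
    ∃ K : ℝ, 0 ≤ K ∧ ∀ x ∈ V, ‖x‖ ^ 2 ≤ K * ⟪B x, x⟫_ℝ := by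
  have : ProperSpace V := FiniteDimensional.proper_real V
  rcases (Metric.sphere (0 : V) 1).eq_empty_or_nonempty with hem | hne
  · refine ⟨0, le_rfl, fun x hx => ?_⟩
    by_contra hc
    have hx0 : ‖(⟨x, hx⟩ : V)‖ ≠ 0 := by
      intro h0
      have : ‖x‖ = 0 := h0
      simp [this] at hc
    have : (‖(⟨x, hx⟩ : V)‖⁻¹ • (⟨x, hx⟩ : V)) ∈ Metric.sphere (0 : V) 1 := by
      rw [mem_sphere_zero_iff_norm, norm_smul, norm_inv, norm_norm, inv_mul_cancel₀ hx0]
    rw [hem] at this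
    exact this
  · have hcont : ContinuousOn (fun x : V => ⟪B (x : H), (x : H)⟫_ℝ) (Metric.sphere (0 : V) 1) := by
      fun_prop
    obtain ⟨x₀, hx₀, hmin⟩ := (isCompact_sphere (0 : V) 1).exists_isMinOn hne hcont
    have hm : 0 < ⟪B (x₀ : H), (x₀ : H)⟫_ℝ := by
      apply hpos
      intro h0
      have : x₀ = 0 := by simpa using h0
      rw [this] at hx₀
      simp at hx₀
    refine ⟨(⟪B (x₀ : H), (x₀ : H)⟫_ℝ)⁻¹, inv_nonneg.2 hm.le, fun x hx => ?_⟩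
    by_cases hx0 : x = 0
    · simp [hx0]
    have hn : 0 < ‖x‖ := norm_pos_iff.2 hx0
    have hmem : (‖x‖⁻¹ • (⟨x, hx⟩ : V)) ∈ Metric.sphere (0 : V) 1 := by
      rw [mem_sphere_zero_iff_norm, norm_smul, norm_inv, norm_norm]
      exact inv_mul_cancel₀ hn.ne'
    have h1 := hmin hmem
    simp only [Set.mem_ofPred_eq, Submodule.coe_smul, map_smul, real_inner_smul_left,
      real_inner_smul_right] at h1
    rw [le_inv_mul_iff₀ hm]
    have h2 : ⟪B (x₀ : H), (x₀ : H)⟫_ℝ * ‖x‖ ^ 2 ≤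
        (‖x‖⁻¹ * (‖x‖⁻¹ * ⟪B x, x⟫_ℝ)) * ‖x‖ ^ 2 := by gcongr
    calc _ ≤ _ := h2
      _ = ⟪B x, x⟫_ℝ := by field_simp

variable [CompleteSpace H]

/-- The regularised pencil with form `Bh` and root `Rh ∘ Bh` is within `e * a` of the pencil with
form `B + a` and root `R ∘ B`. -/
structure IsClosePencil (B R Bh Rh : H →L[ℝ] H) (a e : ℝ) : Prop where
  a_pos : 0 < a
  e_nonneg : 0 ≤ e
  form : ∀ x, ‖Bh x - B x - a • x‖ ≤ e * a * ‖x‖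
  root : ∀ x, ‖Rh (Bh x) - R (B x)‖ ≤ e * a * ‖x‖

namespace IsClosePencil

variable {A B R Ah Bh Rh : H →L[ℝ] H} {a e : ℝ}

omit [CompleteSpace H] in
lemma abs_form_sub_le (hc : IsClosePencil B R Bh Rh a e) (x : H) :
    |⟪Bh x, x⟫_ℝ - (⟪B x, x⟫_ℝ + a * ‖x‖ ^ 2)| ≤ e * (a * ‖x‖ ^ 2) := by
  have h1 : ⟪Bh x, x⟫_ℝ - (⟪B x, x⟫_ℝ + a * ‖x‖ ^ 2) = ⟪Bh x - B x - a • x, x⟫_ℝ := by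
    rw [inner_sub_left, inner_sub_left, real_inner_smul_left, real_inner_self_eq_norm_sq]; ring
  rw [h1]
  calc _ ≤ ‖Bh x - B x - a • x‖ * ‖x‖ := abs_real_inner_le_norm _ _
    _ ≤ (e * a * ‖x‖) * ‖x‖ := by gcongr; exact hc.form x
    _ = _ := by ring

omit [CompleteSpace H] in
lemma le_form (hc : IsClosePencil B R Bh Rh a e) {x : H} (hx : 0 ≤ ⟪B x, x⟫_ℝ) :
    (1 - e) * (⟪B x, x⟫_ℝ + a * ‖x‖ ^ 2) ≤ ⟪Bh x, x⟫_ℝ := by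
  have h1 := (abs_le.1 (hc.abs_form_sub_le x)).1
  have h2 := mul_nonneg hc.e_nonneg hx
  linarith

omit [CompleteSpace H] in
lemma form_le (hc : IsClosePencil B R Bh Rh a e) {x : H} (hx : 0 ≤ ⟪B x, x⟫_ℝ) :
    ⟪Bh x, x⟫_ℝ ≤ (1 + e) * (⟪B x, x⟫_ℝ + a * ‖x‖ ^ 2) := by
  have h1 := (abs_le.1 (hc.abs_form_sub_le x)).2
  have h2 := mul_nonneg hc.e_nonneg hx
  linarith

omit [CompleteSpace H] in
-- For `a ≤ 1` one has (a‖x‖)² ≤ a‖x‖². This turns the absolute error e a‖x‖ into an error relative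
-- to the regularised form.
lemma mul_norm_le (hc : IsClosePencil B R Bh Rh a e) (ha : a ≤ 1) {x : H}
    (hx : 0 ≤ ⟪B x, x⟫_ℝ) : a * ‖x‖ ≤ Real.sqrt (⟪B x, x⟫_ℝ + a * ‖x‖ ^ 2) := by
  apply Real.le_sqrt_of_sq_le
  have h1 : 0 ≤ a * ‖x‖ ^ 2 * (1 - a) :=
    mul_nonneg (mul_nonneg hc.a_pos.le (sq_nonneg _)) (by linarith)
  nlinarith

omit [CompleteSpace H] in
lemma root_le (hc : IsClosePencil B R Bh Rh a e) (ha : a ≤ 1) {x : H} (hx : 0 ≤ ⟪B x, x⟫_ℝ) :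
    ‖Rh (Bh x) - R (B x)‖ ≤ e * Real.sqrt (⟪B x, x⟫_ℝ + a * ‖x‖ ^ 2) := by
  refine (hc.root x).trans ?_
  rw [mul_assoc]
  exact mul_le_mul_of_nonneg_left (hc.mul_norm_le ha hx) hc.e_nonneg

/-- Upper bound for the eigenvalues of a perturbed pencil. -/
lemma sqrt_eigenvalue_le (hc : IsClosePencil B R Bh Rh a e) (ha : a ≤ 1) (he : e < 1)
    (h : IsCompactPencil A B R) (hh : IsCompactPencil Ah Bh Rh) {j : ℕ} {l lh : ℝ}
    (hl : IsPencilEigenvalue A B j l) (hlh : IsPencilEigenvalue Ah Bh j lh) :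
    Real.sqrt lh ≤ (Real.sqrt l + e) / Real.sqrt (1 - e) := by
  have := finiteDimensional_of_rank_lt hl.1
  -- Min–max through a single vector: by dimension, some combination of perturbed eigenvectors with
  -- eigenvalue `≥ lh` is orthogonal to all unperturbed ones with eigenvalue `> l`.
  obtain ⟨x, hxV, hx0, hxW⟩ := exists_mem_formOrthogonal_of_rank_lt (B := B)
    (hl.1.trans_le hlh.2)
  have hb := h.pos x hx0
  have hl0 := h.eigenvalue_nonneg hl
  have hlh0 := hh.eigenvalue_nonneg hlh
  set q := ⟪B x, x⟫_ℝ + a * ‖x‖ ^ 2 with hq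
  have hqb : ⟪B x, x⟫_ℝ ≤ q := by have := mul_nonneg hc.a_pos.le (sq_nonneg ‖x‖); linarith
  have hq0 : 0 < q := hb.trans_le hqb
  have h1 : lh * ⟪Bh x, x⟫_ℝ ≤ ‖Rh (Bh x)‖ ^ 2 := by
    rw [← hh.inner_self]; exact hh.le_inner_of_mem_eigenspanGE hxV
  have h2 : ‖R (B x)‖ ^ 2 ≤ l * ⟪B x, x⟫_ℝ := by
    rw [← h.inner_self]; exact h.inner_le_of_mem_orthogonal hl0 hxW
  have h3 : ‖R (B x)‖ ≤ Real.sqrt l * Real.sqrt q := by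
    rw [← Real.sqrt_mul hl0]
    exact Real.le_sqrt_of_sq_le (h2.trans (mul_le_mul_of_nonneg_left hqb hl0))
  have h4 : ‖Rh (Bh x)‖ ≤ (Real.sqrt l + e) * Real.sqrt q := by
    have := norm_le_norm_add_norm_sub' (Rh (Bh x)) (R (B x))
    have := hc.root_le ha hb.le
    rw [← hq] at this
    linarith
  have h5 : Real.sqrt lh * (Real.sqrt (1 - e) * Real.sqrt q) ≤ ‖Rh (Bh x)‖ := by
    rw [← Real.sqrt_mul (by linarith), ← Real.sqrt_mul hlh0]
    rw [Real.sqrt_le_left (norm_nonneg _)]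
    exact (mul_le_mul_of_nonneg_left (hc.le_form hb.le) hlh0).trans h1
  have hqs : 0 < Real.sqrt q := Real.sqrt_pos.2 hq0
  rw [le_div_iff₀ (Real.sqrt_pos.2 (by linarith))]
  have h6 : (Real.sqrt lh * Real.sqrt (1 - e)) * Real.sqrt q ≤
      (Real.sqrt l + e) * Real.sqrt q := by
    rw [mul_assoc]; exact h5.trans h4
  exact le_of_mul_le_mul_right h6 hqs

/-- Lower bound for the eigenvalues of a perturbed pencil. -/
lemma le_sqrt_eigenvalue (hc : IsClosePencil B R Bh Rh a e) (ha : a ≤ 1)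
    (h : IsCompactPencil A B R) (hh : IsCompactPencil Ah Bh Rh) {j : ℕ} {l lh K : ℝ}
    {V : Submodule ℝ H} (hV : V ≤ eigenspanGE A B l) (hVr : Module.rank ℝ V = j)
    (hK : ∀ x ∈ V, ‖x‖ ^ 2 ≤ K * ⟪B x, x⟫_ℝ) (hK0 : 0 ≤ K)
    (hl0 : 0 ≤ l) (hlh : IsPencilEigenvalue Ah Bh j lh) :
    (Real.sqrt l / Real.sqrt (1 + a * K) - e) / Real.sqrt (1 + e) ≤ Real.sqrt lh := by
  have := finiteDimensional_of_rank_lt hlh.1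
  -- The roles are exchanged: the test vector comes from the fixed space `V`, where the bias `a *
  -- ‖x‖ ^ 2` is at most `a * K` times the form.
  obtain ⟨x, hxV, hx0, hxW⟩ := exists_mem_formOrthogonal_of_rank_lt (B := Bh)
    (hlh.1.trans_eq hVr.symm)
  have hb := h.pos x hx0
  have hlh0 := hh.eigenvalue_nonneg hlh
  have ha0 := hc.a_pos
  have he0 := hc.e_nonneg
  set q := ⟪B x, x⟫_ℝ + a * ‖x‖ ^ 2 with hq
  have hqb : q ≤ (1 + a * K) * ⟪B x, x⟫_ℝ := by
    have := mul_le_mul_of_nonneg_left (hK x hxV) hc.a_pos.le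
    rw [hq]; linarith
  have h1 : ‖Rh (Bh x)‖ ^ 2 ≤ lh * ⟪Bh x, x⟫_ℝ := by
    rw [← hh.inner_self]; exact hh.inner_le_of_mem_orthogonal hlh0 hxW
  have h2 : l * ⟪B x, x⟫_ℝ ≤ ‖R (B x)‖ ^ 2 := by
    rw [← h.inner_self]; exact h.le_inner_of_mem_eigenspanGE (hV hxV)
  have hK1 : 0 < 1 + a * K := by positivity
  have h3 : Real.sqrt q ≤ Real.sqrt (1 + a * K) * Real.sqrt ⟪B x, x⟫_ℝ := by
    rw [← Real.sqrt_mul hK1.le]; exact Real.sqrt_le_sqrt hqb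
  have h4 : ‖Rh (Bh x)‖ ≤ Real.sqrt lh * (Real.sqrt (1 + e) * Real.sqrt q) := by
    rw [← Real.sqrt_mul (by linarith), ← Real.sqrt_mul hlh0]
    exact Real.le_sqrt_of_sq_le (h1.trans (mul_le_mul_of_nonneg_left (hc.form_le hb.le) hlh0))
  have h5 : Real.sqrt l * Real.sqrt ⟪B x, x⟫_ℝ ≤ ‖R (B x)‖ := by
    rw [← Real.sqrt_mul hl0, Real.sqrt_le_left (norm_nonneg _)]
    exact h2
  have h6 : ‖R (B x)‖ ≤ (Real.sqrt lh * Real.sqrt (1 + e) + e) * Real.sqrt q := by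
    have h7 := norm_le_norm_add_norm_sub (Rh (Bh x)) (R (B x))
    have h8 := hc.root_le ha hb.le
    rw [← hq] at h8
    linarith
  have hbs : 0 < Real.sqrt ⟪B x, x⟫_ℝ := Real.sqrt_pos.2 hb
  have hKs : 0 < Real.sqrt (1 + a * K) := Real.sqrt_pos.2 hK1
  rw [div_le_iff₀ (Real.sqrt_pos.2 (by linarith)), sub_le_iff_le_add, div_le_iff₀ hKs]
  have h9 : Real.sqrt l * Real.sqrt ⟪B x, x⟫_ℝ ≤
      ((Real.sqrt lh * Real.sqrt (1 + e) + e) * Real.sqrt (1 + a * K)) *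
        Real.sqrt ⟪B x, x⟫_ℝ := by
    rw [mul_assoc]
    exact (h5.trans h6).trans (mul_le_mul_of_nonneg_left h3 (by positivity))
  exact le_of_mul_le_mul_right h9 hbs

end IsClosePencil

section Limits

variable {ι : Type*} {F : Filter ι} {A B R : H →L[ℝ] H} {Ah Bh Rh : ι → H →L[ℝ] H} {a e : ι → ℝ}

/-- The eigenvalues of regularised approximations converge. -/
theorem IsCompactPencil.tendsto_eigenvalue (h : IsCompactPencil A B R)
    (hh : ∀ i, IsCompactPencil (Ah i) (Bh i) (Rh i))
    (hc : ∀ i, IsClosePencil B R (Bh i) (Rh i) (a i) (e i))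
    (ha : Tendsto a F (𝓝 0)) (he : Tendsto e F (𝓝 0)) {j : ℕ} {l : ℝ} {lh : ι → ℝ}
    (hl : IsPencilEigenvalue A B j l) (hlh : ∀ i, IsPencilEigenvalue (Ah i) (Bh i) j (lh i)) :
    Tendsto lh F (𝓝 l) := by
  have hl0 := h.eigenvalue_nonneg hl
  obtain ⟨V, hV, hVfd, hVr⟩ := exists_finiteDimensional_le_of_le_rank hl.2
  obtain ⟨K, hK0, hK⟩ := exists_norm_sq_le_of_finiteDimensional h.pos V
  have ha1 : ∀ᶠ i in F, a i ≤ 1 := ha.eventually (Iic_mem_nhds one_pos)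
  have he1 : ∀ᶠ i in F, e i < 1 := he.eventually (Iio_mem_nhds one_pos)
  have hlow : Tendsto (fun i => (Real.sqrt l / Real.sqrt (1 + a i * K) - e i) /
      Real.sqrt (1 + e i)) F (𝓝 (Real.sqrt l)) := by
    have h1 : Tendsto (fun i => Real.sqrt (1 + a i * K)) F (𝓝 1) := by
      have := ((ha.mul_const K).const_add 1).sqrt
      simpa using this
    have h2 : Tendsto (fun i => Real.sqrt (1 + e i)) F (𝓝 1) := by
      have := (he.const_add 1).sqrt
      simpa using this
    have := (((tendsto_const_nhds (x := Real.sqrt l)).div h1 one_ne_zero).sub he).div h2 one_ne_zero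
    rwa [div_one, sub_zero, div_one] at this
  have hup : Tendsto (fun i => (Real.sqrt l + e i) / Real.sqrt (1 - e i)) F
      (𝓝 (Real.sqrt l)) := by
    have h2 : Tendsto (fun i => Real.sqrt (1 - e i)) F (𝓝 1) := by
      have := (he.const_sub 1).sqrt
      simpa using this
    have := (he.const_add (Real.sqrt l)).div h2 one_ne_zero
    rwa [add_zero, div_one] at this
  have hsq : Tendsto (fun i => Real.sqrt (lh i)) F (𝓝 (Real.sqrt l)) := by
    refine tendsto_of_tendsto_of_tendsto_of_le_of_le' hlow hup ?_ ?_
    · filter_upwards [ha1] with i hai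
      exact (hc i).le_sqrt_eigenvalue hai h (hh i) hV hVr hK hK0 hl0 (hlh i)
    · filter_upwards [ha1, he1] with i hai hei
      exact (hc i).sqrt_eigenvalue_le hai hei h (hh i) hl (hlh i)
  have := hsq.pow 2
  rw [Real.sq_sqrt hl0] at this
  exact this.congr fun i => Real.sq_sqrt ((hh i).eigenvalue_nonneg (hlh i))

end Limits

end PencilPerturbation

/-! ### Convergence of eigenvectors at a simple eigenvalue -/

section EigenvectorPerturbation

variable {H : Type*} [NormedAddCommGroup H] [InnerProductSpace ℝ H] [CompleteSpace H]
variable {ι : Type*} {F : Filter ι} {A B R : H →L[ℝ] H} {Ah Bh Rh : ι → H →L[ℝ] H} {a e : ι → ℝ}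

namespace IsCompactPencil

/-- If a simple positive eigenvalue `l` has a successor in the list of eigenvalues, the
eigenvectors above the successor are spanned by those above `l` and by an eigenvector at `l`. -/
lemma exists_gap (h : IsCompactPencil A B R) (hH : ¬ FiniteDimensional ℝ H) {j : ℕ} {l : ℝ}
    (hdist : ∀ (i j : ℕ) (l : ℝ), IsPencilEigenvalue A B i l → IsPencilEigenvalue A B j l → i = j)
    (hl : IsPencilEigenvalue A B j l) {b : H} (hb : IsNormalizedEigenvector A B l b) :
    ∃ l' < l, 0 ≤ l' ∧ FiniteDimensional ℝ (eigenspanGT A B l') ∧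
      ∀ r, r ∈ FormOrthogonal B (eigenspanGT A B l) → ⟪B r, b⟫_ℝ = 0 →
        r ∈ FormOrthogonal B (eigenspanGT A B l') := by
  obtain ⟨l', hl'⟩ := h.exists_isPencilEigenvalue hH (j := j + 1) (by omega)
  have hlt : l' < l := by
    by_contra hc
    rcases (not_lt.1 hc).eq_or_lt with heq | hgt
    · have := hdist j (j + 1) l hl (heq ▸ hl')
      omega
    · have hle : eigenspanGE A B l' ≤ eigenspanGT A B l :=
        iSup₂_le fun m hm => pencilEigenspace_le_eigenspanGT (hgt.trans_le hm)
      have h1 := (hl'.2.trans (Submodule.rank_mono hle)).trans_lt hl.1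
      have h2 : j + 1 < j := by exact_mod_cast h1
      omega
  have hfd := finiteDimensional_of_rank_lt hl'.1
  have hfd' := finiteDimensional_of_rank_lt hl.1
  refine ⟨l', hlt, h.eigenvalue_nonneg hl', hfd, fun r hr hrb => ?_⟩
  have hbl : b ∈ pencilEigenspace A B l := mem_pencilEigenspace.2 hb.1
  have hb0 : b ≠ 0 := by
    rintro rfl
    simpa using hb.2
  have hbW : b ∉ eigenspanGT A B l := by
    intro hmem
    refine hb0 (h.eq_zero_of_mem_of_mem_orthogonal hmem fun w hw => ?_)
    induction hw using Submodule.iSup_induction' with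
    | mem k w hw =>
      by_cases hk : k > l
      · simp only [hk, iSup_pos] at hw
        exact h.inner_eq_zero_of_ne (ne_of_lt hk) hbl hw
      · simp only [hk, iSup_neg, not_false_eq_true, Submodule.mem_bot] at hw
        simp [hw]
    | zero => simp
    | add y z _ _ hy hz => rw [inner_add_right, hy, hz, add_zero]
  set W := eigenspanGT A B l with hWdef
  have hWle : W ⊔ Submodule.span ℝ {b} ≤ eigenspanGT A B l' :=
    sup_le (eigenspanGT_anti hlt.le) (by
      rw [Submodule.span_singleton_le_iff_mem]
      exact pencilEigenspace_le_eigenspanGT hlt hbl)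
  -- If `W` had dimension below `j - 1`, then `l` would also be the eigenvalue number `j - 1`,
  -- against distinctness. With at most `j` dimensions above `l'`, adding `b` to `W` fills the span.
  have hWr : j ≤ Module.finrank ℝ W + 1 := by
    by_contra hc
    have h1 : IsPencilEigenvalue A B (j - 1) l := by
      refine ⟨?_, le_trans (by exact_mod_cast Nat.sub_le j 1) hl.2⟩
      change Module.rank ℝ W < _
      rw [← Module.finrank_eq_rank]
      exact_mod_cast (by omega : Module.finrank ℝ W < j - 1)
    have := hdist _ _ _ h1 hl
    omega
  have hl'r : Module.finrank ℝ (eigenspanGT A B l') < j + 1 := by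
    have h1 := hl'.1
    rw [← Module.finrank_eq_rank] at h1
    exact_mod_cast h1
  have hltW : Module.finrank ℝ W < Module.finrank ℝ (W ⊔ Submodule.span ℝ {b} : Submodule ℝ H) := by
    apply Submodule.finrank_lt_finrank_of_lt
    refine lt_of_le_of_ne le_sup_left fun heq => hbW ?_
    rw [heq]
    exact Submodule.mem_sup_right (Submodule.mem_span_singleton_self b)
  have heq : W ⊔ Submodule.span ℝ {b} = eigenspanGT A B l' :=
    Submodule.eq_of_le_of_finrank_le hWle (by omega)
  rw [← heq]
  intro w hw
  obtain ⟨u, hu, v, hv, rfl⟩ := Submodule.mem_sup.1 hw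
  obtain ⟨c, rfl⟩ := Submodule.mem_span_singleton.1 hv
  rw [inner_add_right, real_inner_smul_right, hr u hu, hrb]; simp

section Convergence

variable (h : IsCompactPencil A B R) (hh : ∀ i, IsCompactPencil (Ah i) (Bh i) (Rh i))
  (hc : ∀ i, IsClosePencil B R (Bh i) (Rh i) (a i) (e i))
  (ha : Tendsto a F (𝓝 0)) (he : Tendsto e F (𝓝 0))
  {l : ℝ} {lh : ι → ℝ} {bh : ι → H} (hlh : Tendsto lh F (𝓝 l))
  (hbh : ∀ i, IsNormalizedEigenvector (Ah i) (Bh i) (lh i) (bh i))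

include h hc ha he hbh

omit [CompleteSpace H] in
omit h hc ha he hbh in
lemma form_add_eq {B : H →L[ℝ] H} (hs : ∀ x y, ⟪B x, y⟫_ℝ = ⟪x, B y⟫_ℝ) {x y : H}
    (hxy : ⟪B x, y⟫_ℝ = 0) : ⟪B (x + y), x + y⟫_ℝ = ⟪B x, x⟫_ℝ + ⟪B y, y⟫_ℝ := by
  have : ⟪B y, x⟫_ℝ = 0 := by rw [hs, real_inner_comm, hxy]
  rw [map_add, inner_add_left, inner_add_right, inner_add_right, hxy, this]; ring

omit ha in
lemma eventually_form_le : ∀ᶠ i in F,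
    ⟪B (bh i), bh i⟫_ℝ + a i * ‖bh i‖ ^ 2 ≤ (1 - e i)⁻¹ := by
  filter_upwards [he.eventually (Iio_mem_nhds one_pos)] with i hei
  have h1 := (hc i).le_form (h.nonneg (bh i))
  rw [(hbh i).2] at h1
  have h2 : 0 < 1 - e i := sub_pos.2 hei
  have h3 := mul_le_mul_of_nonneg_left h1 (inv_nonneg.2 h2.le)
  rwa [← mul_assoc, inv_mul_cancel₀ h2.ne', one_mul, mul_one] at h3

omit ha in
lemma eventually_form_le_two : ∀ᶠ i in F, ⟪B (bh i), bh i⟫_ℝ ≤ 2 ∧ a i * ‖bh i‖ ^ 2 ≤ 2 := by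
  filter_upwards [eventually_form_le h hc he hbh,
    he.eventually (Iic_mem_nhds (by norm_num : (0 : ℝ) < 1 / 2))] with i h1 h2
  have h3 : (1 - e i)⁻¹ ≤ 2 := by
    rw [inv_le_comm₀ (by linarith [show e i ≤ 1 / 2 from h2]) two_pos]
    linarith [show e i ≤ 1 / 2 from h2]
  have h4 := h.nonneg (bh i)
  have h5 := mul_nonneg (hc i).a_pos.le (sq_nonneg ‖bh i‖)
  constructor <;> linarith

/-- The norms ‖b̂‖ need not stay bounded, but a‖b̂‖² does, and (a‖b̂‖)² = a · a‖b̂‖². -/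
lemma tendsto_mul_norm : Tendsto (fun i => a i * ‖bh i‖) F (𝓝 0) := by
  have h1 : Tendsto (fun i => Real.sqrt (2 * a i)) F (𝓝 0) := by
    have := (ha.const_mul 2).sqrt
    simpa using this
  refine squeeze_zero' (Eventually.of_forall fun i =>
    mul_nonneg (hc i).a_pos.le (norm_nonneg _)) ?_ h1
  filter_upwards [eventually_form_le_two h hc he hbh] with i hi
  apply Real.le_sqrt_of_sq_le
  have := mul_le_mul_of_nonneg_left hi.2 (hc i).a_pos.le
  nlinarith

lemma tendsto_root_sub : Tendsto (fun i => Rh i (Bh i (bh i)) - R (B (bh i))) F (𝓝 0) := by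
  rw [tendsto_zero_iff_norm_tendsto_zero]
  refine squeeze_zero (fun i => norm_nonneg _) (fun i => (hc i).root _) ?_
  have := he.mul (tendsto_mul_norm h hc ha he hbh)
  rw [zero_mul] at this
  exact this.congr fun i => (mul_assoc _ _ _).symm

lemma tendsto_form_sub : Tendsto (fun i => Bh i (bh i) - B (bh i)) F (𝓝 0) := by
  have hp := tendsto_mul_norm h hc ha he hbh
  have h1 : Tendsto (fun i => Bh i (bh i) - B (bh i) - a i • bh i) F (𝓝 0) := by
    rw [tendsto_zero_iff_norm_tendsto_zero]
    refine squeeze_zero (fun i => norm_nonneg _) (fun i => (hc i).form _) ?_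
    have := he.mul hp
    rw [zero_mul] at this
    exact this.congr fun i => (mul_assoc _ _ _).symm
  have h2 : Tendsto (fun i => a i • bh i) F (𝓝 0) := by
    rw [tendsto_zero_iff_norm_tendsto_zero]
    exact hp.congr fun i => by rw [norm_smul, Real.norm_of_nonneg (hc i).a_pos.le]
  have := h1.add h2
  simpa using this

omit ha in
lemma eventually_norm_root_le : ∀ᶠ i in F,
    ‖R (B (bh i))‖ ≤ Real.sqrt (‖R‖ ^ 2 * ‖B‖ * 2) := by
  filter_upwards [eventually_form_le_two h hc he hbh] with i hi
  apply Real.le_sqrt_of_sq_le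
  rw [← h.inner_self]
  exact (h.inner_self_le _).trans (mul_le_mul_of_nonneg_left hi.1 (by positivity))

include hh hlh

/-- The normalisation gives ‖R̂B̂b̂‖² = λ̂ exactly; replacing R̂B̂ by RB costs a vanishing error. -/
lemma tendsto_norm_root_sq : Tendsto (fun i => ‖R (B (bh i))‖ ^ 2) F (𝓝 l) := by
  have h1 : Tendsto (fun i => ‖Rh i (Bh i (bh i))‖ ^ 2) F (𝓝 l) := by
    refine hlh.congr fun i => ?_
    rw [← (hh i).inner_self, (hbh i).1, real_inner_smul_left, (hbh i).2, mul_one]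
  have h2 : Tendsto (fun i => ‖Rh i (Bh i (bh i))‖) F (𝓝 (Real.sqrt l)) :=
    h1.sqrt.congr fun i => Real.sqrt_sq (norm_nonneg _)
  have h3 : Tendsto (fun i => ‖R (B (bh i))‖ - ‖Rh i (Bh i (bh i))‖) F (𝓝 0) := by
    refine squeeze_zero_norm (fun i => ?_)
      (tendsto_zero_iff_norm_tendsto_zero.1 (tendsto_root_sub h hc ha he hbh))
    rw [← norm_neg (_ - _), neg_sub, Real.norm_eq_abs, abs_sub_comm]
    rw [norm_sub_rev]
    exact abs_norm_sub_norm_le _ _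
  have h4 := (h3.add h2).pow 2
  simp only [sub_add_cancel, zero_add] at h4
  rcases F.eq_or_neBot with rfl | hF
  · exact tendsto_bot
  have hl0 : 0 ≤ l := ge_of_tendsto' h1 fun i => sq_nonneg _
  rwa [Real.sq_sqrt hl0] at h4

/-- Both eigenvalue equations express an inner product of roots: λ̂⟨B̂b̂, v⟩ on the empirical side,
m⟨Bb̂, v⟩ on the other. Their difference vanishes and λ̂ → l ≠ m, so ⟨Bb̂, v⟩ must vanish too. -/
lemma tendsto_inner_eigenvector {m : ℝ} (hm : m ≠ l) {v : H} (hv : A v = m • B v) :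
    Tendsto (fun i => ⟪B (bh i), v⟫_ℝ) F (𝓝 0) := by
  set τ := fun i => ⟪B (bh i), v⟫_ℝ with hτ
  set o := fun i => ⟪Bh i (bh i) - B (bh i), v⟫_ℝ with ho
  have ho0 : Tendsto o F (𝓝 0) := by
    have := Tendsto.inner (𝕜 := ℝ) (tendsto_form_sub h hc ha he hbh)
      (tendsto_const_nhds (x := v))
    simpa only [inner_zero_left] using this
  have hd1 : Tendsto (fun i => ⟪Rh i (Bh i (bh i)) - R (B (bh i)), R (B v)⟫_ℝ) F (𝓝 0) := by
    have := Tendsto.inner (𝕜 := ℝ) (tendsto_root_sub h hc ha he hbh)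
      (tendsto_const_nhds (x := R (B v)))
    simpa only [inner_zero_left] using this
  have hrv : Tendsto (fun i => Rh i (Bh i v) - R (B v)) F (𝓝 0) := by
    rw [tendsto_zero_iff_norm_tendsto_zero]
    refine squeeze_zero (fun i => norm_nonneg _) (fun i => (hc i).root _) ?_
    simpa using (he.mul ha).mul_const ‖v‖
  have hd2 : Tendsto (fun i => ⟪Rh i (Bh i (bh i)), Rh i (Bh i v) - R (B v)⟫_ℝ) F (𝓝 0) := by
    set M := Real.sqrt (‖R‖ ^ 2 * ‖B‖ * 2)
    have h0 : Tendsto (fun i => (‖Rh i (Bh i (bh i)) - R (B (bh i))‖ + M) *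
        ‖Rh i (Bh i v) - R (B v)‖) F (𝓝 0) := by
      have := ((tendsto_root_sub h hc ha he hbh).norm.add_const M).mul hrv.norm
      simpa using this
    refine squeeze_zero_norm' ?_ h0
    filter_upwards [eventually_norm_root_le h hc he hbh] with i hi
    refine (norm_inner_le_norm _ _).trans (mul_le_mul_of_nonneg_right ?_ (norm_nonneg _))
    have := norm_le_norm_sub_add (Rh i (Bh i (bh i))) (R (B (bh i)))
    linarith
  have hbd : IsBoundedUnder (· ≤ ·) F fun i => ‖τ i‖ := by
    refine isBoundedUnder_of_eventually_le (a := Real.sqrt (2 * ⟪B v, v⟫_ℝ)) ?_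
    filter_upwards [eventually_form_le_two h hc he hbh] with i hi
    rw [Real.norm_eq_abs]
    apply Real.abs_le_sqrt
    exact (h.inner_sq_le _ _).trans (mul_le_mul_of_nonneg_right hi.1 (h.nonneg v))
  have hlτ : Tendsto (fun i => (lh i - l) * τ i) F (𝓝 0) := by
    have h1 : Tendsto (fun i => lh i - l) F (𝓝 0) := by simpa using hlh.sub_const l
    exact h1.zero_mul_isBoundedUnder_le hbd
  have key : ∀ i, (m - l) * τ i = (lh i - l) * τ i + lh i * o i -
      (⟪Rh i (Bh i (bh i)) - R (B (bh i)), R (B v)⟫_ℝ +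
        ⟪Rh i (Bh i (bh i)), Rh i (Bh i v) - R (B v)⟫_ℝ) := by
    intro i
    have e1 : ⟪Rh i (Bh i (bh i)), Rh i (Bh i v)⟫_ℝ = lh i * ⟪Bh i (bh i), v⟫_ℝ := by
      rw [← (hh i).inner_left, (hbh i).1, real_inner_smul_left]
    have e2 : ⟪R (B (bh i)), R (B v)⟫_ℝ = m * ⟪B (bh i), v⟫_ℝ := by
      rw [← h.inner_left, h.symm_left, hv, real_inner_smul_right, h.symm]
    simp only [hτ, ho, inner_sub_left, inner_sub_right, e1, e2]
    ring
  have h2 : Tendsto (fun i => (m - l) * τ i) F (𝓝 0) := by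
    have := ((hlτ.add (hlh.mul ho0)).sub (hd1.add hd2))
    simp only [mul_zero, add_zero, sub_zero] at this
    exact this.congr fun i => (key i).symm
  have h3 := h2.const_mul (m - l)⁻¹
  rw [mul_zero] at h3
  exact h3.congr fun i => by
    rw [← mul_assoc, inv_mul_cancel₀ (sub_ne_zero.2 hm), one_mul]

lemma tendsto_inner_of_mem_eigenspanGT {v : H} (hv : v ∈ eigenspanGT A B l) :
    Tendsto (fun i => ⟪B (bh i), v⟫_ℝ) F (𝓝 0) := by
  induction hv using Submodule.iSup_induction' with
  | mem k w hw =>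
    by_cases hk : k > l
    · simp only [hk, iSup_pos] at hw
      exact tendsto_inner_eigenvector h hh hc ha he hlh hbh (ne_of_gt hk)
        (mem_pencilEigenspace.1 hw)
    · simp only [hk, iSup_neg, not_false_eq_true, Submodule.mem_bot] at hw
      simp [hw, tendsto_const_nhds]
  | zero => simp [tendsto_const_nhds]
  | add y z _ _ hy hz =>
    simp only [inner_add_right]
    simpa using hy.add hz

/-- Orthogonality of the remainder gives ⟨Bw, w⟩ = ⟨Bb̂, w⟩, a combination of finitely many
vanishing pairings. The unknown factor ‖w‖ is absorbed because the form dominates the norm on a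
finite-dimensional space. -/
lemma tendsto_form_of_mem_eigenspanGT [FiniteDimensional ℝ (eigenspanGT A B l)] {w : ι → H}
    (hw : ∀ i, w i ∈ eigenspanGT A B l)
    (hwo : ∀ i, bh i - w i ∈ FormOrthogonal B (eigenspanGT A B l)) :
    Tendsto (fun i => ⟪B (w i), w i⟫_ℝ) F (𝓝 0) := by
  set W := eigenspanGT A B l with hW
  obtain ⟨K, hK0, hK⟩ := exists_norm_sq_le_of_finiteDimensional h.pos W
  set v := stdOrthonormalBasis ℝ W with hv
  set φ := fun i => ∑ k, |⟪B (bh i), (v k : H)⟫_ℝ| with hφ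
  have hφ0 : Tendsto φ F (𝓝 0) := by
    have : Tendsto φ F (𝓝 (∑ k : Fin (Module.finrank ℝ W), |(0 : ℝ)|)) := by
      refine tendsto_finsetSum _ fun k _ => ?_
      exact (tendsto_inner_of_mem_eigenspanGT h hh hc ha he hlh hbh (v k).2).abs
    simpa using this
  have hle : ∀ i, ⟪B (w i), w i⟫_ℝ ≤ K * φ i ^ 2 := by
    intro i
    have e1 : ⟪B (w i), w i⟫_ℝ = ⟪B (bh i), w i⟫_ℝ := by
      have := hwo i (w i) (hw i)
      rw [map_sub, inner_sub_left] at this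
      linarith
    have e2 : w i = ∑ k, ⟪(v k : H), w i⟫_ℝ • (v k : H) := by
      have := v.sum_repr' ⟨w i, hw i⟩
      have := congrArg (fun x : W => (x : H)) this
      simpa using this.symm
    have e3 : ⟪B (bh i), w i⟫_ℝ ≤ ‖w i‖ * φ i := by
      conv_lhs => rw [e2]
      rw [inner_sum, hφ, Finset.mul_sum]
      refine Finset.sum_le_sum fun k _ => ?_
      rw [real_inner_smul_right]
      refine (le_abs_self _).trans ?_
      rw [abs_mul]
      refine mul_le_mul_of_nonneg_right ?_ (abs_nonneg _)
      have h1 := abs_real_inner_le_norm (v k : H) (w i)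
      have h2 : ‖(v k : H)‖ = 1 := v.orthonormal.1 k
      rwa [h2, one_mul] at h1
    have h4 := hK (w i) (hw i)
    have hφn : 0 ≤ φ i := Finset.sum_nonneg fun k _ => abs_nonneg _
    have h5 : ⟪B (w i), w i⟫_ℝ ^ 2 ≤ (K * φ i ^ 2) * ⟪B (w i), w i⟫_ℝ := by
      calc _ ≤ (‖w i‖ * φ i) ^ 2 := pow_le_pow_left₀ (h.nonneg _) (e1.trans_le e3) 2
        _ = ‖w i‖ ^ 2 * φ i ^ 2 := by ring
        _ ≤ (K * ⟪B (w i), w i⟫_ℝ) * φ i ^ 2 := by gcongr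
        _ = _ := by ring
    rcases (h.nonneg (w i)).eq_or_lt with h0 | hpos
    · rw [← h0]; positivity
    · rw [sq] at h5
      exact le_of_mul_le_mul_right h5 hpos
  refine squeeze_zero (fun i => h.nonneg _) hle ?_
  simpa using (hφ0.pow 2).const_mul K

/-- The normalised eigenvectors of regularised approximations converge, up to sign, at a simple
eigenvalue. -/
theorem tendsto_eigenvector {l' : ℝ} (hl' : l' < l) (hl'0 : 0 ≤ l')
    [FiniteDimensional ℝ (eigenspanGT A B l)] [FiniteDimensional ℝ (eigenspanGT A B l')]
    {b : H} (hb : IsNormalizedEigenvector A B l b)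
    (hgap : ∀ r, r ∈ FormOrthogonal B (eigenspanGT A B l) → ⟪B r, b⟫_ℝ = 0 →
        r ∈ FormOrthogonal B (eigenspanGT A B l'))
    {s : ι → ℝ} (hs : ∀ i, s i = if 0 ≤ ⟪B (bh i), b⟫_ℝ then 1 else -1) :
    Tendsto (fun i => ⟪B (s i • bh i - b), s i • bh i - b⟫_ℝ) F (𝓝 0) := by
  choose w hw hwo using fun i => exists_sub_mem_formOrthogonal h.pos (eigenspanGT A B l) (bh i)
  set t := fun i => ⟪B (bh i), b⟫_ℝ with ht
  -- Three mutually orthogonal parts: `w` above the eigenvalue, `t • b` at it, and `r` below.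
  set r := fun i => bh i - w i - t i • b with hr
  have hlpos : 0 < l := hl'0.trans_lt hl'
  have hbW : ∀ v ∈ eigenspanGT A B l, ⟪B b, v⟫_ℝ = 0 := by
    intro v hv
    induction hv using Submodule.iSup_induction' with
    | mem k w hw =>
      by_cases hk : k > l
      · simp only [hk, iSup_pos] at hw
        exact h.inner_eq_zero_of_ne (ne_of_lt hk) (mem_pencilEigenspace.2 hb.1) hw
      · simp only [hk, iSup_neg, not_false_eq_true, Submodule.mem_bot] at hw
        simp [hw]
    | zero => simp
    | add y z _ _ hy hz => rw [inner_add_right, hy, hz, add_zero]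
  have hWb : ∀ v ∈ eigenspanGT A B l, ⟪B v, b⟫_ℝ = 0 := fun v hv => by
    rw [h.symm, real_inner_comm, hbW v hv]
  have hrW : ∀ i, r i ∈ FormOrthogonal B (eigenspanGT A B l) := fun i =>
    Submodule.sub_mem _ (hwo i) (Submodule.smul_mem _ _ hbW)
  have hrb : ∀ i, ⟪B (r i), b⟫_ℝ = 0 := by
    intro i
    simp only [hr, map_sub, map_smul, inner_sub_left, real_inner_smul_left, hWb _ (hw i), hb.2]
    simp [ht]
  have hdec : ∀ i, bh i = w i + (t i • b + r i) := fun i => by simp only [hr]; abel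
  have hform : ∀ i (p q c : ℝ), ⟪B (p • w i + (q • b + c • r i)), p • w i + (q • b + c • r i)⟫_ℝ =
      p ^ 2 * ⟪B (w i), w i⟫_ℝ + (q ^ 2 + c ^ 2 * ⟪B (r i), r i⟫_ℝ) := by
    intro i p q c
    have h1 : ⟪B (w i), r i⟫_ℝ = 0 := by rw [h.symm, real_inner_comm, hrW i _ (hw i)]
    have h2 : ⟪B b, r i⟫_ℝ = 0 := by rw [h.symm, real_inner_comm, hrb]
    rw [form_add_eq h.symm, form_add_eq h.symm]
    · simp only [map_smul, real_inner_smul_left, real_inner_smul_right, hb.2]; ring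
    · simp only [map_smul, real_inner_smul_left, real_inner_smul_right, h2]; ring
    · simp only [map_smul, real_inner_smul_left, real_inner_smul_right, inner_add_right,
        hWb _ (hw i), h1]; ring
  have hA : ∀ i, ‖R (B (bh i))‖ ^ 2 =
      ⟪A (w i), w i⟫_ℝ + (l * t i ^ 2 + ⟪A (r i), r i⟫_ℝ) := by
    intro i
    have h1 : ⟪A (w i), r i⟫_ℝ = 0 := by
      rw [h.symm_left, real_inner_comm]
      exact h.inner_apply_eq_zero (p := fun m => m > l) (hrW i) _ (hw i)
    have h2 : ⟪A b, r i⟫_ℝ = 0 := by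
      rw [hb.1, real_inner_smul_left, h.symm, real_inner_comm, hrb, mul_zero]
    have h3 : ⟪A (w i), b⟫_ℝ = 0 := by
      rw [h.symm_left, hb.1, real_inner_smul_right, ← h.symm, hWb _ (hw i), mul_zero]
    rw [← h.inner_self]
    conv_lhs => rw [hdec i]
    rw [form_add_eq h.symm_left, form_add_eq h.symm_left]
    · simp only [map_smul, real_inner_smul_left, real_inner_smul_right, hb.1, hb.2]; ring
    · simp only [map_smul, real_inner_smul_left, h2]; ring
    · simp only [real_inner_smul_right, inner_add_right, h3, h1]; ring
  have hBw := tendsto_form_of_mem_eigenspanGT h hh hc ha he hlh hbh hw hwo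
  have hAw : Tendsto (fun i => ⟪A (w i), w i⟫_ℝ) F (𝓝 0) := by
    refine squeeze_zero (fun i => by rw [h.inner_self]; positivity)
      (fun i => h.inner_self_le (w i)) ?_
    simpa using hBw.const_mul (‖R‖ ^ 2 * ‖B‖)
  have hAb := tendsto_norm_root_sq h hh hc ha he hlh hbh
  have hArle : ∀ i, ⟪A (r i), r i⟫_ℝ ≤ l' * ⟪B (r i), r i⟫_ℝ := fun i =>
    h.inner_le_of_mem_orthogonal hl'0 (hgap _ (hrW i) (hrb i))
  -- The total mass is asymptotically at most 1 while the energy tends to `l`. Mass in `r` earns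
  -- energy at rate at most `l' < l`, so none can remain there.
  have hBr : Tendsto (fun i => ⟪B (r i), r i⟫_ℝ) F (𝓝 0) := by
    have hup : Tendsto (fun i => (l - l')⁻¹ *
        (l * (1 - e i)⁻¹ - ‖R (B (bh i))‖ ^ 2 + ⟪A (w i), w i⟫_ℝ)) F (𝓝 0) := by
      have h1 : Tendsto (fun i => (1 - e i)⁻¹) F (𝓝 1) := by
        simpa using (he.const_sub 1).inv₀ (by norm_num)
      have := (((h1.const_mul l).sub hAb).add hAw).const_mul (l - l')⁻¹
      simpa using this
    refine squeeze_zero' (Eventually.of_forall fun i => h.nonneg _) ?_ hup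
    filter_upwards [eventually_form_le h hc he hbh] with i hi
    have hll : 0 < l - l' := sub_pos.2 hl'
    rw [le_inv_mul_iff₀ hll]
    have h1 := hform i 1 (t i) 1
    simp only [one_smul, one_pow, one_mul, ← hdec] at h1
    have h2 := hA i
    have h3 := hArle i
    have h4 := mul_nonneg (hc i).a_pos.le (sq_nonneg ‖bh i‖)
    have h5 : ⟪B (w i), w i⟫_ℝ + (t i ^ 2 + ⟪B (r i), r i⟫_ℝ) ≤ (1 - e i)⁻¹ := by
      rw [← h1]; linarith
    have h6 := mul_le_mul_of_nonneg_left h5 hlpos.le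
    have h7 := mul_nonneg hlpos.le (h.nonneg (w i))
    linarith
  have hAr : Tendsto (fun i => ⟪A (r i), r i⟫_ℝ) F (𝓝 0) :=
    squeeze_zero (fun i => by rw [h.inner_self]; positivity) hArle (by simpa using hBr.const_mul l')
  have ht2 : Tendsto (fun i => t i ^ 2) F (𝓝 1) := by
    have h1 := ((hAb.sub hAw).sub hAr).const_mul l⁻¹
    rw [sub_zero, sub_zero, inv_mul_cancel₀ hlpos.ne'] at h1
    refine h1.congr fun i => ?_
    rw [hA i]
    field_simp
    ring
  have htabs : Tendsto (fun i => |t i|) F (𝓝 1) := by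
    have := ht2.sqrt
    rw [Real.sqrt_one] at this
    exact this.congr fun i => Real.sqrt_sq_eq_abs _
  have hst : ∀ i, s i * t i = |t i| ∧ s i ^ 2 = 1 := by
    intro i
    rw [hs i]
    split_ifs with h0
    · exact ⟨by rw [abs_of_nonneg h0, one_mul], by norm_num⟩
    · exact ⟨by rw [abs_of_neg (not_le.1 h0)]; ring, by norm_num⟩
  have hfin : ∀ i, ⟪B (s i • bh i - b), s i • bh i - b⟫_ℝ =
      ⟪B (w i), w i⟫_ℝ + ((|t i| - 1) ^ 2 + ⟪B (r i), r i⟫_ℝ) := by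
    intro i
    have h1 : s i • bh i - b = s i • w i + ((|t i| - 1) • b + s i • r i) := by
      rw [← (hst i).1]
      conv_lhs => rw [hdec i]
      module
    rw [h1, hform, (hst i).2, one_mul, one_mul]
  simp only [hfin]
  have := hBw.add (((htabs.sub_const 1).pow 2).add hBr)
  simpa using this

end Convergence

end IsCompactPencil
end EigenvectorPerturbation

/-! ### Hilbert bases and compactness of square summable operators -/

section HilbertSpace

variable {H : Type*} [NormedAddCommGroup H] [InnerProductSpace ℝ H]

lemma isCompactOperator_rankOne (x y : H) : IsCompactOperator (rankOne ℝ x y : H →L[ℝ] H) := by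
  rw [rankOne_def']
  exact IsCompactOperator.clm_comp
    (isCompactOperator_of_locallyCompactSpace_dom (innerSL ℝ y))
    (ContinuousLinearMap.toSpanSingleton ℝ x)

lemma isCompactOperator_sum {ι : Type*} (s : Finset ι) {g : ι → H →L[ℝ] H}
    (hg : ∀ i, IsCompactOperator (g i)) : IsCompactOperator (∑ i ∈ s, g i : H →L[ℝ] H) := by
  classical
  induction s using Finset.induction_on with
  | empty => simpa using (isCompactOperator_zero : IsCompactOperator (0 : H → H))
  | insert i s hi ih =>
    rw [Finset.sum_insert hi]
    exact (hg i).add ih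

/-- Distinct orthonormal vectors are √2 apart, so the balls of radius 1/2 around them are disjoint.
-/
lemma Orthonormal.countable_index [TopologicalSpace.SeparableSpace H] {ι : Type*} {v : ι → H}
    (hv : Orthonormal ℝ v) : Countable ι := by
  have hd : ∀ i j, i ≠ j → 1 < dist (v i) (v j) := by
    intro i j hij
    have h1 : ‖v i - v j‖ ^ 2 = 2 := by
      rw [norm_sub_sq_real, hv.1 i, hv.1 j, hv.2 hij]; norm_num
    rw [dist_eq_norm]
    nlinarith [norm_nonneg (v i - v j)]
  have hdis : (Set.univ : Set ι).PairwiseDisjoint fun i => Metric.ball (v i) (1 / 2) := by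
    intro i _ j _ hij
    apply Metric.ball_disjoint_ball
    linarith [hd i j hij]
  have := hdis.countable_of_isOpen (fun i _ => Metric.isOpen_ball)
    (fun i _ => ⟨v i, Metric.mem_ball_self (by norm_num)⟩)
  exact Set.countable_univ_iff.1 this

lemma exists_countable_hilbertBasis (H : Type*) [NormedAddCommGroup H] [InnerProductSpace ℝ H]
    [CompleteSpace H] [TopologicalSpace.SeparableSpace H] :
    ∃ (w : Set H) (_ : HilbertBasis w ℝ H), Countable w := by
  obtain ⟨w, b, -⟩ := exists_hilbertBasis ℝ H
  exact ⟨w, b, b.orthonormal.countable_index⟩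

/-- Parseval, stated for extended nonnegative reals so that sums and integrals may be exchanged
without summability checks. -/
lemma HilbertBasis.enorm_sq_eq_tsum {ι : Type*} (b : HilbertBasis ι ℝ H) (x : H) :
    ‖x‖ₑ ^ 2 = ∑' i, ‖⟪b i, x⟫_ℝ‖ₑ ^ 2 := by
  have h := b.hasSum_inner_mul_inner x x
  have h1 : ∀ i, ‖⟪b i, x⟫_ℝ‖ₑ ^ 2 = ENNReal.ofReal (⟪x, b i⟫_ℝ * ⟪b i, x⟫_ℝ) := by
    intro i
    rw [real_inner_comm, ← ofReal_norm, ← ENNReal.ofReal_pow (norm_nonneg _), sq,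
      Real.norm_eq_abs, abs_mul_abs_self]
  simp_rw [h1]
  rw [← ENNReal.ofReal_tsum_of_nonneg _ h.summable, h.tsum_eq, real_inner_self_eq_norm_sq,
    ← ofReal_norm, ENNReal.ofReal_pow (norm_nonneg _)]
  intro i
  rw [real_inner_comm]
  exact mul_self_nonneg _

lemma HilbertBasis.lintegral_enorm_sq {ι Ω : Type*} [MeasurableSpace Ω] [Countable ι]
    (b : HilbertBasis ι ℝ H) {μ : Measure Ω} {X : Ω → H} (hX : AEStronglyMeasurable X μ) :
    ∫⁻ ω, ‖X ω‖ₑ ^ 2 ∂μ = ∑' i, ∫⁻ ω, ‖⟪b i, X ω⟫_ℝ‖ₑ ^ 2 ∂μ := by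
  simp_rw [b.enorm_sq_eq_tsum]
  rw [lintegral_tsum]
  intro i
  exact ((hX.const_inner (c := b i)).enorm).pow_const 2

variable [CompleteSpace H]

/-- A bounded operator that is square summable along a Hilbert basis is compact. -/
lemma HilbertBasis.isCompactOperator_of_summable {ι : Type*} (b : HilbertBasis ι ℝ H)
    {A : H →L[ℝ] H} (hA : Summable fun i => ‖A (b i)‖ ^ 2) : IsCompactOperator A := by
  classical
  -- Finite-rank truncations along the basis; Cauchy–Schwarz and Bessel bound the remainder by the
  -- square root of the tail of the series.
  set G : Finset ι → H →L[ℝ] H := fun s => ∑ i ∈ s, rankOne ℝ (A (b i)) (b i) with hG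
  have hGx : ∀ s x, G s x = ∑ i ∈ s, ⟪b i, x⟫_ℝ • A (b i) := by
    intro s x
    simp [hG]
  have hlim : ∀ x, Tendsto (fun s => G s x) atTop (𝓝 (A x)) := by
    intro x
    have h1 := (b.hasSum_repr x).mapL A
    simp only [map_smul, b.repr_apply_apply] at h1
    exact h1.congr fun s => (hGx s x).symm
  set S := ∑' i, ‖A (b i)‖ ^ 2 with hS
  have hbound : ∀ s x, ‖A x - G s x‖ ≤ Real.sqrt (S - ∑ i ∈ s, ‖A (b i)‖ ^ 2) * ‖x‖ := by
    intro s x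
    refine le_of_tendsto ((hlim x).sub_const (G s x)).norm ?_
    filter_upwards [eventually_ge_atTop s] with t hst
    have e1 : G t x - G s x = ∑ i ∈ t \ s, ⟪b i, x⟫_ℝ • A (b i) := by
      rw [hGx, hGx, ← Finset.sum_sdiff hst, add_sub_cancel_right]
    rw [e1]
    calc _ ≤ ∑ i ∈ t \ s, ‖A (b i)‖ * ‖⟪b i, x⟫_ℝ‖ := by
          refine (norm_sum_le _ _).trans_eq (Finset.sum_congr rfl fun i _ => ?_)
          rw [norm_smul, mul_comm]
      _ ≤ Real.sqrt (∑ i ∈ t \ s, ‖A (b i)‖ ^ 2) *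
          Real.sqrt (∑ i ∈ t \ s, ‖⟪b i, x⟫_ℝ‖ ^ 2) := Real.sum_mul_le_sqrt_mul_sqrt _ _ _
      _ ≤ _ := by
        gcongr
        · rw [le_sub_iff_add_le, Finset.sum_sdiff hst]
          exact hA.sum_le_tsum t fun i _ => sq_nonneg _
        · rw [Real.sqrt_le_left (norm_nonneg _)]
          exact b.orthonormal.sum_inner_products_le x
  have hnorm : Tendsto G atTop (𝓝 A) := by
    rw [tendsto_iff_norm_sub_tendsto_zero]
    have h0 : Tendsto (fun s => Real.sqrt (S - ∑ i ∈ s, ‖A (b i)‖ ^ 2)) atTop (𝓝 0) := by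
      have h1 : Tendsto (fun s => ∑ i ∈ s, ‖A (b i)‖ ^ 2) atTop (𝓝 S) := hA.hasSum
      have := (h1.const_sub S).sqrt
      simpa using this
    refine squeeze_zero (fun s => norm_nonneg _) (fun s => ?_) h0
    rw [norm_sub_rev]
    exact ContinuousLinearMap.opNorm_le_bound _ (Real.sqrt_nonneg _) (hbound s)
  exact isCompactOperator_of_tendsto hnorm
    (Eventually.of_forall fun s => isCompactOperator_sum s fun i => isCompactOperator_rankOne _ _)

lemma HilbertBasis.isCompactOperator_of_tsum_lt_top {ι : Type*} (b : HilbertBasis ι ℝ H)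
    {A : H →L[ℝ] H} (hA : ∑' i, ‖A (b i)‖ₑ ^ 2 < ⊤) : IsCompactOperator A := by
  refine b.isCompactOperator_of_summable ?_
  have h2 := ENNReal.summable_toReal hA.ne
  simpa using h2

/-- Both sides sum the squared matrix entries, in opposite orders. -/
lemma HilbertBasis.tsum_enorm_sq_adjoint {ι : Type*} (b : HilbertBasis ι ℝ H) (A : H →L[ℝ] H) :
    ∑' i, ‖ContinuousLinearMap.adjoint A (b i)‖ₑ ^ 2 = ∑' i, ‖A (b i)‖ₑ ^ 2 := by
  simp_rw [b.enorm_sq_eq_tsum]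
  rw [ENNReal.tsum_comm]
  congr 1
  ext i
  congr 1
  ext j
  rw [ContinuousLinearMap.adjoint_inner_right, real_inner_comm]

end HilbertSpace

lemma eLpNorm_two_sq {Ω E : Type*} [MeasurableSpace Ω] [NormedAddCommGroup E] (μ : Measure Ω)
    (X : Ω → E) : eLpNorm X 2 μ ^ 2 = ∫⁻ ω, ‖X ω‖ₑ ^ 2 ∂μ := by
  have h := eLpNorm_nnreal_pow_eq_lintegral (μ := μ) (f := X) (p := 2) two_ne_zero
  have h2 : (((2 : NNReal) : ℝ)) = ((2 : ℕ) : ℝ) := by norm_num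
  simp only [h2, ENNReal.rpow_natCast] at h
  exact_mod_cast h

lemma memLp_two_iff_lintegral {Ω E : Type*} [MeasurableSpace Ω] [NormedAddCommGroup E]
    {μ : Measure Ω} {X : Ω → E} (hX : AEStronglyMeasurable X μ) :
    MemLp X 2 μ ↔ ∫⁻ ω, ‖X ω‖ₑ ^ 2 ∂μ < ⊤ := by
  rw [← eLpNorm_two_sq]
  constructor
  · intro h
    exact ENNReal.pow_lt_top h.2
  · intro h
    refine ⟨hX, ?_⟩
    by_contra hc
    rw [not_lt, top_le_iff] at hc
    simp [hc] at h

/-! ### Integral operators on the interval -/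

section L2Interval

instance instSeparableSpaceL2Interval (T : ℝ) : SecondCountableTopology (L2Interval T) := by
  have : Fact ((2 : ENNReal) ≠ ⊤) := ⟨by norm_num⟩
  infer_instance

/-- A Hilbert–Schmidt integral operator is square summable along Hilbert bases. -/
lemma IsHilbertSchmidtIntegralOperator.tsum_enorm_sq_lt_top {T : ℝ}
    {A : L2Interval T →L[ℝ] L2Interval T} (hA : IsHilbertSchmidtIntegralOperator T A)
    {ι : Type*} [Countable ι] (b : HilbertBasis ι ℝ (L2Interval T)) :
    ∑' i, ‖A (b i)‖ₑ ^ 2 < ⊤ := by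
  obtain ⟨k, hk, hkA⟩ := hA
  set ν := intervalMeasure T
  -- The operator integrates over the first kernel variable; the swap makes `u ↦ k u v` the section
  -- over `v`.
  have hk' : MemLp (fun p : ℝ × ℝ => k p.2 p.1) 2 (ν.prod ν) :=
    hk.comp_measurePreserving Measure.measurePreserving_swap
  have hfin : ∫⁻ v, ∫⁻ u, ‖k u v‖ₑ ^ 2 ∂ν ∂ν < ⊤ := by
    have h1 := (memLp_two_iff_lintegral hk'.1).1 hk'
    rwa [lintegral_prod _ (hk'.1.enorm.pow_const 2)] at h1
  have hsec : ∀ᵐ v ∂ν, MemLp (fun u => k u v) 2 ν := by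
    have h1 : AEMeasurable (fun v => ∫⁻ u, ‖k u v‖ₑ ^ 2 ∂ν) ν :=
      (hk'.1.enorm.pow_const 2).lintegral_prod_right'
    filter_upwards [hk'.1.prodMk_left, ae_lt_top' h1 hfin.ne] with v hv1 hv2
    exact (memLp_two_iff_lintegral hv1).2 hv2
  have hall : ∀ᵐ v ∂ν, ∀ i, A (b i) v = ∫ u, k u v * b i u ∂ν := by
    rw [ae_all_iff]
    exact fun i => hkA (b i)
  -- For almost every `v`, the numbers `A (b i) v` are the coefficients of the section `u ↦ k u v`,
  -- and Parseval applies.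
  have hae : ∀ᵐ v ∂ν, ∑' i, ‖A (b i) v‖ₑ ^ 2 = ∫⁻ u, ‖k u v‖ₑ ^ 2 ∂ν := by
    filter_upwards [hsec, hall] with v hv hv'
    rw [← eLpNorm_two_sq, ← Lp.enorm_toLp hv, b.enorm_sq_eq_tsum]
    congr 1
    ext i
    rw [hv' i, L2.inner_def]
    congr 2
    refine integral_congr_ae ?_
    filter_upwards [hv.coeFn_toLp] with u hu
    rw [hu]
    simp
  have h1 : ∀ i, ‖A (b i)‖ₑ ^ 2 = ∫⁻ v, ‖A (b i) v‖ₑ ^ 2 ∂ν := by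
    intro i
    rw [← eLpNorm_two_sq, Lp.enorm_def]
  simp_rw [h1]
  rw [← lintegral_tsum fun i => (Lp.aestronglyMeasurable (A (b i))).enorm.pow_const 2,
    lintegral_congr_ae hae]
  exact hfin

/-- Hilbert–Schmidt integral operators are compact. -/
lemma IsHilbertSchmidtIntegralOperator.isCompactOperator {T : ℝ}
    {A : L2Interval T →L[ℝ] L2Interval T} (hA : IsHilbertSchmidtIntegralOperator T A) :
    IsCompactOperator A := by
  obtain ⟨w, b, hw⟩ := exists_countable_hilbertBasis (L2Interval T)
  exact b.isCompactOperator_of_tsum_lt_top (hA.tsum_enorm_sq_lt_top b)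

lemma IsHilbertSchmidtIntegralOperator.isCompactOperator_adjoint {T : ℝ}
    {A : L2Interval T →L[ℝ] L2Interval T} (hA : IsHilbertSchmidtIntegralOperator T A) :
    IsCompactOperator (ContinuousLinearMap.adjoint A) := by
  obtain ⟨w, b, hw⟩ := exists_countable_hilbertBasis (L2Interval T)
  refine b.isCompactOperator_of_tsum_lt_top ?_
  rw [b.tsum_enorm_sq_adjoint]
  exact hA.tsum_enorm_sq_lt_top b

/-- The indicators of the disjoint intervals (T/(n+2), T/(n+1)) are nonzero and mutually orthogonal.
-/
lemma not_finiteDimensional_L2Interval {T : ℝ} (hT : 0 < T) :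
    ¬ FiniteDimensional ℝ (L2Interval T) := by
  intro hfd
  set s : ℕ → Set ℝ := fun n => Set.Ioo (T / ((n : ℝ) + 2)) (T / ((n : ℝ) + 1)) with hs
  have hsm : ∀ n, MeasurableSet (s n) := fun n => measurableSet_Ioo
  have hlt : ∀ n : ℕ, T / ((n : ℝ) + 2) < T / ((n : ℝ) + 1) := fun n => by gcongr; norm_num
  have hsub : ∀ n, s n ⊆ Set.Icc 0 T := by
    intro n x hx
    refine ⟨le_trans (by positivity) hx.1.le, hx.2.le.trans (div_le_self hT.le ?_)⟩
    linarith [n.cast_nonneg (α := ℝ)]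
  have hmeas : ∀ n, intervalMeasure T (s n) = volume (s n) := fun n => by
    rw [Measure.restrict_apply (hsm n), Set.inter_eq_self_of_subset_left (hsub n)]
  have hne : ∀ n, intervalMeasure T (s n) ≠ ⊤ := fun n => measure_ne_top _ _
  have hdisj : ∀ m n, m < n → s m ∩ s n = ∅ := by
    intro m n hmn
    rw [Set.eq_empty_iff_forall_notMem]
    rintro x ⟨h1, h2⟩
    have h3 : T / ((n : ℝ) + 1) ≤ T / ((m : ℝ) + 2) := by
      apply div_le_div_of_nonneg_left hT.le (by positivity)
      have : (m : ℝ) + 1 ≤ n := by exact_mod_cast hmn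
      linarith
    exact absurd (h1.1.trans h2.2) (not_lt.2 h3)
  set g : ℕ → L2Interval T := fun n => indicatorConstLp 2 (hsm n) (hne n) (1 : ℝ) with hg
  have hinner : ∀ m n, ⟪g m, g n⟫_ℝ = (intervalMeasure T).real (s m ∩ s n) := fun m n =>
    L2.real_inner_indicatorConstLp_one_indicatorConstLp_one (hsm m) (hsm n) (hne m) (hne n)
  have hli : LinearIndependent ℝ g := by
    refine linearIndependent_of_ne_zero_of_inner_eq_zero (𝕜 := ℝ) (fun n h0 => ?_) fun m n hmn => ?_
    · have h1 := hinner n n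
      rw [h0, inner_zero_left, Set.inter_self, measureReal_def, hmeas, Real.volume_Ioo,
        ENNReal.toReal_ofReal (sub_nonneg.2 (hlt n).le)] at h1
      linarith [hlt n]
    · change ⟪g m, g n⟫_ℝ = 0
      rw [hinner]
      rcases lt_or_gt_of_ne hmn with h | h
      · rw [hdisj m n h]; simp
      · rw [Set.inter_comm, hdisj n m h]; simp
  exact Module.Finite.not_linearIndependent_of_infinite g hli

end L2Interval

/-! ### Powers of compact operators that contract a form -/

section PowerStability

variable {H : Type*} [NormedAddCommGroup H] [InnerProductSpace ℝ H]

/-- Orbits of a compact operator that contracts a weaker positive definite form are bounded. -/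
lemma exists_norm_pow_apply_le {A C : H →L[ℝ] H} (hA : IsCompactOperator A)
    (hpos : ∀ x, x ≠ 0 → 0 < ⟪C x, x⟫_ℝ) (hcon : ∀ x, ⟪C (A x), A x⟫_ℝ ≤ ⟪C x, x⟫_ℝ) (x : H) :
    ∃ M, ∀ k : ℕ, ‖(A ^ k) x‖ ≤ M := by
  obtain ⟨K, hK, hKsub⟩ := hA.image_closedBall_subset_compact (f := (A : H →ₗ[ℝ] H)) 1
  -- By compactness the form, though weaker than the norm, has a positive minimum on the part of the
  -- image of the unit ball at norm at least 1.
  have hδ : ∃ δ > 0, ∀ y, ‖y‖ ≤ 1 → 1 ≤ ‖A y‖ → δ ≤ ⟪C (A y), A y⟫_ℝ := by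
    set K' := K ∩ {y | 1 ≤ ‖y‖} with hK'
    have hK'c : IsCompact K' := hK.inter_right (isClosed_le continuous_const continuous_norm)
    rcases K'.eq_empty_or_nonempty with hem | hne
    · refine ⟨1, one_pos, fun y hy hy' => ?_⟩
      have : A y ∈ K' := ⟨hKsub ⟨y, by simpa using hy, rfl⟩, hy'⟩
      rw [hem] at this
      exact this.elim
    · obtain ⟨z, hz, hmin⟩ := hK'c.exists_isMinOn hne
        (f := fun y => ⟪C y, y⟫_ℝ) (by fun_prop)
      refine ⟨⟪C z, z⟫_ℝ, hpos z ?_, fun y hy hy' =>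
        hmin ⟨hKsub ⟨y, by simpa using hy, rfl⟩, hy'⟩⟩
      rintro rfl
      have := hz.2
      simp at this
      linarith
  obtain ⟨δ, hδ0, hδ⟩ := hδ
  have hnn : 0 ≤ ⟪C x, x⟫_ℝ := by
    by_cases h0 : x = 0
    · simp [h0]
    · exact (hpos x h0).le
  have hCk : ∀ k : ℕ, ⟪C ((A ^ k) x), (A ^ k) x⟫_ℝ ≤ ⟪C x, x⟫_ℝ := by
    intro k
    induction k with
    | zero => simp
    | succ k ih =>
      rw [pow_succ']
      exact (hcon _).trans ih
  set r := ‖x‖ + Real.sqrt (⟪C x, x⟫_ℝ / δ) + 1 with hr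
  have hs := Real.sqrt_nonneg (⟪C x, x⟫_ℝ / δ)
  have hr0 : 0 < r := by have := norm_nonneg x; linarith
  refine ⟨r, fun k => ?_⟩
  induction k with
  | zero => simp only [pow_zero, one_apply_eq_self]; linarith
  | succ k ih =>
    by_contra hc
    rw [not_le, pow_succ'] at hc
    set y := (A ^ k) x with hy
    have hc' : r < ‖A y‖ := hc
    -- At a first exit from the ball of radius `r`, rescaling by `r` shows that the form is at least
    -- δr²; but it never exceeds its initial value, and `r` was chosen too large for that.
    have h1 := hδ (r⁻¹ • y) (by
      rw [norm_smul, Real.norm_of_nonneg (inv_nonneg.2 hr0.le), inv_mul_le_iff₀ hr0]; linarith) (by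
      rw [map_smul, norm_smul, Real.norm_of_nonneg (inv_nonneg.2 hr0.le), le_inv_mul_iff₀ hr0]
      linarith)
    simp only [map_smul, real_inner_smul_left, real_inner_smul_right] at h1
    have h2 : ⟪C (A y), A y⟫_ℝ ≤ ⟪C x, x⟫_ℝ := (hcon y).trans (hCk k)
    have h3 : δ * r ^ 2 ≤ ⟪C x, x⟫_ℝ := by
      have := mul_le_mul_of_nonneg_right h1 (sq_nonneg r)
      refine this.trans (le_trans (le_of_eq ?_) h2)
      field_simp
    have h4 : r ^ 2 ≤ ⟪C x, x⟫_ℝ / δ := by rw [le_div_iff₀ hδ0]; linarith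
    have h5 : r ≤ Real.sqrt (⟪C x, x⟫_ℝ / δ) := Real.le_sqrt_of_sq_le h4
    have := norm_nonneg x
    linarith

variable [CompleteSpace H]

lemma exists_norm_pow_le {A C : H →L[ℝ] H} (hA : IsCompactOperator A)
    (hpos : ∀ x, x ≠ 0 → 0 < ⟪C x, x⟫_ℝ) (hcon : ∀ x, ⟪C (A x), A x⟫_ℝ ≤ ⟪C x, x⟫_ℝ) :
    ∃ M, ∀ k : ℕ, ‖A ^ k‖ ≤ M :=
  banach_steinhaus (exists_norm_pow_apply_le hA hpos hcon)

/-- The powers of a compact operator that contracts a weaker positive definite form have strong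
limit points, which preserve the limiting form. -/
lemma exists_limit_pow {A C : H →L[ℝ] H} (hA : IsCompactOperator A)
    (hpos : ∀ x, x ≠ 0 → 0 < ⟪C x, x⟫_ℝ) (hcon : ∀ x, ⟪C (A x), A x⟫_ℝ ≤ ⟪C x, x⟫_ℝ)
    (U : Ultrafilter ℕ) (hU : (U : Filter ℕ) ≤ atTop) :
    ∃ L : H →L[ℝ] H, (∀ x, Tendsto (fun k => (A ^ k) x) U (𝓝 (L x))) ∧
      (∀ x, L (A x) = A (L x)) ∧ ∀ x, ⟪C (L (A x)), L (A x)⟫_ℝ = ⟪C (L x), L x⟫_ℝ := by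
  obtain ⟨M, hM⟩ := exists_norm_pow_le hA hpos hcon
  -- Each orbit is relatively compact. An ultrafilter selects limits for all `x` at once, which
  -- makes the limit linear in `x`.
  have hex : ∀ x, ∃ y, Tendsto (fun k => (A ^ k) x) U (𝓝 y) := by
    intro x
    obtain ⟨K, hK, hKsub⟩ := hA.image_closedBall_subset_compact (f := (A : H →ₗ[ℝ] H)) (M * ‖x‖)
    have hmem : ∀ᶠ k in (U : Filter ℕ), (A ^ k) x ∈ K := by
      filter_upwards [hU (eventually_ge_atTop 1)] with k hk
      obtain ⟨m, rfl⟩ := Nat.exists_eq_add_of_le' hk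
      rw [pow_succ']
      refine hKsub ⟨(A ^ m) x, ?_, rfl⟩
      rw [mem_closedBall_zero_iff]
      exact ((A ^ m).le_opNorm x).trans (mul_le_mul_of_nonneg_right (hM m) (norm_nonneg _))
    obtain ⟨y, -, hy⟩ := hK.ultrafilter_le_nhds (U.map fun k => (A ^ k) x)
      (le_principal_iff.2 hmem)
    exact ⟨y, hy⟩
  choose g hg using hex
  let L₀ : H →ₗ[ℝ] H := linearMapOfTendsto (l := (U : Filter ℕ)) g
    (fun k => ((A ^ k : H →L[ℝ] H) : H →ₗ[ℝ] H)) (tendsto_pi_nhds.2 hg)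
  have hL₀ : ∀ x, ‖L₀ x‖ ≤ M * ‖x‖ := fun x =>
    le_of_tendsto (hg x).norm (Eventually.of_forall fun k =>
      ((A ^ k).le_opNorm x).trans (mul_le_mul_of_nonneg_right (hM k) (norm_nonneg _)))
  let L : H →L[ℝ] H := L₀.mkContinuous M hL₀
  have hL : ∀ x, Tendsto (fun k => (A ^ k) x) U (𝓝 (L x)) := hg
  refine ⟨L, hL, fun x => ?_, fun x => ?_⟩
  · refine tendsto_nhds_unique (hL (A x)) ?_
    refine ((A.continuous.tendsto _).comp (hL x)).congr fun k => ?_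
    change (A * A ^ k) x = (A ^ k * A) x
    rw [← pow_succ, ← pow_succ']
  · set u : ℕ → ℝ := fun k => ⟪C ((A ^ k) x), (A ^ k) x⟫_ℝ with hu
    have hnn : ∀ x, 0 ≤ ⟪C x, x⟫_ℝ := by
      intro x
      by_cases h0 : x = 0
      · simp [h0]
      · exact (hpos x h0).le
    have hanti : Antitone u := antitone_nat_of_succ_le fun k => by
      simp only [hu]
      rw [pow_succ']
      exact hcon _
    -- The form decreases along an orbit, hence converges along the full sequence; the orbits of `x`
    -- and `A x` differ by a shift and share this limit.
    obtain ⟨q, hq⟩ : ∃ q, Tendsto u atTop (𝓝 q) :=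
      ⟨_, tendsto_atTop_ciInf hanti ⟨0, by rintro _ ⟨k, rfl⟩; exact hnn _⟩⟩
    have hC : Continuous fun y : H => ⟪C y, y⟫_ℝ := by fun_prop
    have h1 : ⟪C (L x), L x⟫_ℝ = q :=
      tendsto_nhds_unique ((hC.tendsto _).comp (hL x)) (hq.mono_left hU)
    have h2 : ⟪C (L (A x)), L (A x)⟫_ℝ = q := by
      refine tendsto_nhds_unique ((hC.tendsto _).comp (hL (A x))) ?_
      refine (((tendsto_add_atTop_iff_nat 1).2 hq).mono_left hU).congr fun k => ?_
      simp only [hu, Function.comp_apply]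
      rw [pow_succ]
      rfl
    rw [h1, h2]

/-- If the powers of a compact operator tend to zero strongly, they do so in norm. -/
lemma tendsto_norm_pow_of_tendsto_apply {A : H →L[ℝ] H} (hA : IsCompactOperator A)
    (h : ∀ x, Tendsto (fun k : ℕ => (A ^ k) x) atTop (𝓝 0)) :
    Tendsto (fun k : ℕ => ‖A ^ k‖) atTop (𝓝 0) := by
  obtain ⟨M, hM⟩ : ∃ M, ∀ k : ℕ, ‖A ^ k‖ ≤ M := banach_steinhaus fun x => by
    obtain ⟨M, hM⟩ := (h x).norm.bddAbove_range
    exact ⟨M, fun k => hM ⟨k, rfl⟩⟩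
  have hM0 : 0 ≤ M := (norm_nonneg _).trans (hM 0)
  obtain ⟨K, hK, hKsub⟩ := hA.image_closedBall_subset_compact (f := (A : H →ₗ[ℝ] H)) 1
  -- One factor of `A` is spent on mapping the unit ball into a compact set; on a finite net of that
  -- set strong convergence is uniform.
  rw [← tendsto_add_atTop_iff_nat 1, Metric.tendsto_atTop']
  intro η hη
  set r := η / (4 * (M + 1)) with hr
  have hr0 : 0 < r := by positivity
  obtain ⟨t, -, htf, htc⟩ := hK.finite_cover_balls hr0
  have hev : ∀ᶠ k in atTop, ∀ y ∈ t, ‖(A ^ k) y‖ < η / 4 := by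
    rw [eventually_all_finite htf]
    intro y _
    exact (tendsto_zero_iff_norm_tendsto_zero.1 (h y)).eventually (Iio_mem_nhds (by positivity))
  obtain ⟨N, hN⟩ := eventually_atTop.1 hev
  refine ⟨N, fun k hk => ?_⟩
  rw [dist_zero_right, norm_norm]
  have hle : ‖A ^ (k + 1)‖ ≤ η / 2 := by
    refine ContinuousLinearMap.opNorm_le_of_unit_norm (by positivity) fun x hx => ?_
    have hAx : A x ∈ K := hKsub ⟨x, by simp [hx], rfl⟩
    obtain ⟨y, hy, hxy⟩ := Set.mem_iUnion₂.1 (htc hAx)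
    rw [Metric.mem_ball, dist_eq_norm] at hxy
    rw [pow_succ]
    change ‖(A ^ k) (A x)‖ ≤ _
    have h1 : (A ^ k) (A x) = (A ^ k) (A x - y) + (A ^ k) y := by rw [map_sub]; abel
    rw [h1]
    have h2 : ‖(A ^ k) (A x - y)‖ ≤ M * r := ((A ^ k).le_opNorm _).trans
      (mul_le_mul (hM k) hxy.le (norm_nonneg _) hM0)
    have h3 := hN k hk.le y hy
    have h4 : M * r ≤ η / 4 := by
      rw [hr, mul_div_assoc', div_le_div_iff₀ (by positivity) (by norm_num)]
      nlinarith
    exact (norm_add_le _ _).trans (by linarith)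
  linarith

end PowerStability

/-! ### Calculus of cross-covariance operators -/

section CrossCovariance

variable {H : Type*} [NormedAddCommGroup H] [InnerProductSpace ℝ H] [CompleteSpace H]
  {Ω : Type*} [MeasurableSpace Ω] {μ : Measure Ω} [IsProbabilityMeasure μ] {X Y Z : Ω → H}

lemma inner_crossCov (hX : MemLp X 2 μ) (hY : MemLp Y 2 μ) (g h : H) :
    ⟪crossCov μ X Y g, h⟫_ℝ =
      ∫ ω, ⟪X ω - ∫ ω', X ω' ∂μ, g⟫_ℝ * ⟪Y ω - ∫ ω', Y ω' ∂μ, h⟫_ℝ ∂μ := by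
  have hX' : MemLp (fun ω => ⟪X ω - ∫ ω', X ω' ∂μ, g⟫_ℝ) 2 μ :=
    (hX.sub (memLp_const _)).inner_const g
  have hY' : MemLp (fun ω => Y ω - ∫ ω', Y ω' ∂μ) 2 μ := hY.sub (memLp_const _)
  have hi : Integrable (fun ω => ⟪X ω - ∫ ω', X ω' ∂μ, g⟫_ℝ • (Y ω - ∫ ω', Y ω' ∂μ)) μ :=
    memLp_one_iff_integrable.1 (hY'.smul hX')
  rw [crossCov_apply μ hX hY, real_inner_comm, ← integral_inner hi]
  refine integral_congr_ae (Eventually.of_forall fun ω => ?_)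
  simp only [real_inner_smul_right, real_inner_comm]

omit [CompleteSpace H] [IsProbabilityMeasure μ] in
lemma crossCov_congr_ae {X' Y' : Ω → H} (hX : X =ᵐ[μ] X') (hY : Y =ᵐ[μ] Y') :
    crossCov μ X Y = crossCov μ X' Y' := by
  rw [crossCov, crossCov, integral_congr_ae hX, integral_congr_ae hY]
  refine integral_congr_ae ?_
  filter_upwards [hX, hY] with ω h1 h2
  rw [h1, h2]

lemma adjoint_crossCov (hX : MemLp X 2 μ) (hY : MemLp Y 2 μ) :
    ContinuousLinearMap.adjoint (crossCov μ X Y) = crossCov μ Y X := by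
  symm
  rw [ContinuousLinearMap.eq_adjoint_iff]
  intro g h
  rw [inner_crossCov hY hX, real_inner_comm, inner_crossCov hX hY]
  refine integral_congr_ae (Eventually.of_forall fun ω => mul_comm _ _)

lemma crossCov_clm_comp (S T : H →L[ℝ] H) (hX : MemLp X 2 μ) (hY : MemLp Y 2 μ) :
    crossCov μ (fun ω => S (X ω)) (fun ω => T (Y ω)) =
      T ∘L crossCov μ X Y ∘L ContinuousLinearMap.adjoint S := by
  have hSX : MemLp (fun ω => S (X ω)) 2 μ := S.comp_memLp' hX
  have hTY : MemLp (fun ω => T (Y ω)) 2 μ := T.comp_memLp' hY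
  refine ContinuousLinearMap.ext fun g => ext_inner_right ℝ fun h => ?_
  rw [inner_crossCov hSX hTY, ContinuousLinearMap.comp_apply, ContinuousLinearMap.comp_apply,
    ← ContinuousLinearMap.adjoint_inner_right T, inner_crossCov hX hY]
  refine integral_congr_ae (Eventually.of_forall fun ω => ?_)
  simp only [ContinuousLinearMap.adjoint_inner_right, map_sub]
  rw [ContinuousLinearMap.integral_comp_comm S (hX.integrable one_le_two),
    ContinuousLinearMap.integral_comp_comm T (hY.integrable one_le_two)]

lemma crossCov_add_right (hX : MemLp X 2 μ) (hY : MemLp Y 2 μ) (hZ : MemLp Z 2 μ) :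
    crossCov μ X (fun ω => Y ω + Z ω) = crossCov μ X Y + crossCov μ X Z := by
  have hYZ : MemLp (fun ω => Y ω + Z ω) 2 μ := hY.add hZ
  refine ContinuousLinearMap.ext fun g => ext_inner_right ℝ fun h => ?_
  rw [add_apply, inner_add_left, inner_crossCov hX hYZ, inner_crossCov hX hY,
    inner_crossCov hX hZ, ← integral_add]
  · refine integral_congr_ae (Eventually.of_forall fun ω => ?_)
    simp only
    rw [integral_add (hY.integrable one_le_two) (hZ.integrable one_le_two), ← mul_add,
      ← inner_add_left]
    congr 2
    abel
  · exact MemLp.integrable_mul ((hX.sub (memLp_const _)).inner_const g)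
      ((hY.sub (memLp_const _)).inner_const h)
  · exact MemLp.integrable_mul ((hX.sub (memLp_const _)).inner_const g)
      ((hZ.sub (memLp_const _)).inner_const h)

lemma crossCov_add_left (hX : MemLp X 2 μ) (hY : MemLp Y 2 μ) (hZ : MemLp Z 2 μ) :
    crossCov μ (fun ω => X ω + Y ω) Z = crossCov μ X Z + crossCov μ Y Z := by
  have hXY : MemLp (fun ω => X ω + Y ω) 2 μ := hX.add hY
  rw [← adjoint_crossCov hZ hXY, crossCov_add_right hZ hX hY, map_add, adjoint_crossCov hZ hX,
    adjoint_crossCov hZ hY]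

lemma inner_crossCov_self_nonneg (hX : MemLp X 2 μ) (g : H) : 0 ≤ ⟪crossCov μ X X g, g⟫_ℝ := by
  rw [inner_crossCov hX hX]
  exact integral_nonneg fun ω => mul_self_nonneg _

/-- A vanishing variance in the direction `g` forces `X` to be almost surely constant in that
direction. -/
lemma inner_ae_eq_of_crossCov_self (hX : MemLp X 2 μ) {g : H}
    (h : ⟪crossCov μ X X g, g⟫_ℝ = 0) : ∀ᵐ ω ∂μ, ⟪X ω - ∫ ω', X ω' ∂μ, g⟫_ℝ = 0 := by
  have hX' : MemLp (fun ω => ⟪X ω - ∫ ω', X ω' ∂μ, g⟫_ℝ) 2 μ :=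
    (hX.sub (memLp_const _)).inner_const g
  rw [inner_crossCov hX hX, integral_eq_zero_iff_of_nonneg (fun ω => mul_self_nonneg _)
    (hX'.integrable_mul hX')] at h
  filter_upwards [h] with ω hω
  exact mul_self_eq_zero.1 hω

end CrossCovariance

/-! ### Covariance equations, and stability from uniqueness -/

section Autoregression

variable {H : Type*} [NormedAddCommGroup H] [InnerProductSpace ℝ H] [CompleteSpace H]
  {Ω : Type*} [MeasurableSpace Ω] {μ : Measure Ω} [IsProbabilityMeasure μ]
  {ρ : H →L[ℝ] H} {ε f : ℤ → Ω → H}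

namespace IsStationarySolution

omit [IsProbabilityMeasure μ] [CompleteSpace H] in
lemma crossCov_self (hs : IsStationarySolution μ ρ ε f) (t : ℤ) :
    crossCov μ (f t) (f t) = covOp μ f := by
  have := hs.stationary.cov t 0 0
  simpa [covOp] using this

/-- The Yule–Walker equation: the innovation is uncorrelated with the present and drops out. -/
lemma crossCov_succ (hs : IsStationarySolution μ ρ ε f) (hε : ∀ t, MemLp (ε t) 2 μ) (t : ℤ) :
    crossCov μ (f t) (f (t + 1)) = ρ ∘L covOp μ f := by
  have hf := hs.stationary.memLp t
  rw [crossCov_congr_ae (EventuallyEq.refl _ (f t)) (hs.recursion t),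
    crossCov_add_right hf (show MemLp (fun ω => ρ (f t ω)) 2 μ from ρ.comp_memLp' hf) (hε t),
    hs.innovation, add_zero,
    ← hs.crossCov_self t]
  have := crossCov_clm_comp (μ := μ) (ContinuousLinearMap.id ℝ H) ρ hf hf
  rw [show ContinuousLinearMap.adjoint (ContinuousLinearMap.id ℝ H) =
    ContinuousLinearMap.id ℝ H from star_one (H →L[ℝ] H)] at this
  simpa using this

lemma crossCovSq_eq (hs : IsStationarySolution μ ρ ε f) (hε : ∀ t, MemLp (ε t) 2 μ) (x : H) :
    crossCovSq μ f x = covOp μ f (ContinuousLinearMap.adjoint ρ (ρ (covOp μ f x))) := by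
  have hf := hs.stationary.memLp
  have h1 := hs.crossCov_succ hε 0
  rw [zero_add] at h1
  have h2 : ContinuousLinearMap.adjoint (covOp μ f) = covOp μ f :=
    adjoint_crossCov (hf 0) (hf 0)
  rw [crossCovSq, ← adjoint_crossCov (hf 0) (hf 1), h1, ContinuousLinearMap.adjoint_comp, h2]
  rfl

lemma covOp_symm (hs : IsStationarySolution μ ρ ε f) (x y : H) :
    ⟪covOp μ f x, y⟫_ℝ = ⟪x, covOp μ f y⟫_ℝ := by
  have h2 : ContinuousLinearMap.adjoint (covOp μ f) = covOp μ f :=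
    adjoint_crossCov (hs.stationary.memLp 0) (hs.stationary.memLp 0)
  conv_lhs => rw [← h2, ContinuousLinearMap.adjoint_inner_left]

lemma isCompactPencil (hs : IsStationarySolution μ ρ ε f) (hε : ∀ t, MemLp (ε t) 2 μ)
    (hρ : IsCompactOperator ρ) (hpos : ∀ x, x ≠ 0 → 0 < ⟪covOp μ f x, x⟫_ℝ) :
    IsCompactPencil (crossCovSq μ f) (covOp μ f) ρ where
  symm := hs.covOp_symm
  pos := hpos
  compact := hρ
  factor := hs.crossCovSq_eq hε

/-- The stationary covariance equation `Γ₁₁ = ρ Γ₁₁ ρ* + E[ε ⊗ ε]`. -/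
lemma covOp_eq (hs : IsStationarySolution μ ρ ε f) (hε : ∀ t, MemLp (ε t) 2 μ) (t : ℤ) :
    covOp μ f = ρ ∘L covOp μ f ∘L ContinuousLinearMap.adjoint ρ + crossCov μ (ε t) (ε t) := by
  have hf := hs.stationary.memLp t
  have hρf : MemLp (fun ω => ρ (f t ω)) 2 μ := ρ.comp_memLp' hf
  have h1 : crossCov μ (fun ω => ρ (f t ω)) (ε t) = 0 := by
    have := crossCov_clm_comp (μ := μ) ρ (ContinuousLinearMap.id ℝ H) hf (hε t)
    rw [hs.innovation] at this
    simpa using this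
  have h2 : crossCov μ (ε t) (fun ω => ρ (f t ω)) = 0 := by
    rw [← adjoint_crossCov hρf (hε t), h1, map_zero]
  conv_lhs => rw [← hs.crossCov_self (t + 1), crossCov_congr_ae (hs.recursion t) (hs.recursion t)]
  rw [crossCov_add_left hρf (hε t)
    (show MemLp (fun ω => ρ (f t ω) + ε t ω) 2 μ from hρf.add (hε t)),
    crossCov_add_right hρf hρf (hε t),
    crossCov_add_right (hε t) hρf (hε t), h1, h2, crossCov_clm_comp ρ ρ hf hf,
    hs.crossCov_self t, add_zero, zero_add]

end IsStationarySolution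

variable [MeasurableSpace H] [SecondCountableTopology H]

/-- If the autoregression determines its stationary solution and the covariance operator is
positive definite, then the powers of the autoregression operator tend to zero. -/
theorem DefinesStationaryProcess.tendsto_norm_pow (hf : DefinesStationaryProcess μ ρ ε f)
    (hε : IsStrongWhiteNoise μ ε) (hρ : IsCompactOperator (ContinuousLinearMap.adjoint ρ))
    (hpos : ∀ x, x ≠ 0 → 0 < ⟪covOp μ f x, x⟫_ℝ) :
    Tendsto (fun k : ℕ => ‖ρ ^ k‖) atTop (𝓝 0) := by
  obtain ⟨hs, huniq⟩ := hf
  set A := ContinuousLinearMap.adjoint ρ with hA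
  set C := covOp μ f with hC
  have hcov : ∀ x t, ⟪C x, x⟫_ℝ = ⟪C (A x), A x⟫_ℝ + ⟪crossCov μ (ε t) (ε t) x, x⟫_ℝ := by
    intro x t
    conv_lhs => rw [hC, hs.covOp_eq hε.memLp t, add_apply, inner_add_left]
    rw [ContinuousLinearMap.comp_apply, ContinuousLinearMap.comp_apply,
      ← ContinuousLinearMap.adjoint_inner_right]
  have hcon : ∀ x, ⟪C (A x), A x⟫_ℝ ≤ ⟪C x, x⟫_ℝ := fun x => by
    rw [hcov x 0]; linarith [inner_crossCov_self_nonneg (hε.memLp 0) x]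
  have hnorm : ∀ k : ℕ, ‖ρ ^ k‖ = ‖A ^ k‖ := by
    intro k
    have h1 : A ^ k = ContinuousLinearMap.adjoint (ρ ^ k) := (star_pow ρ k).symm
    rw [h1]
    exact (LinearIsometryEquiv.norm_map ContinuousLinearMap.adjoint (ρ ^ k)).symm
  simp_rw [hnorm]
  refine tendsto_norm_pow_of_tendsto_apply hρ fun x => ?_
  rw [tendsto_iff_ultrafilter]
  intro U hU
  obtain ⟨L, hL, hcomm, hform⟩ := exists_limit_pow hρ hpos hcon U hU
  suffices hL0 : ∀ x, L x = 0 by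
    have := hL x
    rwa [hL0] at this
  set P := ContinuousLinearMap.adjoint L with hP
  have hPρ : ∀ x, P (ρ x) = ρ (P x) := by
    intro x
    refine ext_inner_right ℝ fun y => ?_
    have h1 : ⟪P (ρ x), y⟫_ℝ = ⟪x, A (L y)⟫_ℝ := by
      rw [hP, ContinuousLinearMap.adjoint_inner_left, hA, ContinuousLinearMap.adjoint_inner_right]
    have h2 : ⟪ρ (P x), y⟫_ℝ = ⟪x, L (A y)⟫_ℝ := by
      rw [← ContinuousLinearMap.adjoint_inner_right, ← hA, hP,
        ContinuousLinearMap.adjoint_inner_left]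
    rw [h1, h2, hcomm]
  -- the projected innovations vanish
  have hPε : ∀ t, ∀ᵐ ω ∂μ, P (ε t ω) = 0 := by
    intro t
    refine ae_eq_zero_of_forall_inner (𝕜 := ℝ) (f := fun ω => P (ε t ω)) fun y => ?_
    -- On the range of `L` the form is preserved by `A`; the noise covariance is exactly the loss of
    -- form under `A`, so it vanishes there.
    have h1 : ⟪crossCov μ (ε t) (ε t) (L y), L y⟫_ℝ = 0 := by
      have h2 := hcov (L y) t
      rw [← hcomm, hform] at h2
      linarith
    filter_upwards [inner_ae_eq_of_crossCov_self (hε.memLp t) h1] with ω hω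
    rw [hε.mean_zero, sub_zero] at hω
    rw [hP, ContinuousLinearMap.adjoint_inner_right, real_inner_comm]
    exact hω
  -- `P` commutes with `ρ` and kills the noise, so the process `P f` solves the homogeneous
  -- recursion and can be added to `f`. Uniqueness then forces `P f = 0`.
  set S : H →L[ℝ] H := ContinuousLinearMap.id ℝ H + P with hS
  have hSx : ∀ x, S x = x + P x := fun x => by simp [hS]
  have hsol : IsStationarySolution μ ρ ε fun t ω => S (f t ω) := by
    have hfm := hs.stationary.memLp
    refine ⟨⟨fun t => S.comp_memLp' (hfm t), fun s t => ?_, fun s t h => ?_⟩, fun t => ?_,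
      fun t => ?_⟩
    · rw [ContinuousLinearMap.integral_comp_comm S ((hfm s).integrable one_le_two),
        ContinuousLinearMap.integral_comp_comm S ((hfm t).integrable one_le_two),
        hs.stationary.mean s t]
    · rw [crossCov_clm_comp S S (hfm _) (hfm _), crossCov_clm_comp S S (hfm _) (hfm _),
        hs.stationary.cov s t h]
    · filter_upwards [hs.recursion t, hPε t] with ω h1 h2
      rw [h1, hSx, hSx, map_add, map_add, h2, hPρ]
      abel
    · have := crossCov_clm_comp (μ := μ) S (ContinuousLinearMap.id ℝ H) (hfm t) (hε.memLp t)
      rw [hs.innovation] at this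
      simpa using this
  have hPf : (fun ω => P (f 0 ω)) =ᵐ[μ] fun _ => (0 : H) := by
    filter_upwards [huniq _ hsol 0] with ω hω
    rw [hSx] at hω
    simpa using hω
  intro x
  by_contra hne
  have h1 := hpos (L x) hne
  -- The form at `L x` is the variance of `P f` in the direction `x`.
  have h2 : ⟪C (L x), L x⟫_ℝ = ⟪(P ∘L C ∘L ContinuousLinearMap.adjoint P) x, x⟫_ℝ := by
    rw [hP, ContinuousLinearMap.adjoint_adjoint, ContinuousLinearMap.comp_apply,
      ContinuousLinearMap.comp_apply, ContinuousLinearMap.adjoint_inner_left]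
  rw [h2, hC, covOp, ← crossCov_clm_comp P P (hs.stationary.memLp 0) (hs.stationary.memLp 0),
    crossCov_congr_ae hPf hPf] at h1
  simp [crossCov] at h1

end Autoregression

/-! ### Causal representation and independence of the innovations from the past -/

section Representation

variable {H : Type*} [NormedAddCommGroup H] [InnerProductSpace ℝ H] [CompleteSpace H]
  {Ω : Type*} [MeasurableSpace Ω] {μ : Measure Ω} [IsProbabilityMeasure μ]
  {ρ : H →L[ℝ] H} {ε f : ℤ → Ω → H}

namespace IsStationarySolution

/-- The constant mean is a fixed point of `ρ`, hence of all its powers, which tend to zero. -/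
lemma integral_eq_zero (hs : IsStationarySolution μ ρ ε f) (hε : ∀ t, MemLp (ε t) 2 μ)
    (hε0 : ∀ t, ∫ ω, ε t ω ∂μ = 0) (hpow : Tendsto (fun k : ℕ => ‖ρ ^ k‖) atTop (𝓝 0)) (t : ℤ) :
    ∫ ω, f t ω ∂μ = 0 := by
  have hf := hs.stationary.memLp
  set m := ∫ ω, f t ω ∂μ with hm
  have h1 : m = ρ m := by
    have h2 : ∫ ω, f (t + 1) ω ∂μ = m := hs.stationary.mean _ _
    rw [integral_congr_ae (hs.recursion t), integral_add, hε0,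
      ContinuousLinearMap.integral_comp_comm ρ ((hf t).integrable one_le_two), add_zero] at h2
    · exact h2.symm
    · exact ρ.integrable_comp ((hf t).integrable one_le_two)
    · exact (hε t).integrable one_le_two
  have h2 : ∀ k : ℕ, (ρ ^ k) m = m := by
    intro k
    induction k with
    | zero => rfl
    | succ k ih =>
      rw [pow_succ]
      change (ρ ^ k) (ρ m) = m
      rw [← h1, ih]
  have h3 : ∀ k : ℕ, ‖m‖ ≤ ‖ρ ^ k‖ * ‖m‖ := fun k => by
    conv_lhs => rw [← h2 k]
    exact (ρ ^ k).le_opNorm m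
  have h4 : ‖m‖ ≤ 0 * ‖m‖ := ge_of_tendsto' (hpow.mul_const _) h3
  rw [zero_mul] at h4
  exact norm_le_zero_iff.1 h4

/-- Weak stationarity concerns covariance operators rather than norms; for centred variables E‖f_t‖²
is the trace of the covariance operator. -/
lemma eLpNorm_eq [TopologicalSpace.SeparableSpace H] (hs : IsStationarySolution μ ρ ε f)
    (hm : ∀ t, ∫ ω, f t ω ∂μ = 0) (t : ℤ) : eLpNorm (f t) 2 μ = eLpNorm (f 0) 2 μ := by
  have hf := hs.stationary.memLp
  obtain ⟨w, b, hw⟩ := exists_countable_hilbertBasis H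
  have key : ∀ s, eLpNorm (f s) 2 μ ^ 2 = ∑' i, ENNReal.ofReal ⟪covOp μ f (b i), b i⟫_ℝ := by
    intro s
    rw [eLpNorm_two_sq, b.lintegral_enorm_sq (hf s).1]
    congr 1
    ext i
    rw [← hs.crossCov_self s, inner_crossCov (hf s) (hf s), hm s]
    have hL : MemLp (fun ω => ⟪f s ω - 0, b i⟫_ℝ) 2 μ := by
      simpa using (hf s).inner_const (b i)
    have hint : Integrable (fun ω => ⟪f s ω - 0, b i⟫_ℝ * ⟪f s ω - 0, b i⟫_ℝ) μ :=
      hL.integrable_mul hL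
    rw [ofReal_integral_eq_lintegral_ofReal hint
      (Eventually.of_forall fun ω => mul_self_nonneg _)]
    refine lintegral_congr fun ω => ?_
    rw [sub_zero, real_inner_comm, ← ofReal_norm, ← ENNReal.ofReal_pow (norm_nonneg _), sq,
      Real.norm_eq_abs, abs_mul_abs_self]
  have h1 := (key t).trans (key 0).symm
  exact (ENNReal.pow_right_strictMono two_ne_zero).injective h1

omit [CompleteSpace H] [IsProbabilityMeasure μ] in
/-- Iterating the recursion `N` times. -/
lemma ae_eq_sum_add (hs : IsStationarySolution μ ρ ε f) (t : ℤ) (N : ℕ) :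
    ∀ᵐ ω ∂μ, f t ω = ∑ i ∈ Finset.range N, (ρ ^ i) (ε (t - 1 - i) ω) +
      (ρ ^ N) (f (t - N) ω) := by
  induction N with
  | zero => simp
  | succ N ih =>
    have h := hs.recursion (t - (N + 1 : ℕ))
    have e : t - ((N + 1 : ℕ) : ℤ) + 1 = t - N := by push_cast; ring
    rw [e] at h
    filter_upwards [ih, h] with ω h1 h2
    rw [h1, h2, Finset.sum_range_succ, map_add, pow_succ]
    have e' : t - 1 - (N : ℤ) = t - ((N + 1 : ℕ) : ℤ) := by push_cast; ring
    rw [e']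
    change _ = _ + (ρ ^ N) (ρ _)
    abel

variable [MeasurableSpace H] [BorelSpace H] [SecondCountableTopology H]

/-- The σ-algebra generated by the innovations before time `t`. -/
@[reducible] def _root_.pastAlgebra (ε : ℤ → Ω → H) (t : ℤ) : MeasurableSpace Ω :=
  ⨆ s ∈ Set.Iio t, MeasurableSpace.comap (ε s) inferInstance

omit [CompleteSpace H] [NormedAddCommGroup H] [InnerProductSpace ℝ H] [BorelSpace H]
  [SecondCountableTopology H] [MeasurableSpace Ω] in
lemma _root_.pastAlgebra_mono (ε : ℤ → Ω → H) {s t : ℤ} (h : s ≤ t) :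
    pastAlgebra ε s ≤ pastAlgebra ε t :=
  biSup_mono fun _ hu => lt_of_lt_of_le hu h

omit [CompleteSpace H] [InnerProductSpace ℝ H] [MeasurableSpace Ω] in
lemma _root_.stronglyMeasurable_pastAlgebra (ε : ℤ → Ω → H) {s t : ℤ} (h : s < t) :
    StronglyMeasurable[pastAlgebra ε t] (ε s) := by
  have h1 : Measurable[MeasurableSpace.comap (ε s) inferInstance] (ε s) :=
    comap_measurable (ε s)
  have h2 : MeasurableSpace.comap (ε s) inferInstance ≤ pastAlgebra ε t :=
    le_iSup₂_of_le s h le_rfl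
  exact (h1.mono h2 le_rfl).stronglyMeasurable

/-- A stationary solution is adapted to the past of the innovations. -/
lemma aestronglyMeasurable_past (hs : IsStationarySolution μ ρ ε f)
    (hεm : ∀ t, Measurable (ε t))
    (hm : ∀ t, ∫ ω, f t ω ∂μ = 0) (hpow : Tendsto (fun k : ℕ => ‖ρ ^ k‖) atTop (𝓝 0)) (t : ℤ) :
    AEStronglyMeasurable[pastAlgebra ε t] (f t) μ := by
  have hf := hs.stationary.memLp
  set S : ℕ → Ω → H := fun N ω => ∑ i ∈ Finset.range N, (ρ ^ i) (ε (t - 1 - i) ω) with hS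
  have hSm : ∀ N, StronglyMeasurable[pastAlgebra ε t] (S N) := by
    intro N
    refine Finset.stronglyMeasurable_fun_sum _ fun i _ => ?_
    exact (ρ ^ i).continuous.comp_stronglyMeasurable
      (stronglyMeasurable_pastAlgebra ε (by omega))
  have hSm' : ∀ N, AEStronglyMeasurable (S N) μ := by
    intro N
    refine Measurable.aestronglyMeasurable ?_
    exact Finset.measurable_fun_sum _ fun i _ => (ρ ^ i).continuous.measurable.comp (hεm _)
  -- After `N` steps the remainder is `(ρ ^ N) (f (t - N))`, whose second moment is controlled
  -- uniformly in time by stationarity.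
  have hlim : Tendsto (fun N => eLpNorm (S N - f t) 2 μ) atTop (𝓝 0) := by
    have hle : ∀ N, eLpNorm (S N - f t) 2 μ ≤ ENNReal.ofReal ‖ρ ^ N‖ * eLpNorm (f 0) 2 μ := by
      intro N
      rw [← hs.eLpNorm_eq hm (t - N)]
      refine eLpNorm_le_mul_eLpNorm_of_ae_le_mul ?_ 2
      filter_upwards [hs.ae_eq_sum_add t N] with ω hω
      rw [Pi.sub_apply, hω, sub_add_cancel_left, norm_neg]
      exact (ρ ^ N).le_opNorm _
    have h0 : Tendsto (fun N : ℕ => ENNReal.ofReal ‖ρ ^ N‖ * eLpNorm (f 0) 2 μ) atTop (𝓝 0) := by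
      have h1 : Tendsto (fun N : ℕ => ENNReal.ofReal ‖ρ ^ N‖) atTop (𝓝 0) := by
        simpa using ENNReal.tendsto_ofReal hpow
      have := ENNReal.Tendsto.mul_const h1 (Or.inr (hf 0).2.ne)
      simpa using this
    exact tendsto_of_tendsto_of_tendsto_of_le_of_le tendsto_const_nhds h0 (fun _ => zero_le) hle
  -- An almost sure limit along a subsequence is measurable for the past, up to a null set.
  obtain ⟨ns, -, hns⟩ := (tendstoInMeasure_of_tendsto_eLpNorm two_ne_zero hSm' (hf t).1
    hlim).exists_seq_tendsto_ae
  have hne : Nonempty H := ⟨0⟩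
  refine ⟨fun ω => limUnder atTop fun i => S (ns i) ω,
    @StronglyMeasurable.limUnder _ _ _ (pastAlgebra ε t) _ _ _ _ _ _ _ fun i => hSm (ns i), ?_⟩
  filter_upwards [hns] with ω hω
  exact hω.limUnder_eq.symm

omit [CompleteSpace H] [NormedAddCommGroup H] [InnerProductSpace ℝ H] [IsProbabilityMeasure μ]
  [BorelSpace H] [SecondCountableTopology H] in
/-- The current innovation is independent of the past. -/
lemma _root_.indepFun_of_aestronglyMeasurable_past {E : Type*} [TopologicalSpace E]
    [TopologicalSpace.PseudoMetrizableSpace E] [MeasurableSpace E] [BorelSpace E]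
    (hεm : ∀ t, Measurable (ε t)) (hind : iIndepFun ε μ) {t : ℤ} {X : Ω → E}
    (hX : AEStronglyMeasurable[pastAlgebra ε t] X μ) : IndepFun X (ε t) μ := by
  obtain ⟨X', hX', hXX'⟩ := hX
  have h1 : Indep (⨆ s ∈ Set.Iio t, MeasurableSpace.comap (ε s) inferInstance)
      (⨆ s ∈ ({t} : Set ℤ), MeasurableSpace.comap (ε s) inferInstance) μ :=
    indep_iSup_of_disjoint (fun s => (hεm s).comap_le) hind.iIndep (by simp)
  rw [iSup_singleton] at h1
  have h2 : IndepFun X' (ε t) μ := by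
    rw [IndepFun_iff_Indep]
    exact indep_of_indep_of_le_left h1 hX'.measurable.comap_le
  exact h2.congr hXX'.symm (EventuallyEq.refl _ _)

end IsStationarySolution

end Representation

/-! ### Sequences of mean size √n -/

section RootBounded

variable {Ω : Type*} [MeasurableSpace Ω] {μ : Measure Ω}

/-- The sequence `X n` is dominated, almost surely, by random variables whose means are
of order at most `√n`. -/
def IsRootBounded (μ : Measure Ω) (X : ℕ → Ω → ℝ) : Prop :=
  ∃ c : ℝ, 0 ≤ c ∧ ∀ n, ∃ G : Ω → ℝ, Integrable G μ ∧ (∀ᵐ ω ∂μ, X n ω ≤ G ω) ∧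
    ∫ ω, G ω ∂μ ≤ c * Real.sqrt ((n : ℝ) + 1)

namespace IsRootBounded

variable {X Y : ℕ → Ω → ℝ}

lemma mono (hY : IsRootBounded μ Y) (h : ∀ n, ∀ᵐ ω ∂μ, X n ω ≤ Y n ω) : IsRootBounded μ X := by
  obtain ⟨c, hc, hG⟩ := hY
  refine ⟨c, hc, fun n => ?_⟩
  obtain ⟨G, hGi, hGY, hGc⟩ := hG n
  refine ⟨G, hGi, ?_, hGc⟩
  filter_upwards [hGY, h n] with ω h1 h2 using h2.trans h1

lemma add (hX : IsRootBounded μ X) (hY : IsRootBounded μ Y) :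
    IsRootBounded μ fun n ω => X n ω + Y n ω := by
  obtain ⟨c, hc, hG⟩ := hX
  obtain ⟨c', hc', hG'⟩ := hY
  refine ⟨c + c', add_nonneg hc hc', fun n => ?_⟩
  obtain ⟨G, hGi, hGX, hGc⟩ := hG n
  obtain ⟨G', hGi', hGY, hGc'⟩ := hG' n
  refine ⟨fun ω => G ω + G' ω, hGi.add hGi', ?_, ?_⟩
  · filter_upwards [hGX, hGY] with ω h1 h2 using add_le_add h1 h2
  · rw [integral_add hGi hGi', add_mul]
    exact add_le_add hGc hGc'

lemma const_mul (hX : IsRootBounded μ X) {k : ℝ} (hk : 0 ≤ k) :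
    IsRootBounded μ fun n ω => k * X n ω := by
  obtain ⟨c, hc, hG⟩ := hX
  refine ⟨k * c, mul_nonneg hk hc, fun n => ?_⟩
  obtain ⟨G, hGi, hGX, hGc⟩ := hG n
  refine ⟨fun ω => k * G ω, hGi.const_mul k, ?_, ?_⟩
  · filter_upwards [hGX] with ω h1 using mul_le_mul_of_nonneg_left h1 hk
  · rw [integral_const_mul, mul_assoc]
    exact mul_le_mul_of_nonneg_left hGc hk

lemma comp_pred (hX : IsRootBounded μ X) : IsRootBounded μ fun n => X (n - 1) := by
  obtain ⟨c, hc, hG⟩ := hX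
  refine ⟨c, hc, fun n => ?_⟩
  obtain ⟨G, hGi, hGX, hGc⟩ := hG (n - 1)
  refine ⟨G, hGi, hGX, hGc.trans ?_⟩
  have : ((n - 1 : ℕ) : ℝ) ≤ n := by exact_mod_cast Nat.sub_le n 1
  gcongr

lemma of_integral_le {c : ℝ} (hc : 0 ≤ c) (hX : ∀ n, Integrable (X n) μ)
    (hXc : ∀ n, ∫ ω, X n ω ∂μ ≤ c) : IsRootBounded μ X := by
  refine ⟨c, hc, fun n => ⟨X n, hX n, Eventually.of_forall fun _ => le_rfl, (hXc n).trans ?_⟩⟩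
  refine le_mul_of_one_le_right hc ?_
  rw [Real.one_le_sqrt]
  linarith [n.cast_nonneg (α := ℝ)]

/-- Young's inequality x ≤ x²/r + r with r = √(n+1) supplies the dominating variable. -/
lemma of_integral_sq_le [IsProbabilityMeasure μ] {c : ℝ} (hc : 0 ≤ c)
    (hX : ∀ n, Integrable (fun ω => X n ω ^ 2) μ)
    (hXc : ∀ n : ℕ, ∫ ω, X n ω ^ 2 ∂μ ≤ c * ((n : ℝ) + 1)) : IsRootBounded μ X := by
  refine ⟨c + 1, by linarith, fun n => ?_⟩
  set r := Real.sqrt ((n : ℝ) + 1) with hr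
  have hn : (0 : ℝ) < (n : ℝ) + 1 := by positivity
  have hr0 : 0 < r := Real.sqrt_pos.2 hn
  have hrr : r * r = (n : ℝ) + 1 := Real.mul_self_sqrt hn.le
  refine ⟨fun ω => r⁻¹ * X n ω ^ 2 + r, ((hX n).const_mul _).add (integrable_const _),
    Eventually.of_forall fun ω => ?_, ?_⟩
  · have h1 : 0 ≤ r⁻¹ * (X n ω - r) ^ 2 := by positivity
    have h2 : r⁻¹ * (X n ω - r) ^ 2 = r⁻¹ * X n ω ^ 2 - 2 * X n ω + r := by
      field_simp
      ring
    have h3 : 0 ≤ r⁻¹ * X n ω ^ 2 := by positivity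
    by_cases h4 : 0 ≤ X n ω
    · linarith
    · linarith
  · rw [integral_add ((hX n).const_mul _) (integrable_const _), integral_const_mul, integral_const,
      probReal_univ, one_smul, add_mul, one_mul]
    refine add_le_add ?_ le_rfl
    rw [inv_mul_le_iff₀ hr0]
    calc _ ≤ c * ((n : ℝ) + 1) := hXc n
      _ = _ := by rw [← hrr]; ring

/-- A root bounded sequence is negligible with respect to `n a_n` when `√n a_n → ∞`. -/
lemma tendsto_measure [IsProbabilityMeasure μ] (hX : IsRootBounded μ X)
    (hX0 : ∀ n ω, 0 ≤ X n ω) {a : ℕ → ℝ}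
    (ha : Tendsto (fun n : ℕ => Real.sqrt n * a n) atTop atTop) {η : ℝ} (hη : 0 < η) :
    Tendsto (fun n : ℕ => μ {ω | η * (n * a n) ≤ X n ω}) atTop (𝓝 0) := by
  obtain ⟨c, hc, hG⟩ := hX
  have hlim : Tendsto (fun n : ℕ => ENNReal.ofReal (2 * c / η / (Real.sqrt n * a n))) atTop
      (𝓝 0) := by
    have := ENNReal.tendsto_ofReal (ha.const_div_atTop (2 * c / η))
    simpa using this
  refine tendsto_of_tendsto_of_tendsto_of_le_of_le' tendsto_const_nhds hlim
    (Eventually.of_forall fun _ => zero_le) ?_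
  filter_upwards [ha.eventually_gt_atTop 0, eventually_ge_atTop 1] with n hn hn1
  obtain ⟨G, hGi, hGX, hGc⟩ := hG n
  have hn1' : (1 : ℝ) ≤ n := by exact_mod_cast hn1
  set r := Real.sqrt n with hr
  have hr0 : 0 < r := Real.sqrt_pos.2 (by linarith)
  have hrr : r * r = n := Real.mul_self_sqrt (by linarith)
  -- This is where `n ≥ 1` enters; Markov's inequality then gives the bound.
  have hle : Real.sqrt ((n : ℝ) + 1) ≤ 2 * r := by
    rw [Real.sqrt_le_left (by positivity)]
    nlinarith
  have hG0 : 0 ≤ᵐ[μ] G := by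
    filter_upwards [hGX] with ω h using (hX0 n ω).trans h
  have hM := mul_meas_ge_le_integral_of_nonneg hG0 hGi (η * (n * a n))
  have hle2 : μ {ω | η * (n * a n) ≤ X n ω} ≤ μ {ω | η * (n * a n) ≤ G ω} := by
    refine measure_mono_ae ?_
    filter_upwards [hGX] with ω h h'
    exact le_trans h' h
  refine hle2.trans ?_
  rw [← ofReal_measureReal (measure_ne_top _ _)]
  refine ENNReal.ofReal_le_ofReal ?_
  rw [div_div, le_div_iff₀ (by positivity)]
  have h1 : r * (μ.real {ω | η * (n * a n) ≤ G ω} * (η * (r * a n))) ≤ r * (2 * c) := by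
    calc _ = η * (n * a n) * μ.real {ω | η * (n * a n) ≤ G ω} := by rw [← hrr]; ring
      _ ≤ c * Real.sqrt ((n : ℝ) + 1) := hM.trans hGc
      _ ≤ c * (2 * r) := by gcongr
      _ = _ := by ring
  exact le_of_mul_le_mul_left h1 hr0

end IsRootBounded

end RootBounded

/-! ### A priori bounds for fixed-point and Lyapunov equations -/

section Neumann

/-- A priori bound for the solutions of `x = Φ x + y`, when the powers of `Φ` tend to zero. -/
lemma exists_norm_le_of_eq_apply_add {E : Type*} [NormedAddCommGroup E] [NormedSpace ℝ E]
    (Φ : E →L[ℝ] E) (hΦ : Tendsto (fun k : ℕ => ‖Φ ^ k‖) atTop (𝓝 0)) :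
    ∃ κ : ℝ, 0 ≤ κ ∧ ∀ x y, x = Φ x + y → ‖x‖ ≤ κ * ‖y‖ := by
  -- Some power has norm at most 1/2; after that many iterations half of ‖x‖ is absorbed on the
  -- left.
  obtain ⟨k, hk⟩ := (hΦ.eventually_le_const (show (0 : ℝ) < 1 / 2 by norm_num)).exists
  refine ⟨2 * ∑ i ∈ Finset.range k, ‖Φ ^ i‖, by positivity, fun x y hxy => ?_⟩
  have hit : ∀ m : ℕ, x = (Φ ^ m) x + ∑ i ∈ Finset.range m, (Φ ^ i) y := by
    intro m
    induction m with
    | zero => simp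
    | succ m ih =>
      rw [Finset.sum_range_succ, pow_succ]
      have h1 : (Φ ^ m * Φ) x + (Φ ^ m) y = (Φ ^ m) x := by
        conv_rhs => rw [hxy, map_add]
        rfl
      conv_lhs => rw [ih, ← h1]
      abel
  have h1 : ‖x‖ ≤ 1 / 2 * ‖x‖ + (∑ i ∈ Finset.range k, ‖Φ ^ i‖) * ‖y‖ := by
    conv_lhs => rw [hit k]
    refine (norm_add_le _ _).trans (add_le_add (((Φ ^ k).le_opNorm x).trans ?_) ?_)
    · gcongr
    · rw [Finset.sum_mul]
      exact (norm_sum_le _ _).trans (Finset.sum_le_sum fun i _ => (Φ ^ i).le_opNorm y)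
  linarith

/-- The map X ↦ AXB has powers X ↦ AᵏXBᵏ, so its powers also tend to zero. With A = ρ and B = ρ* it
inverts the Lyapunov equation of the sample covariance. -/
lemma exists_norm_le_of_eq_comp_add {E : Type*} [NormedAddCommGroup E] [NormedSpace ℝ E]
    (A B : E →L[ℝ] E) (hA : Tendsto (fun k : ℕ => ‖A ^ k‖) atTop (𝓝 0))
    (hB : Tendsto (fun k : ℕ => ‖B ^ k‖) atTop (𝓝 0)) :
    ∃ κ : ℝ, 0 ≤ κ ∧ ∀ X Y : E →L[ℝ] E, X = A ∘L X ∘L B + Y → ‖X‖ ≤ κ * ‖Y‖ := by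
  set Φ := ContinuousLinearMap.mulLeftRight ℝ (E →L[ℝ] E) A B with hΦ
  have hk : ∀ (k : ℕ) X, (Φ ^ k) X = A ^ k * X * B ^ k := by
    intro k
    induction k with
    | zero => intro X; simp
    | succ k ih =>
      intro X
      rw [pow_succ]
      change (Φ ^ k) (Φ X) = _
      rw [ih, hΦ, ContinuousLinearMap.mulLeftRight_apply, pow_succ, pow_succ']
      simp only [mul_assoc]
  have hle : ∀ k : ℕ, ‖Φ ^ k‖ ≤ ‖A ^ k‖ * ‖B ^ k‖ := fun k => by
    refine ContinuousLinearMap.opNorm_le_bound _ (by positivity) fun X => ?_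
    rw [hk]
    calc _ ≤ ‖A ^ k‖ * ‖X‖ * ‖B ^ k‖ := norm_mul₃_le
      _ = _ := by ring
  obtain ⟨κ, hκ, h⟩ := exists_norm_le_of_eq_apply_add Φ
    (squeeze_zero (fun _ => norm_nonneg _) hle (by simpa using hA.mul hB))
  refine ⟨κ, hκ, fun X Y hXY => h X Y ?_⟩
  rw [hΦ, ContinuousLinearMap.mulLeftRight_apply]
  exact hXY

end Neumann

/-! ### Orthogonal random vectors -/

section Orthogonality

variable {E : Type*} [NormedAddCommGroup E] [InnerProductSpace ℝ E]
  {Ω : Type*} [MeasurableSpace Ω] {μ : Measure Ω}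

lemma MeasureTheory.MemLp.integrable_inner_two {X Y : Ω → E} (hX : MemLp X 2 μ)
    (hY : MemLp Y 2 μ) : Integrable (fun ω => ⟪X ω, Y ω⟫_ℝ) μ := by
  refine Integrable.mono' (hX.norm.integrable_mul hY.norm) (hX.1.inner hY.1) ?_
  exact Eventually.of_forall fun ω => norm_inner_le_norm _ _

/-- Pythagoras for orthogonal random vectors. -/
lemma integral_norm_sq_sum {ι : Type*} (s : Finset ι) {Z : ι → Ω → E}
    (hZ : ∀ i, MemLp (Z i) 2 μ)
    (horth : ∀ i ∈ s, ∀ j ∈ s, i ≠ j → ∫ ω, ⟪Z i ω, Z j ω⟫_ℝ ∂μ = 0) :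
    ∫ ω, ‖∑ i ∈ s, Z i ω‖ ^ 2 ∂μ = ∑ i ∈ s, ∫ ω, ‖Z i ω‖ ^ 2 ∂μ := by
  classical
  have h1 : ∀ ω, ‖∑ i ∈ s, Z i ω‖ ^ 2 = ∑ i ∈ s, ∑ j ∈ s, ⟪Z i ω, Z j ω⟫_ℝ := by
    intro ω
    rw [← real_inner_self_eq_norm_sq, sum_inner]
    simp_rw [inner_sum]
  simp_rw [h1]
  have hint : ∀ i j, Integrable (fun ω => ⟪Z i ω, Z j ω⟫_ℝ) μ := fun i j =>
    (hZ i).integrable_inner_two (hZ j)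
  rw [integral_finsetSum _ fun i _ => integrable_finsetSum _ fun j _ => hint i j]
  refine Finset.sum_congr rfl fun i hi => ?_
  rw [integral_finsetSum _ fun j _ => hint i j, Finset.sum_eq_single i]
  · simp_rw [real_inner_self_eq_norm_sq]
  · exact fun j hj hji => horth i hi j hj hji.symm
  · exact fun h => (h hi).elim

end Orthogonality

/-! ### Hilbert–Schmidt norms through the tensor square -/

section Tensor

open TensorProduct

variable {H : Type*} [NormedAddCommGroup H] [InnerProductSpace ℝ H]

/-- The Hilbert space tensor square, which models the Hilbert–Schmidt operators. -/
def HilbertTensorSquare (H : Type*) [NormedAddCommGroup H] [InnerProductSpace ℝ H] : Type _ :=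
  UniformSpace.Completion (H ⊗[ℝ] H)

instance : NormedAddCommGroup (HilbertTensorSquare H) :=
  inferInstanceAs (NormedAddCommGroup (UniformSpace.Completion (H ⊗[ℝ] H)))

instance : InnerProductSpace ℝ (HilbertTensorSquare H) :=
  inferInstanceAs (InnerProductSpace ℝ (UniformSpace.Completion (H ⊗[ℝ] H)))

instance : CompleteSpace (HilbertTensorSquare H) :=
  inferInstanceAs (CompleteSpace (UniformSpace.Completion (H ⊗[ℝ] H)))

/-- The elementary tensor `x ⊗ y`. -/
def pureTensor (x y : H) : HilbertTensorSquare H :=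
  ((x ⊗ₜ[ℝ] y : H ⊗[ℝ] H) : UniformSpace.Completion (H ⊗[ℝ] H))

lemma inner_pureTensor (x y z w : H) :
    ⟪pureTensor x y, pureTensor z w⟫_ℝ = ⟪x, z⟫_ℝ * ⟪y, w⟫_ℝ :=
  (UniformSpace.Completion.inner_coe (𝕜 := ℝ) (x ⊗ₜ[ℝ] y : H ⊗[ℝ] H) (z ⊗ₜ[ℝ] w)).trans
    (TensorProduct.inner_tmul ℝ x z y w)

lemma norm_pureTensor (x y : H) : ‖pureTensor x y‖ = ‖x‖ * ‖y‖ :=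
  (UniformSpace.Completion.norm_coe (x ⊗ₜ[ℝ] y : H ⊗[ℝ] H)).trans (TensorProduct.norm_tmul x y)

lemma continuous_pureTensor : Continuous fun p : H × H => pureTensor p.1 p.2 :=
  (UniformSpace.Completion.continuous_coe _).comp TensorProduct.continuous_tmul

/-- The operator norm is dominated by the Hilbert–Schmidt norm. -/
lemma opNorm_le_norm_of_inner_eq {X : H →L[ℝ] H} {τ : HilbertTensorSquare H}
    (h : ∀ z w, ⟪X w, z⟫_ℝ = ⟪τ, pureTensor z w⟫_ℝ) : ‖X‖ ≤ ‖τ‖ := by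
  refine ContinuousLinearMap.opNorm_le_bound _ (norm_nonneg _) fun w => ?_
  have h1 : ‖X w‖ * ‖X w‖ ≤ ‖τ‖ * ‖w‖ * ‖X w‖ := by
    rw [← real_inner_self_eq_norm_mul_norm, h]
    refine (real_inner_le_norm _ _).trans_eq ?_
    rw [norm_pureTensor]
    ring
  by_cases h0 : ‖X w‖ = 0
  · rw [h0]; positivity
  · exact le_of_mul_le_mul_right h1 (lt_of_le_of_ne (norm_nonneg _) (Ne.symm h0))

/-- Passing to the tensor square allows Pythagoras, which the operator norm does not satisfy. -/
lemma norm_sum_rankOne_le {ι : Type*} (s : Finset ι) (x y : ι → H) :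
    ‖∑ i ∈ s, rankOne ℝ (x i) (y i)‖ ≤ ‖∑ i ∈ s, pureTensor (x i) (y i)‖ := by
  refine opNorm_le_norm_of_inner_eq fun z w => ?_
  rw [_root_.sum_apply, sum_inner, sum_inner]
  refine Finset.sum_congr rfl fun i _ => ?_
  rw [inner_pureTensor, rankOne_apply, real_inner_smul_left, mul_comm]

end Tensor

/-! ### Second and fourth moments -/

section Moments

instance instHolderTripleFourFourTwo : ENNReal.HolderTriple 4 4 2 := by
  refine ⟨?_⟩
  rw [← two_mul, show (4 : ENNReal) = 2 * 2 by norm_num,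
    ENNReal.mul_inv (Or.inl two_ne_zero) (Or.inl ENNReal.ofNat_ne_top), ← mul_assoc,
    ENNReal.mul_inv_cancel two_ne_zero ENNReal.ofNat_ne_top, one_mul]

variable {Ω : Type*} [MeasurableSpace Ω] {μ : Measure Ω}

lemma MeasureTheory.MemLp.integrable_norm_sq {E : Type*} [NormedAddCommGroup E] {X : Ω → E}
    (hX : MemLp X 2 μ) : Integrable (fun ω => ‖X ω‖ ^ 2) μ :=
  (memLp_two_iff_integrable_sq_norm hX.1).1 hX

lemma integral_norm_sq_eq_toReal {E : Type*} [NormedAddCommGroup E] {X : Ω → E}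
    (hX : AEStronglyMeasurable X μ) :
    ∫ ω, ‖X ω‖ ^ 2 ∂μ = (eLpNorm X 2 μ ^ 2).toReal := by
  rw [eLpNorm_two_sq, integral_eq_lintegral_of_nonneg_ae
    (Eventually.of_forall fun _ => sq_nonneg _) (hX.norm.pow 2)]
  congr 1
  refine lintegral_congr fun ω => ?_
  rw [← ofReal_norm, ENNReal.ofReal_pow (norm_nonneg _)]

variable {H : Type*} [NormedAddCommGroup H] [InnerProductSpace ℝ H]

omit [NormedAddCommGroup H] [InnerProductSpace ℝ H] in
lemma Continuous.comp_aestronglyMeasurable_prodMk [TopologicalSpace H] {F : Type*}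
    [TopologicalSpace F] {g : H × H → F} (hg : Continuous g) {X Y : Ω → H}
    (hX : AEStronglyMeasurable X μ) (hY : AEStronglyMeasurable Y μ) :
    AEStronglyMeasurable (fun ω => g (X ω, Y ω)) μ :=
  hg.comp_aestronglyMeasurable (hX.prodMk hY)

lemma aestronglyMeasurable_pureTensor {X Y : Ω → H} (hX : AEStronglyMeasurable X μ)
    (hY : AEStronglyMeasurable Y μ) :
    AEStronglyMeasurable (fun ω => pureTensor (X ω) (Y ω)) μ :=
  continuous_pureTensor.comp_aestronglyMeasurable_prodMk hX hY

omit [InnerProductSpace ℝ H] in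
lemma memLp_norm_mul_norm {X Y : Ω → H} (hX : MemLp X 4 μ) (hY : MemLp Y 4 μ) :
    MemLp (fun ω => ‖X ω‖ * ‖Y ω‖) 2 μ :=
  hY.norm.mul hX.norm

lemma memLp_pureTensor {X Y : Ω → H} (hX : MemLp X 4 μ) (hY : MemLp Y 4 μ) :
    MemLp (fun ω => pureTensor (X ω) (Y ω)) 2 μ := by
  refine (memLp_norm_mul_norm hX hY).mono' (aestronglyMeasurable_pureTensor hX.1 hY.1) ?_
  exact Eventually.of_forall fun ω => (norm_pureTensor _ _).le

/-- Sums of `n` orthogonal random vectors with bounded second moments have size `√n`. -/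
lemma integrable_and_integral_norm_sq_sum_le [IsProbabilityMeasure μ] {E : Type*}
    [NormedAddCommGroup E] [InnerProductSpace ℝ E] {Z : ℤ → Ω → E} (hZ : ∀ t, MemLp (Z t) 2 μ)
    (horth : ∀ s t, s < t → ∫ ω, ⟪Z s ω, Z t ω⟫_ℝ ∂μ = 0) {c : ℝ}
    (hc : ∀ t, ∫ ω, ‖Z t ω‖ ^ 2 ∂μ ≤ c) (n : ℕ) :
    Integrable (fun ω => ‖∑ i ∈ Finset.Icc 1 n, Z i ω‖ ^ 2) μ ∧
      ∫ ω, ‖∑ i ∈ Finset.Icc 1 n, Z i ω‖ ^ 2 ∂μ ≤ c * n := by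
  have h1 : MemLp (fun ω => ∑ i ∈ Finset.Icc 1 n, Z i ω) 2 μ :=
    memLp_finsetSum _ fun i _ => hZ i
  refine ⟨h1.integrable_norm_sq, ?_⟩
  rw [integral_norm_sq_sum _ fun i : ℕ => hZ i]
  · calc _ ≤ ∑ i ∈ Finset.Icc 1 n, c := Finset.sum_le_sum fun i _ => hc i
      _ = c * n := by simp [mul_comm]
  · intro i _ j _ hij
    rcases lt_or_gt_of_ne hij with h | h
    · exact horth i j (by exact_mod_cast h)
    · rw [← horth j i (by exact_mod_cast h)]
      simp_rw [real_inner_comm]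

end Moments

/-! ### Fluctuations of products with the innovations -/

section Rates

variable {H : Type*} [NormedAddCommGroup H] [InnerProductSpace ℝ H] [CompleteSpace H]
  [MeasurableSpace H] [BorelSpace H] [SecondCountableTopology H]
  {Ω : Type*} [MeasurableSpace Ω] {μ : Measure Ω} [IsProbabilityMeasure μ]
  {ρ : H →L[ℝ] H} {ε f : ℤ → Ω → H}

namespace IsStationarySolution

omit [MeasurableSpace H] [BorelSpace H] in
lemma integral_norm_sq_eq (hs : IsStationarySolution μ ρ ε f)
    (hm : ∀ t, ∫ ω, f t ω ∂μ = 0) (t : ℤ) :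
    ∫ ω, ‖f t ω‖ ^ 2 ∂μ = ∫ ω, ‖f 0 ω‖ ^ 2 ∂μ := by
  rw [integral_norm_sq_eq_toReal (hs.stationary.memLp t).1,
    integral_norm_sq_eq_toReal (hs.stationary.memLp 0).1, hs.eLpNorm_eq hm t]

omit [CompleteSpace H] [MeasurableSpace H] [BorelSpace H] [SecondCountableTopology H]
  [IsProbabilityMeasure μ] in
lemma memLp_innovation (hs : IsStationarySolution μ ρ ε f) {p : ENNReal}
    (hp : ∀ t, MemLp (f t) p μ) (t : ℤ) : MemLp (ε t) p μ := by
  have h1 : MemLp (fun ω => f (t + 1) ω - ρ (f t ω)) p μ :=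
    (hp (t + 1)).sub (ρ.comp_memLp' (hp t))
  refine h1.ae_eq ?_
  filter_upwards [hs.recursion t] with ω hω
  rw [hω, add_sub_cancel_left]

omit [SecondCountableTopology H] [CompleteSpace H] [IsProbabilityMeasure μ] in
lemma _root_.IsStrongWhiteNoise.integral_norm_sq_eq (hε : IsStrongWhiteNoise μ ε) (t : ℤ) :
    ∫ ω, ‖ε t ω‖ ^ 2 ∂μ = ∫ ω, ‖ε 0 ω‖ ^ 2 ∂μ :=
  ((hε.identDistrib t 0).comp (u := fun x => ‖x‖ ^ 2)
    (measurable_norm.pow_const 2)).integral_eq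

omit [SecondCountableTopology H] in
/-- The innovation is orthogonal to every integrable function of its past. -/
lemma _root_.IsStrongWhiteNoise.integral_inner_eq_zero (hε : IsStrongWhiteNoise μ ε)
    (hεm : ∀ t, Measurable (ε t)) {t : ℤ} {X : Ω → H}
    (hX : AEStronglyMeasurable[pastAlgebra ε t] X μ) (hXi : Integrable X μ) :
    ∫ ω, ⟪X ω, ε t ω⟫_ℝ ∂μ = 0 := by
  have h1 := (indepFun_of_aestronglyMeasurable_past hεm hε.indep hX).integral_bilin hXi
    ((hε.memLp t).integrable one_le_two) (innerSL ℝ)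
  rw [hε.mean_zero t, map_zero] at h1
  exact h1

omit [SecondCountableTopology H] in
lemma _root_.IsStrongWhiteNoise.sum_bound (hε : IsStrongWhiteNoise μ ε) (n : ℕ) :
    Integrable (fun ω => ‖∑ i ∈ Finset.Icc 1 n, ε i ω‖ ^ 2) μ ∧
      ∫ ω, ‖∑ i ∈ Finset.Icc 1 n, ε i ω‖ ^ 2 ∂μ ≤ (∫ ω, ‖ε 0 ω‖ ^ 2 ∂μ) * n := by
  refine integrable_and_integral_norm_sq_sum_le hε.memLp (fun s t hst => ?_)
    (fun t => (hε.integral_norm_sq_eq t).le) n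
  have h1 := (hε.indep.indepFun hst.ne).integral_bilin ((hε.memLp s).integrable one_le_two)
    ((hε.memLp t).integrable one_le_two) (innerSL ℝ)
  rw [hε.mean_zero t, map_zero] at h1
  exact h1

/-- The martingale part `∑ ε_i ⊗ f_i` has size `√n`. -/
lemma isRootBounded_cross (hs : IsStationarySolution μ ρ ε f) (hε : IsStrongWhiteNoise μ ε)
    (hεm : ∀ t, Measurable (ε t)) (hpow : Tendsto (fun k : ℕ => ‖ρ ^ k‖) atTop (𝓝 0))
    (hf4 : ∀ t, MemLp (f t) 4 μ) :
    IsRootBounded μ fun n ω => ‖∑ i ∈ Finset.Icc 1 n, rankOne ℝ (ε i ω) (f i ω)‖ := by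
  have hm := hs.integral_eq_zero hε.memLp hε.mean_zero hpow
  have hpast := hs.aestronglyMeasurable_past hεm hm hpow
  have hε4 := hs.memLp_innovation hf4
  set Z : ℤ → Ω → HilbertTensorSquare H := fun t ω => pureTensor (ε t ω) (f t ω) with hZ
  have hZ2 : ∀ t, MemLp (Z t) 2 μ := fun t => memLp_pureTensor (hε4 t) (hf4 t)
  -- The product factors as ⟨ε_s, ε_t⟩⟨f_s, f_t⟩ = ⟨X, ε_t⟩ with X = ⟨f_s, f_t⟩ ε_s, which depends
  -- only on the past of `t`.
  have horth : ∀ s t, s < t → ∫ ω, ⟪Z s ω, Z t ω⟫_ℝ ∂μ = 0 := by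
    intro s t hst
    have hin : MemLp (fun ω => ⟪f s ω, f t ω⟫_ℝ) 2 μ := by
      have h1 : MemLp ((fun ω => ‖f s ω‖) * fun ω => ‖f t ω‖) 2 μ := (hf4 t).norm.mul (hf4 s).norm
      refine h1.mono' ((hf4 s).1.inner (hf4 t).1) ?_
      exact Eventually.of_forall fun ω => norm_inner_le_norm _ _
    have hXi : Integrable ((fun ω => ⟪f s ω, f t ω⟫_ℝ) • ε s) μ :=
      memLp_one_iff_integrable.1 ((hε.memLp s).smul hin)
    have hX : AEStronglyMeasurable[pastAlgebra ε t] ((fun ω => ⟪f s ω, f t ω⟫_ℝ) • ε s) μ :=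
      (((hpast s).mono (pastAlgebra_mono ε hst.le)).inner (hpast t)).smul
        (stronglyMeasurable_pastAlgebra ε hst).aestronglyMeasurable
    rw [← hε.integral_inner_eq_zero hεm hX hXi]
    refine integral_congr_ae (Eventually.of_forall fun ω => ?_)
    simp only [hZ, inner_pureTensor, Pi.smul_apply', real_inner_smul_left]
    ring
  have hc : ∀ t, ∫ ω, ‖Z t ω‖ ^ 2 ∂μ ≤ (∫ ω, ‖f 0 ω‖ ^ 2 ∂μ) * ∫ ω, ‖ε 0 ω‖ ^ 2 ∂μ := by
    intro t
    have hind : IndepFun (fun ω => ‖f t ω‖ ^ 2) (fun ω => ‖ε t ω‖ ^ 2) μ :=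
      (indepFun_of_aestronglyMeasurable_past hεm hε.indep (hpast t)).comp
        (φ := fun x => ‖x‖ ^ 2) (ψ := fun x => ‖x‖ ^ 2) (measurable_norm.pow_const 2)
        (measurable_norm.pow_const 2)
    rw [← hs.integral_norm_sq_eq hm t, ← hε.integral_norm_sq_eq t,
      ← hind.integral_fun_mul_eq_mul_integral ((hf4 t).1.norm.pow 2) ((hε.memLp t).1.norm.pow 2)]
    refine (integral_congr_ae (Eventually.of_forall fun ω => ?_)).le
    simp only [hZ, norm_pureTensor]
    ring
  have hsum := integrable_and_integral_norm_sq_sum_le hZ2 horth hc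
  refine IsRootBounded.mono (IsRootBounded.of_integral_sq_le
    (c := (∫ ω, ‖f 0 ω‖ ^ 2 ∂μ) * ∫ ω, ‖ε 0 ω‖ ^ 2 ∂μ) (by positivity)
    (fun n => (hsum n).1) (fun n => (hsum n).2.trans ?_))
    fun n => Eventually.of_forall fun ω => norm_sum_rankOne_le _ _ _
  gcongr
  linarith

omit [SecondCountableTopology H] in
/-- The fluctuations of the empirical covariance of the innovations have size `√n`. -/
lemma _root_.IsStrongWhiteNoise.isRootBounded_cov (hε : IsStrongWhiteNoise μ ε)
    (hε4 : ∀ t, MemLp (ε t) 4 μ) :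
    IsRootBounded μ fun n ω => ‖∑ i ∈ Finset.Icc 1 n,
      (rankOne ℝ (ε i ω) (ε i ω) - crossCov μ (ε 0) (ε 0))‖ := by
  let _ : MeasurableSpace (HilbertTensorSquare H) := borel _
  have _ : BorelSpace (HilbertTensorSquare H) := ⟨rfl⟩
  set P : H → HilbertTensorSquare H := fun x => pureTensor x x with hP
  have hPc : Continuous P := continuous_pureTensor.comp (continuous_id.prodMk continuous_id)
  have hPε : ∀ t, MemLp (fun ω => P (ε t ω)) 2 μ := fun t => memLp_pureTensor (hε4 t) (hε4 t)
  -- The mean taken in the tensor square represents the noise covariance operator, so centring there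
  -- matches centring the operators.
  set τ := ∫ ω, P (ε 0 ω) ∂μ with hτ
  have hmean : ∀ t, ∫ ω, P (ε t ω) ∂μ = τ := fun t =>
    ((hε.identDistrib t 0).comp hPc.measurable).integral_eq
  set Z : ℤ → Ω → HilbertTensorSquare H := fun t ω => P (ε t ω) - τ with hZ
  have hZ2 : ∀ t, MemLp (Z t) 2 μ := fun t => (hPε t).sub (memLp_const _)
  have hZ0 : ∀ t, ∫ ω, Z t ω ∂μ = 0 := fun t => by
    rw [hZ, integral_sub ((hPε t).integrable one_le_two) (integrable_const _), hmean t]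
    simp
  have hPm : Measurable fun x => P x - τ := (hPc.sub continuous_const).measurable
  have horth : ∀ s t, s < t → ∫ ω, ⟪Z s ω, Z t ω⟫_ℝ ∂μ = 0 := by
    intro s t hst
    have h1 := ((hε.indep.indepFun hst.ne).comp hPm hPm).integral_bilin
      ((hZ2 s).integrable one_le_two) ((hZ2 t).integrable one_le_two) (innerSL ℝ)
    have h2 : ∫ ω, ((fun x => P x - τ) ∘ ε t) ω ∂μ = 0 := hZ0 t
    rw [h2, map_zero] at h1
    exact h1
  have hc : ∀ t, ∫ ω, ‖Z t ω‖ ^ 2 ∂μ ≤ ∫ ω, ‖Z 0 ω‖ ^ 2 ∂μ := fun t =>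
    ((hε.identDistrib t 0).comp (u := fun x => ‖P x - τ‖ ^ 2)
      ((hPc.sub continuous_const).norm.pow 2).measurable).integral_eq.le
  have hsum := integrable_and_integral_norm_sq_sum_le hZ2 horth hc
  refine IsRootBounded.mono (IsRootBounded.of_integral_sq_le
    (c := ∫ ω, ‖Z 0 ω‖ ^ 2 ∂μ) (by positivity)
    (fun n => (hsum n).1) (fun n => (hsum n).2.trans ?_))
    fun n => Eventually.of_forall fun ω => ?_
  · gcongr
    linarith
  · refine opNorm_le_norm_of_inner_eq fun z w => ?_
    rw [_root_.sum_apply, sum_inner, sum_inner]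
    refine Finset.sum_congr rfl fun i _ => ?_
    have h1 : ⟪crossCov μ (ε 0) (ε 0) w, z⟫_ℝ = ⟪τ, pureTensor z w⟫_ℝ := by
      rw [inner_crossCov (hε.memLp 0) (hε.memLp 0), hτ, real_inner_comm,
        ← integral_inner ((hPε 0).integrable one_le_two)]
      refine integral_congr_ae (Eventually.of_forall fun ω => ?_)
      simp only [hP]
      rw [hε.mean_zero, sub_zero, real_inner_comm (pureTensor _ _), inner_pureTensor, mul_comm,
        real_inner_comm w]
    simp only [hZ, hP]
    rw [sub_apply, inner_sub_left, inner_sub_left, h1, inner_pureTensor, rankOne_apply,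
      real_inner_smul_left, mul_comm]

end IsStationarySolution

end Rates

/-! ### Telescoping -/

section Telescope

/-- Only two boundary terms distinguish a sum from its shift; this closes the recursions for the
sums of f and of f ⊗ f. -/
lemma sum_Icc_shift {E : Type*} [AddCommGroup E] (g : ℤ → E) (n : ℕ) :
    ∑ i ∈ Finset.Icc 1 n, g ((i : ℤ) + 1) =
      ∑ i ∈ Finset.Icc 1 n, g i - g 1 + g ((n : ℤ) + 1) := by
  induction n with
  | zero => simp
  | succ n ih =>
    rw [Finset.sum_Icc_succ_top (by omega), Finset.sum_Icc_succ_top (by omega), ih]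
    push_cast
    abel

end Telescope

/-! ### Root-n rates for the empirical operators -/

section Consistency

variable {H : Type*} [NormedAddCommGroup H] [InnerProductSpace ℝ H] [CompleteSpace H]
  [MeasurableSpace H] [BorelSpace H] [SecondCountableTopology H]
  {Ω : Type*} [MeasurableSpace Ω] {μ : Measure Ω} [IsProbabilityMeasure μ]
  {ρ : H →L[ℝ] H} {ε f : ℤ → Ω → H}

namespace IsStationarySolution

omit [MeasurableSpace H] [BorelSpace H] in
lemma isRootBounded_norm_sq_succ (hs : IsStationarySolution μ ρ ε f)
    (hm : ∀ t, ∫ ω, f t ω ∂μ = 0) :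
    IsRootBounded μ fun n ω => ‖f 1 ω‖ ^ 2 + ‖f ((n : ℤ) + 1) ω‖ ^ 2 := by
  have hint := fun t => (hs.stationary.memLp t).integrable_norm_sq
  refine IsRootBounded.of_integral_le (c := 2 * ∫ ω, ‖f 0 ω‖ ^ 2 ∂μ) (by positivity)
    (fun n => (hint _).add (hint _)) fun n => ?_
  rw [integral_add (hint _) (hint _), hs.integral_norm_sq_eq hm 1,
    hs.integral_norm_sq_eq hm ((n : ℤ) + 1)]
  linarith

/-- The sample mean, multiplied by `√n`, is bounded in mean square. -/
lemma isRootBounded_sum_sq (hs : IsStationarySolution μ ρ ε f) (hε : IsStrongWhiteNoise μ ε)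
    (hpow : Tendsto (fun k : ℕ => ‖ρ ^ k‖) atTop (𝓝 0)) :
    IsRootBounded μ fun n ω => ‖∑ i ∈ Finset.Icc 1 n, f i ω‖ ^ 2 / n := by
  have hm := hs.integral_eq_zero hε.memLp hε.mean_zero hpow
  obtain ⟨κ, hκ, hsol⟩ := exists_norm_le_of_eq_apply_add ρ hpow
  have hint := fun t => (hs.stationary.memLp t).integrable_norm_sq
  set K := ∫ ω, ‖f 0 ω‖ ^ 2 ∂μ with hK
  set K' := ∫ ω, ‖ε 0 ω‖ ^ 2 ∂μ with hK'
  have hK0 : 0 ≤ K := by positivity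
  have hK0' : 0 ≤ K' := by positivity
  have hEi := fun n => (hε.sum_bound n).1
  have hGi : ∀ n : ℕ, Integrable (fun ω => ‖f 1 ω‖ ^ 2 + ‖f ((n : ℤ) + 1) ω‖ ^ 2 +
      ‖∑ i ∈ Finset.Icc 1 n, ε i ω‖ ^ 2) μ := fun n => ((hint _).add (hint _)).add (hEi n)
  refine IsRootBounded.mono (IsRootBounded.of_integral_le (c := κ ^ 2 * 3 * (2 * K + K'))
    (X := fun n ω => κ ^ 2 * 3 / n * (‖f 1 ω‖ ^ 2 + ‖f ((n : ℤ) + 1) ω‖ ^ 2 +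
      ‖∑ i ∈ Finset.Icc 1 n, ε i ω‖ ^ 2)) (by positivity) (fun n => (hGi n).const_mul _)
      fun n => ?_) fun n => ?_
  · have hfi : Integrable (fun ω => ‖f 1 ω‖ ^ 2 + ‖f ((n : ℤ) + 1) ω‖ ^ 2) μ :=
      (hint _).add (hint _)
    rw [integral_const_mul, integral_add hfi (hEi n), integral_add (hint _) (hint _),
      hs.integral_norm_sq_eq hm 1, hs.integral_norm_sq_eq hm ((n : ℤ) + 1)]
    rcases Nat.eq_zero_or_pos n with rfl | hn
    · simp only [Nat.cast_zero, div_zero, zero_mul]; positivity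
    have hn' : (1 : ℝ) ≤ n := by exact_mod_cast hn
    have h1 := (hε.sum_bound n).2
    rw [div_mul_eq_mul_div, div_le_iff₀ (by linarith), mul_assoc (κ ^ 2 * 3)]
    gcongr
    nlinarith
  · have hrec : ∀ᵐ ω ∂μ, ∀ t, f (t + 1) ω = ρ (f t ω) + ε t ω := ae_all_iff.2 hs.recursion
    filter_upwards [hrec] with ω hω
    set S := ∑ i ∈ Finset.Icc 1 n, f i ω with hS
    set E := ∑ i ∈ Finset.Icc 1 n, ε i ω with hE
    -- The summed recursion is a fixed-point equation for the partial sum, driven by boundary terms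
    -- and the noise.
    have h1 : S = ρ S + (f 1 ω - f ((n : ℤ) + 1) ω + E) := by
      have h2 := sum_Icc_shift (fun t => f t ω) n
      simp_rw [hω, Finset.sum_add_distrib, ← map_sum] at h2
      rw [hω (n : ℤ)]
      have h3 : S = ρ S + E + f 1 ω - (ρ (f n ω) + ε n ω) := by
        rw [hS, hE, h2]; abel
      rw [add_sub_assoc, add_assoc] at h3
      conv_lhs => rw [h3]
      abel
    have h4 := hsol _ _ h1
    have h5 : ‖f 1 ω - f ((n : ℤ) + 1) ω + E‖ ≤ ‖f 1 ω‖ + ‖f ((n : ℤ) + 1) ω‖ + ‖E‖ :=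
      (norm_add_le _ _).trans (add_le_add (norm_sub_le _ _) le_rfl)
    have h6 : ‖S‖ ^ 2 ≤ κ ^ 2 * 3 * (‖f 1 ω‖ ^ 2 + ‖f ((n : ℤ) + 1) ω‖ ^ 2 + ‖E‖ ^ 2) := by
      calc ‖S‖ ^ 2 ≤ (κ * (‖f 1 ω‖ + ‖f ((n : ℤ) + 1) ω‖ + ‖E‖)) ^ 2 := by
            gcongr
            exact h4.trans (by gcongr)
        _ = κ ^ 2 * (‖f 1 ω‖ + ‖f ((n : ℤ) + 1) ω‖ + ‖E‖) ^ 2 := by ring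
        _ ≤ κ ^ 2 * (3 * (‖f 1 ω‖ ^ 2 + ‖f ((n : ℤ) + 1) ω‖ ^ 2 + ‖E‖ ^ 2)) := by
            gcongr
            nlinarith [sq_nonneg (‖f 1 ω‖ - ‖f ((n : ℤ) + 1) ω‖), sq_nonneg (‖f 1 ω‖ - ‖E‖),
              sq_nonneg (‖f ((n : ℤ) + 1) ω‖ - ‖E‖)]
        _ = _ := by ring
    rw [div_mul_eq_mul_div]
    gcongr

/-- The fluctuations of `∑ f_i ⊗ f_i` have size `√n`. -/
lemma isRootBounded_cov (hs : IsStationarySolution μ ρ ε f) (hε : IsStrongWhiteNoise μ ε)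
    (hεm : ∀ t, Measurable (ε t)) (hpow : Tendsto (fun k : ℕ => ‖ρ ^ k‖) atTop (𝓝 0))
    (hf4 : ∀ t, MemLp (f t) 4 μ) :
    IsRootBounded μ fun n ω =>
      ‖∑ i ∈ Finset.Icc 1 n, (rankOne ℝ (f i ω) (f i ω) - covOp μ f)‖ := by
  have hm := hs.integral_eq_zero hε.memLp hε.mean_zero hpow
  set A := ContinuousLinearMap.adjoint ρ with hA
  have hpowA : Tendsto (fun k : ℕ => ‖A ^ k‖) atTop (𝓝 0) := by
    refine hpow.congr fun k => ?_
    have h1 : A ^ k = ContinuousLinearMap.adjoint (ρ ^ k) := (star_pow ρ k).symm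
    rw [h1]
    exact (LinearIsometryEquiv.norm_map ContinuousLinearMap.adjoint (ρ ^ k)).symm
  obtain ⟨κ, hκ, hsol⟩ := exists_norm_le_of_eq_comp_add ρ A hpow hpowA
  refine IsRootBounded.mono (((hs.isRootBounded_norm_sq_succ hm).add
    (((hs.isRootBounded_cross hε hεm hpow hf4).const_mul (k := 2 * ‖ρ‖) (by positivity)).add
      (hε.isRootBounded_cov (hs.memLp_innovation hf4)))).const_mul hκ) fun n => ?_
  have hrec : ∀ᵐ ω ∂μ, ∀ t, f (t + 1) ω = ρ (f t ω) + ε t ω := ae_all_iff.2 hs.recursion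
  filter_upwards [hrec] with ω hω
  set W := ∑ i ∈ Finset.Icc 1 n, (rankOne ℝ (f i ω) (f i ω) - covOp μ f) with hW
  set M := ∑ i ∈ Finset.Icc 1 n, rankOne ℝ (ε i ω) (f i ω) with hM
  set V := ∑ i ∈ Finset.Icc 1 n, (rankOne ℝ (ε i ω) (ε i ω) - crossCov μ (ε 0) (ε 0)) with hV
  -- Expand (ρf + ε) ⊗ (ρf + ε) and subtract the stationary covariance equation; the mixed terms are
  -- a martingale part and its adjoint.
  have hstep : ∀ t, rankOne ℝ (f (t + 1) ω) (f (t + 1) ω) - covOp μ f =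
      ρ ∘L (rankOne ℝ (f t ω) (f t ω) - covOp μ f) ∘L A +
        (rankOne ℝ (ε t ω) (f t ω) ∘L A +
          ContinuousLinearMap.adjoint (rankOne ℝ (ε t ω) (f t ω) ∘L A) +
          (rankOne ℝ (ε t ω) (ε t ω) - crossCov μ (ε 0) (ε 0))) := by
    intro t
    conv_lhs => rw [hω t, hs.covOp_eq hε.memLp 0, ← hA]
    rw [rankOne_comp, hA, ContinuousLinearMap.adjoint_adjoint, adjoint_rankOne,
      ContinuousLinearMap.sub_comp, ContinuousLinearMap.comp_sub, rankOne_comp,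
      ContinuousLinearMap.adjoint_adjoint, comp_rankOne]
    simp only [map_add, add_apply]
    abel
  have h1 : W = ρ ∘L W ∘L A + (rankOne ℝ (f 1 ω) (f 1 ω) -
      rankOne ℝ (f ((n : ℤ) + 1) ω) (f ((n : ℤ) + 1) ω) +
      (M ∘L A + ContinuousLinearMap.adjoint (M ∘L A) + V)) := by
    have h2 := sum_Icc_shift (fun t => rankOne ℝ (f t ω) (f t ω) - covOp μ f) n
    have h3 : ∑ i ∈ Finset.Icc 1 n, (rankOne ℝ (f ((i : ℤ) + 1) ω) (f ((i : ℤ) + 1) ω) -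
        covOp μ f) = ρ ∘L W ∘L A + (M ∘L A + ContinuousLinearMap.adjoint (M ∘L A) + V) := by
      simp_rw [hstep, Finset.sum_add_distrib]
      rw [hW, hM, hV, ContinuousLinearMap.finsetSum_comp, ContinuousLinearMap.comp_finsetSum,
        ContinuousLinearMap.finsetSum_comp, map_sum]
    rw [h3] at h2
    have h4 : W = (ρ ∘L W ∘L A + (M ∘L A + ContinuousLinearMap.adjoint (M ∘L A) + V)) +
        (rankOne ℝ (f 1 ω) (f 1 ω) - covOp μ f) -
        (rankOne ℝ (f ((n : ℤ) + 1) ω) (f ((n : ℤ) + 1) ω) - covOp μ f) := by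
      rw [h2]; abel
    rw [add_sub_assoc] at h4
    conv_lhs => rw [h4]
    abel
  have hMA : ‖M ∘L A‖ ≤ ‖ρ‖ * ‖M‖ := by
    have h2 : ‖A‖ = ‖ρ‖ := LinearIsometryEquiv.norm_map ContinuousLinearMap.adjoint ρ
    rw [← h2, mul_comm]
    exact ContinuousLinearMap.opNorm_comp_le _ _
  have hMA' : ‖ContinuousLinearMap.adjoint (M ∘L A)‖ = ‖M ∘L A‖ :=
    LinearIsometryEquiv.norm_map ContinuousLinearMap.adjoint _
  refine (hsol _ _ h1).trans ?_
  gcongr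
  calc _ ≤ ‖rankOne ℝ (f 1 ω) (f 1 ω)‖ + ‖rankOne ℝ (f ((n : ℤ) + 1) ω) (f ((n : ℤ) + 1) ω)‖ +
        (‖M ∘L A‖ + ‖ContinuousLinearMap.adjoint (M ∘L A)‖ + ‖V‖) :=
        (norm_add_le _ _).trans (add_le_add (norm_sub_le _ _) (norm_add₃_le))
    _ ≤ _ := by
        rw [norm_rankOne, norm_rankOne, hMA', sq, sq]
        linarith

/-- The errors of the empirical covariance and cross-covariance operators have size `1 / √n`. -/
lemma isRootBounded_emp (hs : IsStationarySolution μ ρ ε f) (hε : IsStrongWhiteNoise μ ε)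
    (hεm : ∀ t, Measurable (ε t)) (hpow : Tendsto (fun k : ℕ => ‖ρ ^ k‖) atTop (𝓝 0))
    (hf4 : ∀ t, MemLp (f t) 4 μ) :
    IsRootBounded μ fun n ω => if 2 ≤ n then n * (‖empCov f n ω - covOp μ f‖ +
      ‖empCrossCov f n ω - ρ ∘L covOp μ f‖) else 0 := by
  have hW := hs.isRootBounded_cov hε hεm hpow hf4
  have hS := hs.isRootBounded_sum_sq hε hpow
  have hM := hs.isRootBounded_cross hε hεm hpow hf4
  refine IsRootBounded.mono ((hW.add hS).add ((((hW.comp_pred.const_mul (norm_nonneg ρ)).add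
    hM.comp_pred).const_mul (k := 2) zero_le_two).add hS)) fun n => ?_
  have hrec : ∀ᵐ ω ∂μ, ∀ t, f (t + 1) ω = ρ (f t ω) + ε t ω := ae_all_iff.2 hs.recursion
  filter_upwards [hrec] with ω hω
  split_ifs with hn
  swap
  · positivity
  have hn' : (2 : ℝ) ≤ n := by exact_mod_cast hn
  have hn0 : (n : ℝ) ≠ 0 := by linarith
  have hn1 : (0 : ℝ) < (n : ℝ) - 1 := by linarith
  have hcast : ((n - 1 : ℕ) : ℝ) = (n : ℝ) - 1 := by
    rw [Nat.cast_sub (by omega), Nat.cast_one]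
  set S := ∑ i ∈ Finset.Icc 1 n, f i ω with hSdef
  set W := ∑ i ∈ Finset.Icc 1 n, (rankOne ℝ (f i ω) (f i ω) - covOp μ f) with hWdef
  set W' := ∑ i ∈ Finset.Icc 1 (n - 1), (rankOne ℝ (f i ω) (f i ω) - covOp μ f) with hWdef'
  set M := ∑ i ∈ Finset.Icc 1 (n - 1), rankOne ℝ (ε i ω) (f i ω) with hMdef
  have hmean : rankOne ℝ (sampleMean f n ω) (sampleMean f n ω) =
      ((1 / (n : ℝ)) * (1 / n)) • rankOne ℝ S S := by
    rw [sampleMean, ← hSdef, map_smul, map_smul, smul_apply, smul_smul]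
  have hmn : ‖((1 / (n : ℝ)) * (1 / n)) • rankOne ℝ S S‖ = (1 / n) * (‖S‖ ^ 2 / n) := by
    rw [norm_smul, norm_rankOne, Real.norm_of_nonneg (by positivity)]
    ring
  have h1 : empCov f n ω - covOp μ f =
      (1 / (n : ℝ)) • W - ((1 / (n : ℝ)) * (1 / n)) • rankOne ℝ S S := by
    rw [empCov, hmean, hWdef, Finset.sum_sub_distrib, Finset.sum_const, Nat.card_Icc,
      Nat.add_sub_cancel, ← Nat.cast_smul_eq_nsmul ℝ, smul_sub, smul_smul,
      one_div_mul_cancel hn0, one_smul]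
    abel
  have h2 : empCrossCov f n ω - ρ ∘L covOp μ f =
      (1 / ((n : ℝ) - 1)) • (ρ ∘L W' + M) - ((1 / (n : ℝ)) * (1 / n)) • rankOne ℝ S S := by
    have h3 : ρ ∘L W' + M = ∑ i ∈ Finset.Icc 1 (n - 1), rankOne ℝ (f ((i : ℤ) + 1) ω) (f i ω) -
        ((n : ℝ) - 1) • (ρ ∘L covOp μ f) := by
      rw [hWdef', hMdef, Finset.sum_sub_distrib, Finset.sum_const, Nat.card_Icc,
        Nat.add_sub_cancel, ContinuousLinearMap.comp_sub, ContinuousLinearMap.comp_finsetSum,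
        ← Nat.cast_smul_eq_nsmul ℝ, hcast, ContinuousLinearMap.comp_smul]
      simp_rw [hω, map_add, add_apply, Finset.sum_add_distrib, comp_rankOne]
      abel
    rw [empCrossCov, hmean, h3, smul_sub, smul_smul, one_div_mul_cancel hn1.ne', one_smul]
    abel
  have e1 : n * ‖empCov f n ω - covOp μ f‖ ≤ ‖W‖ + ‖S‖ ^ 2 / n := by
    calc _ ≤ (n : ℝ) * ((1 / n) * ‖W‖ + (1 / n) * (‖S‖ ^ 2 / n)) := by
          rw [h1]
          gcongr
          refine (norm_sub_le _ _).trans_eq ?_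
          rw [hmn, norm_smul, Real.norm_of_nonneg (by positivity)]
      _ = _ := by
          field_simp
  have e2 : n * ‖empCrossCov f n ω - ρ ∘L covOp μ f‖ ≤
      2 * (‖ρ‖ * ‖W'‖ + ‖M‖) + ‖S‖ ^ 2 / n := by
    have h4 : ‖ρ ∘L W' + M‖ ≤ ‖ρ‖ * ‖W'‖ + ‖M‖ :=
      (norm_add_le _ _).trans (add_le_add (ContinuousLinearMap.opNorm_comp_le _ _) le_rfl)
    calc _ ≤ (n : ℝ) * ((1 / ((n : ℝ) - 1)) * (‖ρ‖ * ‖W'‖ + ‖M‖) + (1 / n) * (‖S‖ ^ 2 / n)) := by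
          rw [h2]
          gcongr
          refine (norm_sub_le _ _).trans ?_
          rw [hmn, norm_smul, Real.norm_of_nonneg (by positivity)]
          gcongr
      _ = (n / ((n : ℝ) - 1)) * (‖ρ‖ * ‖W'‖ + ‖M‖) + ‖S‖ ^ 2 / n := by
          field_simp
      _ ≤ _ := by
          gcongr
          -- For `n ≥ 2` the factor n/(n-1) is at most 2.
          rw [div_le_iff₀ hn1]
          linarith
  rw [mul_add]
  exact add_le_add e1 e2

end IsStationarySolution

end Consistency

/-! ### The regularised empirical pencil -/

section Empirical

variable {H : Type*} [NormedAddCommGroup H] [InnerProductSpace ℝ H] {Ω : Type*}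

lemma inner_sum_rankOne {ι : Type*} (s : Finset ι) (x : ι → H) (g h : H) :
    ⟪(∑ i ∈ s, rankOne ℝ (x i) (x i)) g, h⟫_ℝ = ∑ i ∈ s, ⟪x i, g⟫_ℝ * ⟪x i, h⟫_ℝ := by
  rw [_root_.sum_apply, sum_inner]
  simp_rw [rankOne_apply, real_inner_smul_left]

lemma inner_empCov (f : ℤ → Ω → H) (n : ℕ) (ω : Ω) (g h : H) :
    ⟪empCov f n ω g, h⟫_ℝ = (1 / (n : ℝ)) * ∑ i ∈ Finset.Icc 1 n, ⟪f i ω, g⟫_ℝ * ⟪f i ω, h⟫_ℝ -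
      ⟪sampleMean f n ω, g⟫_ℝ * ⟪sampleMean f n ω, h⟫_ℝ := by
  rw [empCov, sub_apply, smul_apply, inner_sub_left, real_inner_smul_left, inner_sum_rankOne,
    rankOne_apply, real_inner_smul_left]

lemma empCov_symm (f : ℤ → Ω → H) (n : ℕ) (ω : Ω) (x y : H) :
    ⟪empCov f n ω x, y⟫_ℝ = ⟪x, empCov f n ω y⟫_ℝ := by
  rw [real_inner_comm _ x, inner_empCov, inner_empCov]
  congr 1
  · simp_rw [mul_comm]
  · exact mul_comm _ _

/-- The square of a mean is at most the mean of the squares; for `n = 0` every term vanishes. -/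
lemma inner_empCov_self_nonneg (f : ℤ → Ω → H) (n : ℕ) (ω : Ω) (x : H) :
    0 ≤ ⟪empCov f n ω x, x⟫_ℝ := by
  rw [inner_empCov]
  have h1 : ⟪sampleMean f n ω, x⟫_ℝ = (1 / (n : ℝ)) * ∑ i ∈ Finset.Icc 1 n, ⟪f i ω, x⟫_ℝ := by
    rw [sampleMean, real_inner_smul_left, sum_inner]
  rw [h1]
  rcases Nat.eq_zero_or_pos n with rfl | hn
  · simp
  have hn' : (0 : ℝ) < n := by exact_mod_cast hn
  have h2 := sq_sum_le_card_mul_sum_sq (s := Finset.Icc 1 n) (f := fun i : ℕ => ⟪f i ω, x⟫_ℝ)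
  rw [Nat.card_Icc, Nat.add_sub_cancel] at h2
  simp_rw [← sq]
  rw [mul_pow, sub_nonneg]
  calc _ ≤ (1 / (n : ℝ)) ^ 2 * (n * ∑ i ∈ Finset.Icc 1 n, ⟪f i ω, x⟫_ℝ ^ 2) := by gcongr
    _ = _ := by field_simp

lemma regCov_symm (f : ℤ → Ω → H) (n : ℕ) (a : ℝ) (ω : Ω) (x y : H) :
    ⟪regCov f n a ω x, y⟫_ℝ = ⟪x, regCov f n a ω y⟫_ℝ := by
  simp [regCov, inner_add_left, inner_add_right, empCov_symm, real_inner_smul_left,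
    real_inner_smul_right]

lemma mul_norm_sq_le_inner_regCov (f : ℤ → Ω → H) (n : ℕ) (a : ℝ) (ω : Ω) (x : H) :
    a * ‖x‖ ^ 2 ≤ ⟪regCov f n a ω x, x⟫_ℝ := by
  have h1 : ⟪regCov f n a ω x, x⟫_ℝ = ⟪empCov f n ω x, x⟫_ℝ + a * ‖x‖ ^ 2 := by
    simp [regCov, inner_add_left, real_inner_smul_left]
  rw [h1]
  linarith [inner_empCov_self_nonneg f n ω x]

/-- The operator has finite rank for every `n`; when `n ≤ 1` the sum is empty. -/
lemma isCompactOperator_empCrossCov (f : ℤ → Ω → H) (n : ℕ) (ω : Ω) :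
    IsCompactOperator (empCrossCov f n ω) := by
  have h1 : IsCompactOperator
      (∑ i ∈ Finset.Icc 1 (n - 1), rankOne ℝ (f (i + 1) ω) (f i ω) : H →L[ℝ] H) :=
    isCompactOperator_sum _ fun i : ℕ => isCompactOperator_rankOne _ _
  exact (h1.smul (1 / ((n : ℝ) - 1))).sub (isCompactOperator_rankOne _ _)

variable [CompleteSpace H]

/-- Lax–Milgram: a coercive operator is invertible. -/
lemma exists_inverse_of_coercive {T : H →L[ℝ] H} {a : ℝ} (ha : 0 < a)
    (hT : ∀ x, a * ‖x‖ ^ 2 ≤ ⟪T x, x⟫_ℝ) :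
    ∃ S : H →L[ℝ] H, (∀ x, S (T x) = x) ∧ ∀ x, T (S x) = x := by
  set B : H →L[ℝ] H →L[ℝ] ℝ := innerSL ℝ ∘L T with hB
  have hco : IsCoercive B := ⟨a, ha, fun x => by
    have := hT x
    rw [sq, ← mul_assoc] at this
    exact this⟩
  have hTe : ∀ x, hco.continuousLinearEquivOfBilin x = T x := fun x =>
    (hco.unique_continuousLinearEquivOfBilin fun w => rfl).symm
  refine ⟨hco.continuousLinearEquivOfBilin.symm, fun x => ?_, fun x => ?_⟩
  · rw [← hTe]
    exact hco.continuousLinearEquivOfBilin.symm_apply_apply x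
  · rw [← hTe]
    exact hco.continuousLinearEquivOfBilin.apply_symm_apply x

/-- Take R = D T⁻¹: then RT = D, and symmetry of T gives T R* R T = D* D. -/
lemma exists_isCompactPencil_of_coercive {T D : H →L[ℝ] H} {a : ℝ} (ha : 0 < a)
    (hsymm : ∀ x y, ⟪T x, y⟫_ℝ = ⟪x, T y⟫_ℝ) (hT : ∀ x, a * ‖x‖ ^ 2 ≤ ⟪T x, x⟫_ℝ)
    (hD : IsCompactOperator D) :
    ∃ R : H →L[ℝ] H, IsCompactPencil (ContinuousLinearMap.adjoint D ∘L D) T R ∧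
      ∀ x, R (T x) = D x := by
  obtain ⟨S, hST, hTS⟩ := exists_inverse_of_coercive ha hT
  have hRT : ∀ x, (D ∘L S) (T x) = D x := fun x => by
    rw [ContinuousLinearMap.comp_apply, hST]
  refine ⟨D ∘L S, ⟨hsymm, fun x hx => ?_, hD.comp_clm S, fun x => ?_⟩, hRT⟩
  · have := norm_pos_iff.2 hx
    exact lt_of_lt_of_le (by positivity) (hT x)
  · rw [hRT]
    refine ext_inner_right ℝ fun y => ?_
    rw [hsymm, ContinuousLinearMap.adjoint_inner_left, hRT, ContinuousLinearMap.comp_apply,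
      ContinuousLinearMap.adjoint_inner_left]

/-- The regularised empirical pencil is compact. -/
lemma exists_isCompactPencil_emp (f : ℤ → Ω → H) (n : ℕ) {a : ℝ} (ha : 0 < a) (ω : Ω) :
    ∃ R : H →L[ℝ] H, IsCompactPencil (empCrossCovSq f n ω) (regCov f n a ω) R ∧
      ∀ x, R (regCov f n a ω x) = empCrossCov f n ω x :=
  exists_isCompactPencil_of_coercive ha (regCov_symm f n a ω)
    (mul_norm_sq_le_inner_regCov f n a ω) (isCompactOperator_empCrossCov f n ω)

omit [CompleteSpace H] in
/-- The empirical pencil is close to a pencil `(B, ρ)` when the covariance operators are. -/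
lemma isClosePencil_emp (B ρ : H →L[ℝ] H) {f : ℤ → Ω → H} {n : ℕ} {a : ℝ} (ha : 0 < a)
    {ω : Ω} {R : H →L[ℝ] H} (hR : ∀ x, R (regCov f n a ω x) = empCrossCov f n ω x) :
    IsClosePencil B ρ (regCov f n a ω) R a
      ((‖empCov f n ω - B‖ + ‖empCrossCov f n ω - ρ ∘L B‖) / a) where
  a_pos := ha
  e_nonneg := by positivity
  form x := by
    have h1 : regCov f n a ω x - B x - a • x = (empCov f n ω - B) x := by
      simp only [regCov, add_apply, smul_apply, sub_apply, ContinuousLinearMap.id_apply]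
      abel
    rw [h1, div_mul_cancel₀ _ ha.ne']
    refine ((empCov f n ω - B).le_opNorm x).trans ?_
    gcongr
    exact le_add_of_nonneg_right (norm_nonneg _)
  root x := by
    rw [hR, div_mul_cancel₀ _ ha.ne']
    refine ((empCrossCov f n ω - ρ ∘L B).le_opNorm x).trans ?_
    gcongr
    exact le_add_of_nonneg_left (norm_nonneg _)

end Empirical

/-! ### From deterministic limits to convergence in probability -/

section Transfer

variable {Ω : Type*} [MeasurableSpace Ω] {μ : Measure Ω}

/-- Deterministic continuity in a random error `e` that is asymptotically negligible yields
convergence in measure. -/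
lemma tendstoInMeasure_of_tendsto_comap {e : ℕ → Ω → ℝ} (he0 : ∀ n ω, 0 ≤ e n ω)
    (he : ∀ η : ℝ, 0 < η → Tendsto (fun n => μ {ω | η ≤ e n ω}) atTop (𝓝 0))
    {X : ℕ → Ω → ℝ} {x : ℝ}
    (hX : Tendsto (fun p : ℕ × Ω => X p.1 p.2)
      (comap Prod.fst atTop ⊓ comap (fun p : ℕ × Ω => e p.1 p.2) (𝓝 0)) (𝓝 x)) :
    TendstoInMeasure μ X atTop fun _ => x := by
  rw [tendstoInMeasure_iff_dist]
  intro δ hδ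
  have h1 := hX (Metric.ball_mem_nhds x hδ)
  -- A basic set of the filter is {n ≥ N, |e| < η}, so for n ≥ N a deviation of size δ forces e ≥ η.
  rw [mem_map, ((atTop_basis.comap Prod.fst).inf (Metric.nhds_basis_ball.comap _)).mem_iff] at h1
  obtain ⟨⟨N, η⟩, ⟨-, hη⟩, hsub⟩ := h1
  refine tendsto_of_tendsto_of_tendsto_of_le_of_le' tendsto_const_nhds (he η hη)
    (Eventually.of_forall fun _ => zero_le) ?_
  filter_upwards [eventually_ge_atTop N] with n hn
  refine measure_mono fun ω hω => ?_
  by_contra hc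
  have h2 : (n, ω) ∈ Prod.fst ⁻¹' Set.Ici N ∩
      (fun p : ℕ × Ω => e p.1 p.2) ⁻¹' Metric.ball 0 η := by
    refine ⟨hn, ?_⟩
    simp only [Set.mem_preimage, Metric.mem_ball, dist_zero_right, Real.norm_eq_abs,
      abs_of_nonneg (he0 n ω)]
    exact not_le.1 hc
  have h3 : dist (X n ω) x < δ := hsub h2
  exact absurd h3 (not_lt.2 hω)

end Transfer

/-! ### Changing the innovations on null sets -/

section Modification

variable {H : Type*} [NormedAddCommGroup H] [InnerProductSpace ℝ H] [MeasurableSpace H]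
  {Ω : Type*} [MeasurableSpace Ω] {μ : Measure Ω} {ρ : H →L[ℝ] H} {ε ε' f : ℤ → Ω → H}

lemma IsStrongWhiteNoise.congr (hε : IsStrongWhiteNoise μ ε) (h : ∀ t, ε t =ᵐ[μ] ε' t) :
    IsStrongWhiteNoise μ ε' where
  memLp t := (hε.memLp t).ae_eq (h t)
  pos t := by
    have h1 : ∫ ω, ‖ε t ω‖ ^ 2 ∂μ = ∫ ω, ‖ε' t ω‖ ^ 2 ∂μ :=
      integral_congr_ae ((h t).fun_comp fun x => ‖x‖ ^ 2)
    exact h1 ▸ hε.pos t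
  mean_zero t := by rw [← integral_congr_ae (h t), hε.mean_zero t]
  indep := hε.indep.congr h
  identDistrib s t :=
    ((IdentDistrib.of_ae_eq (hε.identDistrib s t).aemeasurable_fst (h s)).symm.trans
      (hε.identDistrib s t)).trans
      (IdentDistrib.of_ae_eq (hε.identDistrib s t).aemeasurable_snd (h t))

omit [MeasurableSpace H] in
lemma IsStationarySolution.congr [CompleteSpace H] [IsProbabilityMeasure μ]
    (hs : IsStationarySolution μ ρ ε f) (h : ∀ t, ε t =ᵐ[μ] ε' t) :
    IsStationarySolution μ ρ ε' f where
  stationary := hs.stationary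
  recursion t := by
    filter_upwards [hs.recursion t, h t] with ω h1 h2
    rw [h1, h2]
  innovation t := by
    rw [← hs.innovation t]
    exact crossCov_congr_ae (EventuallyEq.refl _ _) (h t).symm

end Modification

/-! ### Assembly -/

section Consistency

variable {H : Type*} [NormedAddCommGroup H] [InnerProductSpace ℝ H] [CompleteSpace H]
  [MeasurableSpace H] [BorelSpace H] [SecondCountableTopology H]
  {Ω : Type*} [MeasurableSpace Ω] {μ : Measure Ω} [IsProbabilityMeasure μ]
  {ρ : H →L[ℝ] H} {ε f : ℤ → Ω → H}

/-- As log n ≥ 1 for n ≥ 3 > e, dividing by it only decreases the root. -/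
lemma tendsto_sqrt_mul_atTop {α : ℕ → ℝ} (hα : ∀ n, 0 < α n)
    (hαn : Tendsto (fun n : ℕ => Real.sqrt ((n : ℝ) / Real.log n) * α n) atTop atTop) :
    Tendsto (fun n : ℕ => Real.sqrt n * α n) atTop atTop := by
  refine tendsto_atTop_mono' _ ?_ hαn
  filter_upwards [eventually_ge_atTop 3] with n hn
  have hn' : (3 : ℝ) ≤ n := by exact_mod_cast hn
  have hlog : 1 ≤ Real.log n := by
    rw [Real.le_log_iff_exp_le (by linarith)]
    exact (Real.exp_one_lt_d9.le.trans (by norm_num)).trans hn'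
  have h0 := (hα n).le
  gcongr
  exact div_le_self (by linarith) hlog

/-- The estimation errors of the covariance operators are negligible with respect to the
regularisation parameter. -/
theorem DefinesStationaryProcess.tendsto_measure_emp (hf : DefinesStationaryProcess μ ρ ε f)
    (hε : IsStrongWhiteNoise μ ε) (hρ : IsCompactOperator (ContinuousLinearMap.adjoint ρ))
    (hpos : ∀ x, x ≠ 0 → 0 < ⟪covOp μ f x, x⟫_ℝ) (hf4 : ∀ t, MemLp (f t) 4 μ)
    {α : ℕ → ℝ} (hα : ∀ n, 0 < α n)
    (hαn : Tendsto (fun n : ℕ => Real.sqrt n * α n) atTop atTop) {η : ℝ} (hη : 0 < η) :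
    Tendsto (fun n : ℕ => μ {ω | η ≤ (‖empCov f n ω - covOp μ f‖ +
      ‖empCrossCov f n ω - ρ ∘L covOp μ f‖) / α n}) atTop (𝓝 0) := by
  have hpow := hf.tendsto_norm_pow hε hρ hpos
  -- The noise is only almost everywhere strongly measurable, whereas the σ-algebras of the past
  -- need measurable representatives.
  set ε' : ℤ → Ω → H := fun t => (hε.memLp t).1.mk (ε t) with hε'
  have hεε' : ∀ t, ε t =ᵐ[μ] ε' t := fun t => (hε.memLp t).1.ae_eq_mk
  have hεm : ∀ t, Measurable (ε' t) := fun t =>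
    (hε.memLp t).1.stronglyMeasurable_mk.measurable
  have hX := (hf.1.congr hεε').isRootBounded_emp (hε.congr hεε') hεm hpow hf4
  have h1 := hX.tendsto_measure (fun n ω => by positivity) hαn hη
  refine tendsto_of_tendsto_of_tendsto_of_le_of_le' tendsto_const_nhds h1
    (Eventually.of_forall fun _ => zero_le) ?_
  filter_upwards [eventually_ge_atTop 2] with n hn
  refine measure_mono fun ω hω => ?_
  rw [Set.mem_ofPred_eq, le_div_iff₀ (hα n)] at hω
  rw [Set.mem_ofPred_eq, if_pos hn]
  calc η * (n * α n) = n * (η * α n) := by ring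
    _ ≤ _ := by gcongr

/-- Consistency of the eigenvalues and eigenvectors of the regularised empirical pencil, for
autoregressive processes in a separable Hilbert space. -/
theorem DefinesStationaryProcess.consistency (hf : DefinesStationaryProcess μ ρ ε f)
    (hH : ¬ FiniteDimensional ℝ H) (hε : IsStrongWhiteNoise μ ε) (hρ : IsCompactOperator ρ)
    (hρ' : IsCompactOperator (ContinuousLinearMap.adjoint ρ)) (hf4 : ∀ t, MemLp (f t) 4 μ)
    (hpos : ∀ x, x ≠ 0 → 0 < ⟪covOp μ f x, x⟫_ℝ)
    (hdist : ∀ (i j : ℕ) (l : ℝ), IsPencilEigenvalue (crossCovSq μ f) (covOp μ f) i l →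
      IsPencilEigenvalue (crossCovSq μ f) (covOp μ f) j l → i = j)
    {α : ℕ → ℝ} (hα : ∀ n, 0 < α n) (hα0 : Tendsto α atTop (𝓝 0))
    (hαn : Tendsto (fun n : ℕ => Real.sqrt n * α n) atTop atTop) :
    ∀ j : ℕ, 1 ≤ j →
      (∃ l : ℝ, IsPencilEigenvalue (crossCovSq μ f) (covOp μ f) j l) ∧
      (∀ (n : ℕ) (ω : Ω), ∃ l : ℝ,
        IsPencilEigenvalue (empCrossCovSq f n ω) (regCov f n (α n) ω) j l) ∧
      ∀ (l : ℝ) (lhat : ℕ → Ω → ℝ),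
        IsPencilEigenvalue (crossCovSq μ f) (covOp μ f) j l →
        (∀ n ω, IsPencilEigenvalue (empCrossCovSq f n ω) (regCov f n (α n) ω) j (lhat n ω)) →
        TendstoInMeasure μ lhat atTop (fun _ => l) ∧
        ∀ (b : H) (bhat : ℕ → Ω → H),
          IsNormalizedEigenvector (crossCovSq μ f) (covOp μ f) l b →
          (∀ n ω, IsNormalizedEigenvector (empCrossCovSq f n ω) (regCov f n (α n) ω)
            (lhat n ω) (bhat n ω)) →
          ∃ s : ℕ → Ω → ℝ, (∀ n ω, s n ω = 1 ∨ s n ω = -1) ∧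
            TendstoInMeasure μ
              (fun n ω => ⟪covOp μ f (s n ω • bhat n ω - b), s n ω • bhat n ω - b⟫_ℝ)
              atTop (fun _ => 0) := by
  have hP := hf.1.isCompactPencil hε.memLp hρ hpos
  choose R hR hRB using fun (n : ℕ) (ω : Ω) => exists_isCompactPencil_emp f n (hα n) ω
  intro j hj
  refine ⟨hP.exists_isPencilEigenvalue hH hj,
    fun n ω => (hR n ω).exists_isPencilEigenvalue hH hj, fun l lhat hl hlhat => ?_⟩
  set e : ℕ → Ω → ℝ := fun n ω => (‖empCov f n ω - covOp μ f‖ +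
    ‖empCrossCov f n ω - ρ ∘L covOp μ f‖) / α n with he
  have he0 : ∀ n ω, 0 ≤ e n ω := fun n ω => div_nonneg (by positivity) (hα n).le
  have hem : ∀ η : ℝ, 0 < η → Tendsto (fun n => μ {ω | η ≤ e n ω}) atTop (𝓝 0) := fun η hη =>
    hf.tendsto_measure_emp hε hρ' hpos hf4 hα hαn hη
  -- Along this filter the perturbation theorems apply with index (n, ω), and no measurability of
  -- the chosen eigenvalues or eigenvectors is required.
  set F : Filter (ℕ × Ω) := comap Prod.fst atTop ⊓ comap (fun p : ℕ × Ω => e p.1 p.2) (𝓝 0)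
    with hF
  have hαF : Tendsto (fun p : ℕ × Ω => α p.1) F (𝓝 0) :=
    hα0.comp (tendsto_comap.mono_left inf_le_left)
  have heF : Tendsto (fun p : ℕ × Ω => e p.1 p.2) F (𝓝 0) := tendsto_comap.mono_left inf_le_right
  have hclose : ∀ p : ℕ × Ω, IsClosePencil (covOp μ f) ρ (regCov f p.1 (α p.1) p.2) (R p.1 p.2)
      (α p.1) (e p.1 p.2) := fun p => isClosePencil_emp _ _ (hα p.1) (hRB p.1 p.2)
  have hval : Tendsto (fun p : ℕ × Ω => lhat p.1 p.2) F (𝓝 l) :=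
    hP.tendsto_eigenvalue (fun p : ℕ × Ω => hR p.1 p.2) hclose hαF heF hl
      fun p : ℕ × Ω => hlhat p.1 p.2
  refine ⟨tendstoInMeasure_of_tendsto_comap he0 hem hval, fun b bhat hb hbhat => ?_⟩
  obtain ⟨l', hl', hl'0, hfd', hgap⟩ := hP.exists_gap hH hdist hl hb
  have hfd : FiniteDimensional ℝ (eigenspanGT (crossCovSq μ f) (covOp μ f) l) :=
    finiteDimensional_of_rank_lt hl.1
  classical
  -- The sign makes the pairing of the empirical eigenvector with `b` nonnegative.
  refine ⟨fun n ω => if 0 ≤ ⟪covOp μ f (bhat n ω), b⟫_ℝ then 1 else -1, fun n ω => ?_, ?_⟩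
  · by_cases h : 0 ≤ ⟪covOp μ f (bhat n ω), b⟫_ℝ
    · exact Or.inl (if_pos h)
    · exact Or.inr (if_neg h)
  · exact tendstoInMeasure_of_tendsto_comap he0 hem
      (hP.tendsto_eigenvector (fun p : ℕ × Ω => hR p.1 p.2) hclose hαF heF hval
        (fun p : ℕ × Ω => hbhat p.1 p.2) hl' hl'0 hb hgap fun p => rfl)

end Consistency

end

theorem theorem3 {Ω : Type*} [MeasurableSpace Ω] (μ : Measure Ω) [IsProbabilityMeasure μ]
    (T : ℝ) (hT : 0 < T)
    -- model (A): Hilbert–Schmidt integral operator, strong white noise, weakly stationary process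
    (ρ : L2Interval T →L[ℝ] L2Interval T) (hρ : IsHilbertSchmidtIntegralOperator T ρ)
    (ε f : ℤ → Ω → L2Interval T) (hε : IsStrongWhiteNoise μ ε)
    (hf : DefinesStationaryProcess μ ρ ε f)
    (hf4 : ∀ t, MemLp (f t) 4 μ)
    -- the covariance operator is positive definite
    (hpos : ∀ x : L2Interval T, x ≠ 0 → 0 < ⟪covOp μ f x, x⟫_ℝ)
    -- the eigenvalues, listed with multiplicity, are distinct
    (hdist : ∀ (i j : ℕ) (l : ℝ), IsPencilEigenvalue (crossCovSq μ f) (covOp μ f) i l →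
      IsPencilEigenvalue (crossCovSq μ f) (covOp μ f) j l → i = j)
    -- the regularisation parameter
    (α : ℕ → ℝ) (hα : ∀ n, 0 < α n) (hα0 : Tendsto α atTop (𝓝 0))
    (hαn : Tendsto (fun n : ℕ => Real.sqrt ((n : ℝ) / Real.log n) * α n) atTop atTop) :
    ∀ j : ℕ, 1 ≤ j →
      -- the `j`-th eigenvalues exist
      (∃ l : ℝ, IsPencilEigenvalue (crossCovSq μ f) (covOp μ f) j l) ∧
      (∀ (n : ℕ) (ω : Ω), ∃ l : ℝ,
        IsPencilEigenvalue (empCrossCovSq f n ω) (regCov f n (α n) ω) j l) ∧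
      ∀ (l : ℝ) (lhat : ℕ → Ω → ℝ),
        IsPencilEigenvalue (crossCovSq μ f) (covOp μ f) j l →
        (∀ n ω, IsPencilEigenvalue (empCrossCovSq f n ω) (regCov f n (α n) ω) j (lhat n ω)) →
        -- convergence of the eigenvalues
        TendstoInMeasure μ lhat atTop (fun _ => l) ∧
        -- convergence of the normalised eigenvectors, up to sign
        ∀ (b : L2Interval T) (bhat : ℕ → Ω → L2Interval T),
          IsNormalizedEigenvector (crossCovSq μ f) (covOp μ f) l b →
          (∀ n ω, IsNormalizedEigenvector (empCrossCovSq f n ω) (regCov f n (α n) ω)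
            (lhat n ω) (bhat n ω)) →
          ∃ s : ℕ → Ω → ℝ, (∀ n ω, s n ω = 1 ∨ s n ω = -1) ∧
            TendstoInMeasure μ
              (fun n ω => ⟪covOp μ f (s n ω • bhat n ω - b), s n ω • bhat n ω - b⟫_ℝ)
              atTop (fun _ => 0) := by
  exact hf.consistency (not_finiteDimensional_L2Interval hT) hε hρ.isCompactOperator
    hρ.isCompactOperator_adjoint hf4 hpos hdist hα hα0 (tendsto_sqrt_mul_atTop hα hαn)
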